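/- **Setting.** Let $\Omega\subset\mathbb R^3$ be a bounded open set with $\Omega=\operatorname{int}\overline\Omega$ (for instance a bounded Lipschitz polyhedral domain). Let $\mathcal T_h$ be a finite partition of $\overline\Omega$ into polyhedra $T$ of arbitrary shape (finite unions of nondegenerate tetrahedra) with pairwise disjoint interiors. Let $\mathcal E_h$ be the finite set of its faces: flat polygons (finite unions of nondegenerate triangles) with pairwise disjoint relative interiors, such that each $\partial T$ is a union of faces, $T$ lies locally on one side of each of its faces, and each face belongs to some $T$. Let ${\bf n}$ be the outward unit normal on $\partial T$, let ${\bf t}_1,{\bf t}_2$ be orthonormal tangent vectors assigned to each face $e$, and let $h=\max_T\operatorname{diam}T$. Let $k\ge1$, and let $P_r$ denote polynomials of degree at most $r$. Put $$V_h=\{\{{\bf v}_0,{\bf v}_b=v_1{\bf t}_1+v_2{\bf t}_2\}:\ {\bf v}_0|_T\in[P_k(T)]^3,\ v_1|_e,v_2|_e\in P_k(e)\},$$ $$W_h=\{\{w_0,w_b\}:\ w_0|_T\in P_{k-1}(T),\ w_b|_e\in P_k(e),\ w_b=0\text{ on }\partial\Omega\},$$ with one value of ${\bf v}_b$ and $w_b$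 on each face, and $V_{h,0}=\{{\bf v}\in V_h:\ {\bf v}_b\times{\bf n}=0\text{ on }\partial\Omega\}$. For $w\in W_h$ and ${\bf v}\in V_h$ let $\nabla_w w|_T\in[P_k(T)]^3$ and $\nabla_w\times{\bf v}|_T\in[P_{k-1}(T)]^3$ be the unique polynomials with $$(\nabla_w w,{\bf q})_T=-(w_0,\nabla\cdot{\bf q})_T+\langle w_b,{\bf q}\cdot{\bf n}\rangle_{\partial T}\quad\forall{\bf q}\in[P_k(T)]^3,$$ $$(\nabla_w\times{\bf v},{\bf q})_T=({\bf v}_0,\nabla\times{\bf q})_T-\langle{\bf v}_b\times{\bf n},{\bf q}\rangle_{\partial T}\quad\forall{\bf q}\in[P_{k-1}(T)]^3.$$ Let $\nu\in L^1(\Omega)$ with $\nu>0$ a.e., ${\bf f}\in[L^2(\Omega)]^3$, $g\in L^2(\Omega)$, and $$a({\bf v},{\bf w})=\sum_T(\nu\nabla_w\times{\bf v},\nabla_w\times{\bf w})_T+\sum_Th^{-1}\langle({\bf v}_0-{\bf v}_b)\times{\bf n},({\bf w}_0-{\bf w}_b)\times{\bf n}\rangle_{\partial T},$$ $$b({\bf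 v},q)=\sum_T({\bf v}_0,\nabla_wq)_T,\qquad s_2(p,q)=\sum_Th\langle p_0-p_b,q_0-q_b\rangle_{\partial T}.$$ **Statement.** Let $Q_b\phi$ be either any tangential field on $\partial\Omega$ that belongs to $[P_k(e)]^3$ on each boundary face $e$, or the facewise $L^2$ projection onto $[P_k(e)]^3$ of a tangential field $\phi\in[L^2(\partial\Omega)]^3$. Then there is exactly one pair $({\bf u}_h,p_h)\in V_h\times W_h$, ${\bf u}_h=\{{\bf u}_0,{\bf u}_b\}$, such that ${\bf u}_b\times{\bf n}=Q_b\phi$ on $\partial\Omega$ and $$a({\bf u}_h,{\bf v})-b({\bf v},p_h)=({\bf f},{\bf v}_0)\quad\forall{\bf v}\in V_{h,0},$$ $$b({\bf u}_h,q)+s_2(p_h,q)=-(g,q_0)\quad\forall q\in W_h.$$ -/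

import Mathlib

open MeasureTheory Matrix

noncomputable section

namespace WG

/-- Polynomials in `d` real variables of total degree at most `r`. -/
abbrev Poly (d r : ℕ) : Type := MvPolynomial.restrictTotalDegree (Fin d) ℝ r

/-- The value at `x` of a polynomial of bounded degree. -/
def Poly.val {d r : ℕ} (p : Poly d r) (x : Fin d → ℝ) : ℝ :=
  MvPolynomial.eval x (p : MvPolynomial (Fin d) ℝ)

/-- The value at `x` of a vector of polynomials of bounded degree. -/
def Poly.vec {d m r : ℕ} (p : Fin m → Poly d r) (x : Fin d → ℝ) : Fin m → ℝ :=
  fun j => (p j).val x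

/-- The partial derivative `∂ⱼ p`, evaluated at `x`. -/
def Poly.partialVal {r : ℕ} (j : Fin 3) (p : Poly 3 r) (x : Fin 3 → ℝ) : ℝ :=
  MvPolynomial.eval x (MvPolynomial.pderiv j (p : MvPolynomial (Fin 3) ℝ))

/-- The divergence of a polynomial vector field, evaluated at `x`. -/
def Poly.div {r : ℕ} (q : Fin 3 → Poly 3 r) (x : Fin 3 → ℝ) : ℝ :=
  ∑ j, Poly.partialVal j (q j) x

/-- The curl of a polynomial vector field, evaluated at `x`. -/
def Poly.curl {r : ℕ} (q : Fin 3 → Poly 3 r) (x : Fin 3 → ℝ) : Fin 3 → ℝ :=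
  ![Poly.partialVal 1 (q 2) x - Poly.partialVal 2 (q 1) x,
    Poly.partialVal 2 (q 0) x - Poly.partialVal 0 (q 2) x,
    Poly.partialVal 0 (q 1) x - Poly.partialVal 1 (q 0) x]

/-- Polygons in the plane (`d = 2`) and polyhedra in space (`d = 3`), of arbitrary shape:
finite nonempty unions of nondegenerate closed `d`-simplices. -/
def IsPolyhedral {d : ℕ} (S : Set (Fin d → ℝ)) : Prop :=
  ∃ 𝒮 : Finset (Fin (d + 1) → Fin d → ℝ), 𝒮.Nonempty ∧
    (∀ s ∈ 𝒮, AffineIndependent ℝ s) ∧ S = ⋃ s ∈ 𝒮, convexHull ℝ (Set.range s)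

theorem IsPolyhedral.isCompact {d : ℕ} {S : Set (Fin d → ℝ)} (hS : IsPolyhedral S) :
    IsCompact S := by
  obtain ⟨𝒮, -, -, rfl⟩ := hS
  exact 𝒮.isCompact_biUnion fun s _ => (Set.finite_range s).isCompact_convexHull ℝ

theorem IsPolyhedral.nonempty_interior {d : ℕ} {S : Set (Fin d → ℝ)} (hS : IsPolyhedral S) :
    (interior S).Nonempty := by
  obtain ⟨𝒮, ⟨s, hs⟩, hind, rfl⟩ := hS
  have h1 : affineSpan ℝ (Set.range s) = ⊤ := by
    rw [(hind s hs).affineSpan_eq_top_iff_card_eq_finrank_add_one]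
    simp
  exact (interior_convexHull_nonempty_iff_affineSpan_eq_top.2 h1).mono
    (interior_mono (Set.subset_biUnion_of_mem (u := fun s => convexHull ℝ (Set.range s)) hs))

theorem Poly.continuous_val {d r : ℕ} (p : Poly d r) : Continuous p.val :=
  MvPolynomial.continuous_eval _

theorem Poly.continuous_vec {d m r : ℕ} (p : Fin m → Poly d r) : Continuous (Poly.vec p) :=
  continuous_pi fun j => Poly.continuous_val (p j)

theorem Poly.continuous_partialVal {r : ℕ} (j : Fin 3) (p : Poly 3 r) :
    Continuous (Poly.partialVal j p) :=
  MvPolynomial.continuous_eval _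

theorem Poly.continuous_div {r : ℕ} (q : Fin 3 → Poly 3 r) : Continuous (Poly.div q) :=
  continuous_finsetSum _ fun j _ => Poly.continuous_partialVal j (q j)

theorem Poly.continuous_curl {r : ℕ} (q : Fin 3 → Poly 3 r) : Continuous (Poly.curl q) := by
  refine continuous_pi fun j => ?_
  fin_cases j <;>
    exact (Poly.continuous_partialVal _ _).sub (Poly.continuous_partialVal _ _)

theorem Poly.vec_add {d m r : ℕ} (p q : Fin m → Poly d r) (x : Fin d → ℝ) :
    Poly.vec (p + q) x = Poly.vec p x + Poly.vec q x := by
  ext j; simp [Poly.vec, Poly.val]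

theorem Poly.vec_smul {d m r : ℕ} (c : ℝ) (p : Fin m → Poly d r) (x : Fin d → ℝ) :
    Poly.vec (c • p) x = c • Poly.vec p x := by
  ext j; simp [Poly.vec, Poly.val, MvPolynomial.smul_eval]

theorem Poly.div_add {r : ℕ} (p q : Fin 3 → Poly 3 r) (x : Fin 3 → ℝ) :
    Poly.div (p + q) x = Poly.div p x + Poly.div q x := by
  simp [Poly.div, Poly.partialVal, Finset.sum_add_distrib]

theorem Poly.div_smul {r : ℕ} (c : ℝ) (q : Fin 3 → Poly 3 r) (x : Fin 3 → ℝ) :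
    Poly.div (c • q) x = c * Poly.div q x := by
  simp [Poly.div, Poly.partialVal, Finset.mul_sum, MvPolynomial.smul_eval]

theorem Poly.curl_add {r : ℕ} (p q : Fin 3 → Poly 3 r) (x : Fin 3 → ℝ) :
    Poly.curl (p + q) x = Poly.curl p x + Poly.curl q x := by
  ext j; fin_cases j <;> simp [Poly.curl, Poly.partialVal] <;> ring

theorem Poly.curl_smul {r : ℕ} (c : ℝ) (q : Fin 3 → Poly 3 r) (x : Fin 3 → ℝ) :
    Poly.curl (c • q) x = c • Poly.curl q x := by
  ext j; fin_cases j <;> simp [Poly.curl, Poly.partialVal, MvPolynomial.smul_eval] <;> ring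

theorem continuous_dot {X : Type*} [TopologicalSpace X] {m : ℕ} {F G : X → Fin m → ℝ}
    (hF : Continuous F) (hG : Continuous G) : Continuous fun x => F x ⬝ᵥ G x :=
  hF.dotProduct hG

/-- A polynomial vector field vanishing on a set with interior points is zero. -/
theorem Poly.eq_zero_of_interior {d m r : ℕ} {S : Set (Fin d → ℝ)} (hS : (interior S).Nonempty)
    (G : Fin m → Poly d r) (h : ∀ x ∈ interior S, Poly.vec G x = 0) : G = 0 := by
  obtain ⟨x, hx⟩ := hS
  obtain ⟨ε, hε, hb⟩ := Metric.isOpen_iff.1 isOpen_interior x hx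
  ext1 j
  apply Subtype.ext
  refine MvPolynomial.funext_set (fun i => Metric.ball (x i) ε) (fun i => ?_) fun y hy => ?_
  · rw [Real.ball_eq_Ioo]
    exact Set.Ioo_infinite (by linarith)
  · rw [← ball_pi x hε] at hy
    simpa [Poly.vec, Poly.val] using congrFun (h y (hb hy)) j

/-- The `L²(S)` inner product of polynomial vector fields is definite. -/
theorem Poly.eq_zero_of_integral {d m r : ℕ} {S : Set (Fin d → ℝ)} (hS : IsPolyhedral S)
    (G : Fin m → Poly d r) (h : ∫ x in S, Poly.vec G x ⬝ᵥ Poly.vec G x = 0) : G = 0 := by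
  have hc : Continuous fun x => Poly.vec G x ⬝ᵥ Poly.vec G x :=
    continuous_dot (Poly.continuous_vec G) (Poly.continuous_vec G)
  have hnn : ∀ x, 0 ≤ Poly.vec G x ⬝ᵥ Poly.vec G x := fun x =>
    Finset.sum_nonneg fun j _ => mul_self_nonneg _
  rw [integral_eq_zero_iff_of_nonneg hnn (hc.continuousOn.integrableOn_compact hS.isCompact)] at h
  have h2 : (fun x => Poly.vec G x ⬝ᵥ Poly.vec G x) =ᵐ[volume.restrict (interior S)] 0 :=
    ae_restrict_of_ae_restrict_of_subset interior_subset h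
  have h3 := Measure.eqOn_open_of_ae_eq h2 isOpen_interior hc.continuousOn continuousOn_const
  exact Poly.eq_zero_of_interior hS.nonempty_interior G fun x hx => dotProduct_self_eq_zero.1 (h3 hx)

/-- Every linear functional on `[P_r(S)]^m` is represented by a unique element. -/
theorem Poly.existsUnique_riesz {d m r : ℕ} {S : Set (Fin d → ℝ)} (hS : IsPolyhedral S)
    (L : (Fin m → Poly d r) → ℝ) (hadd : ∀ p q, L (p + q) = L p + L q)
    (hsmul : ∀ (c : ℝ) q, L (c • q) = c * L q) :
    ∃! G : Fin m → Poly d r, ∀ q, ∫ x in S, Poly.vec G x ⬝ᵥ Poly.vec q x = L q := by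
  have hint : ∀ p q : Fin m → Poly d r,
      IntegrableOn (fun x => Poly.vec p x ⬝ᵥ Poly.vec q x) S := fun p q =>
    (continuous_dot (Poly.continuous_vec p) (Poly.continuous_vec q)).continuousOn.integrableOn_compact
      hS.isCompact
  let B : (Fin m → Poly d r) →ₗ[ℝ] Module.Dual ℝ (Fin m → Poly d r) :=
    LinearMap.mk₂ ℝ (fun p q => ∫ x in S, Poly.vec p x ⬝ᵥ Poly.vec q x)
      (fun p p' q => by
        simp only [Poly.vec_add, add_dotProduct]
        exact integral_add (hint p q) (hint p' q))
      (fun c p q => by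
        simp only [Poly.vec_smul, smul_dotProduct]
        exact integral_smul c _)
      (fun p q q' => by
        simp only [Poly.vec_add, dotProduct_add]
        exact integral_add (hint p q) (hint p q'))
      (fun c p q => by
        simp only [Poly.vec_smul, dotProduct_smul]
        exact integral_smul c _)
  have hB : Function.Injective B := by
    rw [injective_iff_map_eq_zero]
    intro G hG
    exact Poly.eq_zero_of_integral hS G (LinearMap.congr_fun hG G)
  have hB' : Function.Surjective B :=
    (LinearMap.injective_iff_surjective_of_finrank_eq_finrank
      (Subspace.dual_finrank_eq (K := ℝ) (V := Fin m → Poly d r)).symm).1 hB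
  let L' : Module.Dual ℝ (Fin m → Poly d r) :=
    { toFun := L, map_add' := hadd, map_smul' := hsmul }
  obtain ⟨G, hG⟩ := hB' L'
  refine ⟨G, fun q => LinearMap.congr_fun hG q, fun G' hG' => hB ?_⟩
  rw [hG]
  exact LinearMap.ext hG'

/-- A flat polygonal face in space, given in Cartesian coordinates of its plane: `dom` is the
polygon in the coordinates belonging to the point `origin` and the orthonormal tangent vectors
`tangent 0`, `tangent 1`. Because the tangent vectors are orthonormal, surface integrals over the
face are Lebesgue integrals over `dom`. -/
structure Face where
  origin : Fin 3 → ℝ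
  tangent : Fin 2 → Fin 3 → ℝ
  orthonormal : ∀ a b, tangent a ⬝ᵥ tangent b = if a = b then 1 else 0
  dom : Set (Fin 2 → ℝ)
  polygonal : IsPolyhedral dom

namespace Face

/-- The point of the plane of the face that has coordinates `y`. -/
def chart (F : Face) (y : Fin 2 → ℝ) : Fin 3 → ℝ :=
  F.origin + y 0 • F.tangent 0 + y 1 • F.tangent 1

/-- The face as a subset of space. -/
def carrier (F : Face) : Set (Fin 3 → ℝ) := F.chart '' F.dom

/-- The relative interior of the face. -/
def relInterior (F : Face) : Set (Fin 3 → ℝ) := F.chart '' interior F.dom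

/-- `n` is the unit normal to `F` that points out of the set `T`, which lies on one side of `F`. -/
def IsOutwardNormal (F : Face) (T : Set (Fin 3 → ℝ)) (n : Fin 3 → ℝ) : Prop :=
  n ⬝ᵥ n = 1 ∧ (∀ a, n ⬝ᵥ F.tangent a = 0) ∧
    ∀ x ∈ F.relInterior, ∃ δ > 0, ∀ s : ℝ, 0 < s → s < δ →
      x - s • n ∈ interior T ∧ x + s • n ∉ T

end Face

/-- A partition of (the closure of) `Ω` into finitely many polyhedra `elem i`, together with the
collection of all its faces. The boundary of every element is a union of faces, distinct faces do
not overlap, and every face belongs to some element. -/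
structure Mesh (Ω : Set (Fin 3 → ℝ)) (ι κ : Type*) where
  elem : ι → Set (Fin 3 → ℝ)
  face : κ → Face
  /-- the faces of a given element -/
  faces : ι → Finset κ
  /-- `normal i e` is the outward unit normal of the element `i` on its face `e` -/
  normal : ι → κ → Fin 3 → ℝ
  elem_polyhedral : ∀ i, IsPolyhedral (elem i)
  elem_disjoint : Pairwise fun i j => Disjoint (interior (elem i)) (interior (elem j))
  elem_cover : ⋃ i, elem i = closure Ω
  elem_frontier : ∀ i, frontier (elem i) = ⋃ e ∈ faces i, (face e).carrier
  face_disjoint : Pairwise fun e e' => Disjoint (face e).relInterior (face e').relInterior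
  face_used : ∀ e, ∃ i, e ∈ faces i
  normal_outward : ∀ i, ∀ e ∈ faces i, (face e).IsOutwardNormal (elem i) (normal i e)

/-- All pairs `{v₀, v_b = v₁ t₁ + v₂ t₂}` with `v₀|_T ∈ [P_k(T)]³` on each element and
`v₁, v₂ ∈ P_k(e)` on each face (the space `V_h`). -/
abbrev VSpace (ι κ : Type*) (k : ℕ) : Type _ :=
  (ι → Fin 3 → Poly 3 k) × (κ → Fin 2 → Poly 2 k)

/-- All pairs `{w₀, w_b}` with `w₀|_T ∈ P_{k-1}(T)` and `w_b|_e ∈ P_k(e)`. -/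
abbrev WPair (ι κ : Type*) (k : ℕ) : Type _ :=
  (ι → Poly 3 (k - 1)) × (κ → Poly 2 k)

namespace Mesh

variable {Ω : Set (Fin 3 → ℝ)} {ι κ : Type*}

/-- Faces lying on the boundary of the domain. -/
def IsBoundary (M : Mesh Ω ι κ) (e : κ) : Prop := (M.face e).carrier ⊆ frontier Ω

/-- The mesh size: the largest Euclidean diameter of an element. -/
def size (M : Mesh Ω ι κ) : ℝ := ⨆ i, Metric.diam (WithLp.toLp 2 '' M.elem i)

/-- The inner product `⟨F, G⟩_{∂T}` on the boundary of the element `i` is the sum of the surface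
integrals over its faces; here `F` is the integrand, as a function of the face and of the
coordinates in the face. -/
def bdryIntegral (M : Mesh Ω ι κ) (i : ι) (F : κ → (Fin 2 → ℝ) → ℝ) : ℝ :=
  ∑ e ∈ M.faces i, ∫ y in (M.face e).dom, F e y

/-- The value of `v_b = v₁ t₁ + v₂ t₂` on the face `e` at the point with coordinates `y`. -/
def bVal {k : ℕ} (M : Mesh Ω ι κ) (v : VSpace ι κ k) (e : κ) (y : Fin 2 → ℝ) : Fin 3 → ℝ :=
  (v.2 e 0).val y • (M.face e).tangent 0 + (v.2 e 1).val y • (M.face e).tangent 1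

/-- `V_{h,0}`: the members of `V_h` with `v_b × n = 0` on the boundary faces. -/
def V0 (M : Mesh Ω ι κ) (k : ℕ) : Set (VSpace ι κ k) :=
  {v | ∀ i, ∀ e ∈ M.faces i, M.IsBoundary e →
    ∀ y ∈ (M.face e).dom, M.bVal v e y ⨯₃ M.normal i e = 0}

/-- `W_h`: the pairs `{w₀, w_b}` with `w_b = 0` on the boundary faces. -/
def W (M : Mesh Ω ι κ) (k : ℕ) : Set (WPair ι κ k) :=
  {w | ∀ e, M.IsBoundary e → ∀ y ∈ (M.face e).dom, (w.2 e).val y = 0}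

/-- `G` is the discrete weak gradient of `w` on the element `i`: `G ∈ [P_k(T)]³` and
`(G, q)_T = -(w₀, ∇·q)_T + ⟨w_b, q·n⟩_{∂T}` for all `q ∈ [P_k(T)]³`. -/
def IsWeakGrad (M : Mesh Ω ι κ) (k : ℕ) (w : WPair ι κ k) (i : ι)
    (G : Fin 3 → Poly 3 k) : Prop :=
  ∀ q : Fin 3 → Poly 3 k,
    ∫ x in M.elem i, Poly.vec G x ⬝ᵥ Poly.vec q x =
      -(∫ x in M.elem i, (w.1 i).val x * Poly.div q x) +
        M.bdryIntegral i fun e y =>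
          (w.2 e).val y * (Poly.vec q ((M.face e).chart y) ⬝ᵥ M.normal i e)

/-- `C` is the discrete weak curl of `v` on the element `i`: `C ∈ [P_{k-1}(T)]³` and
`(C, q)_T = (v₀, ∇×q)_T - ⟨v_b × n, q⟩_{∂T}` for all `q ∈ [P_{k-1}(T)]³`. -/
def IsWeakCurl (M : Mesh Ω ι κ) (k : ℕ) (v : VSpace ι κ k) (i : ι)
    (C : Fin 3 → Poly 3 (k - 1)) : Prop :=
  ∀ q : Fin 3 → Poly 3 (k - 1),
    ∫ x in M.elem i, Poly.vec C x ⬝ᵥ Poly.vec q x =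
      (∫ x in M.elem i, Poly.vec (v.1 i) x ⬝ᵥ Poly.curl q x) -
        M.bdryIntegral i fun e y =>
          (M.bVal v e y ⨯₃ M.normal i e) ⬝ᵥ Poly.vec q ((M.face e).chart y)

/-- `Q` is the `L²` projection onto `[P_k(e)]³` of the vector field `φ` on the face `e`. -/
def IsFaceProj (M : Mesh Ω ι κ) (k : ℕ) (φ : (Fin 3 → ℝ) → Fin 3 → ℝ) (e : κ)
    (Q : Fin 3 → Poly 2 k) : Prop :=
  ∀ r : Fin 3 → Poly 2 k,
    ∫ y in (M.face e).dom, Poly.vec Q y ⬝ᵥ Poly.vec r y =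
      ∫ y in (M.face e).dom, φ ((M.face e).chart y) ⬝ᵥ Poly.vec r y

theorem continuous_chart (F : Face) : Continuous F.chart := by
  unfold Face.chart
  fun_prop

theorem continuous_cross {X : Type*} [TopologicalSpace X] {F : X → Fin 3 → ℝ}
    (hF : Continuous F) (n : Fin 3 → ℝ) : Continuous fun x => F x ⨯₃ n := by
  have : Continuous fun v : Fin 3 → ℝ => v ⨯₃ n :=
    LinearMap.continuous_of_finiteDimensional (crossProduct.flip n)
  exact this.comp hF

theorem continuous_bVal {k : ℕ} (M : Mesh Ω ι κ) (v : VSpace ι κ k) (e : κ) :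
    Continuous (M.bVal v e) :=
  ((Poly.continuous_val _).smul continuous_const).add
    ((Poly.continuous_val _).smul continuous_const)

theorem bdryIntegral_add (M : Mesh Ω ι κ) (i : ι) {F G : κ → (Fin 2 → ℝ) → ℝ}
    (hF : ∀ e, Continuous (F e)) (hG : ∀ e, Continuous (G e)) :
    M.bdryIntegral i (fun e y => F e y + G e y) = M.bdryIntegral i F + M.bdryIntegral i G := by
  unfold bdryIntegral
  rw [← Finset.sum_add_distrib]
  refine Finset.sum_congr rfl fun e _ => integral_add ?_ ?_
  · exact (hF e).continuousOn.integrableOn_compact (M.face e).polygonal.isCompact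
  · exact (hG e).continuousOn.integrableOn_compact (M.face e).polygonal.isCompact

theorem bdryIntegral_mul (M : Mesh Ω ι κ) (i : ι) (c : ℝ) (F : κ → (Fin 2 → ℝ) → ℝ) :
    M.bdryIntegral i (fun e y => c * F e y) = c * M.bdryIntegral i F := by
  simp [bdryIntegral, integral_const_mul, Finset.mul_sum]

theorem existsUnique_isWeakGrad {k : ℕ} (M : Mesh Ω ι κ) (w : WPair ι κ k) (i : ι) :
    ∃! G, M.IsWeakGrad k w i G := by
  have hc : ∀ (q : Fin 3 → Poly 3 k) (e : κ), Continuous fun y =>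
      (w.2 e).val y * (Poly.vec q ((M.face e).chart y) ⬝ᵥ M.normal i e) := fun q e =>
    (Poly.continuous_val _).mul
      (continuous_dot ((Poly.continuous_vec q).comp (continuous_chart _)) continuous_const)
  have hv : ∀ q : Fin 3 → Poly 3 k,
      IntegrableOn (fun x => (w.1 i).val x * Poly.div q x) (M.elem i) := fun q =>
    ((Poly.continuous_val _).mul (Poly.continuous_div q)).continuousOn.integrableOn_compact
      (M.elem_polyhedral i).isCompact
  refine Poly.existsUnique_riesz (M.elem_polyhedral i) _ (fun p q => ?_) fun c q => ?_
  · simp only [Poly.vec_add, Poly.div_add, add_dotProduct, mul_add]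
    rw [integral_add (hv p) (hv q), M.bdryIntegral_add i (hc p) (hc q)]
    ring
  · simp only [Poly.vec_smul, Poly.div_smul, smul_dotProduct, smul_eq_mul, mul_left_comm _ c]
    rw [integral_const_mul, M.bdryIntegral_mul]
    ring

theorem existsUnique_isWeakCurl {k : ℕ} (M : Mesh Ω ι κ) (v : VSpace ι κ k) (i : ι) :
    ∃! C, M.IsWeakCurl k v i C := by
  have hc : ∀ (q : Fin 3 → Poly 3 (k - 1)) (e : κ), Continuous fun y =>
      (M.bVal v e y ⨯₃ M.normal i e) ⬝ᵥ Poly.vec q ((M.face e).chart y) := fun q e =>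
    continuous_dot (continuous_cross (M.continuous_bVal v e) _)
      ((Poly.continuous_vec q).comp (continuous_chart _))
  have hv : ∀ q : Fin 3 → Poly 3 (k - 1),
      IntegrableOn (fun x => Poly.vec (v.1 i) x ⬝ᵥ Poly.curl q x) (M.elem i) := fun q =>
    (continuous_dot (Poly.continuous_vec _)
      (Poly.continuous_curl q)).continuousOn.integrableOn_compact (M.elem_polyhedral i).isCompact
  refine Poly.existsUnique_riesz (M.elem_polyhedral i) _ (fun p q => ?_) fun c q => ?_
  · simp only [Poly.vec_add, Poly.curl_add, dotProduct_add]
    rw [integral_add (hv p) (hv q), M.bdryIntegral_add i (hc p) (hc q)]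
    ring
  · simp only [Poly.vec_smul, Poly.curl_smul, dotProduct_smul, smul_eq_mul]
    rw [integral_const_mul, M.bdryIntegral_mul]
    ring

theorem existsUnique_isFaceProj (M : Mesh Ω ι κ) (k : ℕ) (φ : (Fin 3 → ℝ) → Fin 3 → ℝ) (e : κ)
    (hφ : MemLp (fun y => φ ((M.face e).chart y)) 2 (volume.restrict (M.face e).dom)) :
    ∃! Q, M.IsFaceProj k φ e Q := by
  have hcpt := (M.face e).polygonal.isCompact
  have : IsFiniteMeasure (volume.restrict (M.face e).dom) :=
    ⟨by simpa using hcpt.measure_lt_top⟩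
  have hφ' : IntegrableOn (fun y => φ ((M.face e).chart y)) (M.face e).dom :=
    hφ.integrable (by norm_num)
  have hv : ∀ r : Fin 3 → Poly 2 k,
      IntegrableOn (fun y => φ ((M.face e).chart y) ⬝ᵥ Poly.vec r y) (M.face e).dom := fun r =>
    integrable_finsetSum _ fun j _ =>
      IntegrableOn.mul_continuousOn (hφ'.eval j)
        (Poly.continuous_val (r j)).continuousOn hcpt
  refine Poly.existsUnique_riesz (M.face e).polygonal _ (fun p q => ?_) fun c q => ?_
  · simp only [Poly.vec_add, dotProduct_add]
    exact integral_add (hv p) (hv q)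
  · simp only [Poly.vec_smul, dotProduct_smul, smul_eq_mul]
    exact integral_const_mul _ _

/-- The discrete weak gradient `∇_w w` on the element `i`
(see `existsUnique_isWeakGrad`). -/
def weakGrad {k : ℕ} (M : Mesh Ω ι κ) (w : WPair ι κ k) (i : ι) : Fin 3 → Poly 3 k :=
  Classical.epsilon (M.IsWeakGrad k w i)

/-- The discrete weak curl `∇_w × v` on the element `i`
(see `existsUnique_isWeakCurl`). -/
def weakCurl {k : ℕ} (M : Mesh Ω ι κ) (v : VSpace ι κ k) (i : ι) : Fin 3 → Poly 3 (k - 1) :=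
  Classical.epsilon (M.IsWeakCurl k v i)

/-- The facewise `L²` projection `Q_b φ`
(see `existsUnique_isFaceProj`). -/
def faceProj (M : Mesh Ω ι κ) (k : ℕ) (φ : (Fin 3 → ℝ) → Fin 3 → ℝ) (e : κ) :
    Fin 3 → Poly 2 k :=
  Classical.epsilon (M.IsFaceProj k φ e)

variable [Fintype ι] {k : ℕ}

/-- `s₁(v, w) = ∑_T h⁻¹ ⟨(v₀ - v_b) × n, (w₀ - w_b) × n⟩_{∂T}`. -/
def s₁ (M : Mesh Ω ι κ) (v w : VSpace ι κ k) : ℝ :=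
  ∑ i, M.size⁻¹ * M.bdryIntegral i fun e y =>
    ((Poly.vec (v.1 i) ((M.face e).chart y) - M.bVal v e y) ⨯₃ M.normal i e) ⬝ᵥ
      ((Poly.vec (w.1 i) ((M.face e).chart y) - M.bVal w e y) ⨯₃ M.normal i e)

/-- `a(v, w) = ∑_T (ν ∇_w × v, ∇_w × w)_T + s₁(v, w)`. -/
def a (M : Mesh Ω ι κ) (ν : (Fin 3 → ℝ) → ℝ) (v w : VSpace ι κ k) : ℝ :=
  (∑ i, ∫ x in M.elem i,
    ν x * (Poly.vec (M.weakCurl v i) x ⬝ᵥ Poly.vec (M.weakCurl w i) x)) + M.s₁ v w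

/-- `b(v, q) = ∑_T (v₀, ∇_w q)_T`. -/
def b (M : Mesh Ω ι κ) (v : VSpace ι κ k) (q : WPair ι κ k) : ℝ :=
  ∑ i, ∫ x in M.elem i, Poly.vec (v.1 i) x ⬝ᵥ Poly.vec (M.weakGrad q i) x

/-- `s₂(p, q) = ∑_T h ⟨p₀ - p_b, q₀ - q_b⟩_{∂T}`. -/
def s₂ (M : Mesh Ω ι κ) (p q : WPair ι κ k) : ℝ :=
  ∑ i, M.size * M.bdryIntegral i fun e y =>
    ((p.1 i).val ((M.face e).chart y) - (p.2 e).val y) *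
      ((q.1 i).val ((M.face e).chart y) - (q.2 e).val y)

/-- `(u, p)` solves the weak Galerkin scheme with coefficient `ν`, sources `f`, `g` and
polynomial boundary data `Φ`: `u ∈ V_h`, `p ∈ W_h`, `u_b × n = Φ` on `∂Ω`, and
`a(u, v) - b(v, p) = (f, v₀)` for `v ∈ V_{h,0}`, `b(u, q) + s₂(p, q) = -(g, q₀)` for `q ∈ W_h`. -/
def IsSolution (M : Mesh Ω ι κ) (ν : (Fin 3 → ℝ) → ℝ) (f : (Fin 3 → ℝ) → Fin 3 → ℝ)
    (g : (Fin 3 → ℝ) → ℝ) (Φ : κ → Fin 3 → Poly 2 k)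
    (u : VSpace ι κ k) (p : WPair ι κ k) : Prop :=
  p ∈ M.W k ∧
  (∀ i, ∀ e ∈ M.faces i, M.IsBoundary e → ∀ y ∈ (M.face e).dom,
    M.bVal u e y ⨯₃ M.normal i e = Poly.vec (Φ e) y) ∧
  (∀ v ∈ M.V0 k, M.a ν u v - M.b v p =
    ∑ i, ∫ x in M.elem i, f x ⬝ᵥ Poly.vec (v.1 i) x) ∧
  (∀ q ∈ M.W k, M.b u q + M.s₂ p q = -∑ i, ∫ x in M.elem i, g x * (q.1 i).val x)

end Mesh

end WG

end

noncomputable section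

namespace WG

/-! The discrete problem is a square linear system, so unique solvability reduces to showing that
the homogeneous problem has only the zero solution. Tangential polynomial boundary data are first
lifted by `v_b = n × Φ` on boundary faces (`exists_lift`), which works because a boundary face
belongs to a single element; subtracting the lift leaves a problem on the linear space `V_{h,0} ×
W_h`.

Testing the homogeneous equations with `(u, p)` itself makes the two `b` terms cancel, and `a(u, u)
+ s₂(p, p) = 0` remains. Hence the weak curl of `u` vanishes, `(u₀ - u_b) × n = 0` and `p₀ = p_b` on
all faces (`energy_eq_zero`). The form `a(u, ·)` is then zero, so `b(v, p) = 0` for every `v`;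
taking `v₀ = ∇_w p` gives `∇_w p = 0`. Without jumps this forces `∇p₀ = 0`, so `p₀` is piecewise
constant, continuous and zero on the boundary, hence zero.

Likewise `b(u, q) = 0` for every `q`. Interior test functions give `∇·u₀ = 0` in each element, and
face test functions give continuity of the normal component. With the absence of tangential jumps,
`u₀` is curl-free and divergence-free in each element, continuous across interior faces, and normal
to `∂Ω`.

Such a field vanishes whatever the topology of `Ω` (`eq_zero_of_harmonic`). Under these conditions
`∇·((u·∇)u) = |∇u|²`. Across an interior face the jump of `∇u` is symmetric, trace-free and kills
tangent vectors, so it is zero and the fluxes cancel. On a boundary face `u = φ n`, and `n·(u·∇)u =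
φ n·(∇u)n = 0`, because the trace is zero and flatness of the face kills the tangential diagonal
entries. So `∇u = 0`. A constant `c` that is normal to the boundary faces vanishes: for `d ⊥ c` with
`d ≠ 0` there is a boundary face transversal to `d` (`exists_boundary_face`).

All of this rests on the divergence theorem for elements of arbitrary shape (`integral_divergence`),
proved by Fubini: almost every line parallel to an axis crosses the faces transversally at regular
points, and the fundamental theorem of calculus applies on it. -/

/-! ### Polynomials: derivatives, degrees, restriction to faces. -/

theorem hasDerivAt_eval_curve {d : ℕ} (P : MvPolynomial (Fin d) ℝ) {x : ℝ → Fin d → ℝ}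
    {x' : Fin d → ℝ} {t : ℝ} (hx : ∀ i, HasDerivAt (fun s => x s i) (x' i) t) :
    HasDerivAt (fun s => MvPolynomial.eval (x s) P)
      (∑ i, MvPolynomial.eval (x t) (MvPolynomial.pderiv i P) * x' i) t := by
  induction P using MvPolynomial.induction_on with
  | C a => simpa using hasDerivAt_const t a
  | add p q hp hq =>
    simp only [map_add, add_mul, Finset.sum_add_distrib]
    exact hp.add hq
  | mul_X p n hp =>
    have h := hp.mul (hx n)
    simp only [map_mul, MvPolynomial.eval_X]
    refine h.congr_deriv ?_
    simp only [MvPolynomial.pderiv_mul, map_add, map_mul, MvPolynomial.eval_X, add_mul,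
      Finset.sum_add_distrib, MvPolynomial.pderiv_X, Finset.sum_mul]
    congr 1
    · exact Finset.sum_congr rfl fun i _ => by ring
    · rw [Finset.sum_eq_single n]
      · simp
      · intro b _ hb
        simp [hb.symm]
      · simp

/-- A monomial `m` of the derivative comes from the monomial `m + e_j` of `P`. For `r = 0` the
truncated subtraction is harmless, since the derivative is then zero. -/
theorem totalDegree_pderiv_le {d r : ℕ} (j : Fin d) {P : MvPolynomial (Fin d) ℝ}
    (hP : P.totalDegree ≤ r) : (MvPolynomial.pderiv j P).totalDegree ≤ r - 1 := by
  refine Finset.sup_le fun m hm => ?_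
  have h1 : m + Finsupp.single j 1 ∈ P.support := by
    rw [MvPolynomial.mem_support_iff] at hm ⊢
    rw [MvPolynomial.coeff_pderiv] at hm
    exact left_ne_zero_of_mul hm
  have h2 := (MvPolynomial.le_totalDegree h1).trans hP
  rw [Finsupp.sum_add_index' (fun _ => rfl) (fun _ _ _ => rfl), Finsupp.sum_single_index rfl] at h2
  exact Nat.le_sub_one_of_lt h2

theorem pderiv_comm {d : ℕ} (i j : Fin d) (P : MvPolynomial (Fin d) ℝ) :
    MvPolynomial.pderiv i (MvPolynomial.pderiv j P) =
      MvPolynomial.pderiv j (MvPolynomial.pderiv i P) := by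
  rcases eq_or_ne i j with rfl | hij
  · rfl
  ext m
  simp only [MvPolynomial.coeff_pderiv, Finsupp.add_apply, Finsupp.single_eq_of_ne hij,
    Finsupp.single_eq_of_ne hij.symm, add_right_comm m]
  push_cast
  ring

/-- In characteristic zero a monomial containing `X_j` leaves a nonzero coefficient in the `j`-th
derivative. -/
theorem eq_C_of_pderiv_eq_zero {d : ℕ} {P : MvPolynomial (Fin d) ℝ}
    (h : ∀ j, MvPolynomial.pderiv j P = 0) : P = MvPolynomial.C (MvPolynomial.coeff 0 P) := by
  rw [← MvPolynomial.totalDegree_eq_zero_iff_eq_C, MvPolynomial.totalDegree_eq_zero_iff]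
  intro m hm j
  by_contra hj
  have h1 := congrArg (MvPolynomial.coeff (m - Finsupp.single j 1)) (h j)
  have h2 : m - Finsupp.single j 1 + Finsupp.single j 1 = m :=
    tsub_add_cancel_of_le (Finsupp.single_le_iff.2 (Nat.one_le_iff_ne_zero.2 hj))
  rw [MvPolynomial.coeff_pderiv, h2, MvPolynomial.coeff_zero, mul_eq_zero] at h1
  rcases h1 with h1 | h1
  · exact (MvPolynomial.mem_support_iff.1 hm) h1
  · exact absurd h1 (by positivity)

/-- The restriction of a polynomial in space to the plane of a face, in face coordinates. -/
def Poly.onFace {r : ℕ} (F : Face) (p : Poly 3 r) : Poly 2 r :=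
  ⟨MvPolynomial.aeval (fun j => MvPolynomial.C (F.origin j) +
      MvPolynomial.C (F.tangent 0 j) * MvPolynomial.X 0 +
      MvPolynomial.C (F.tangent 1 j) * MvPolynomial.X 1) (p : MvPolynomial (Fin 3) ℝ), by
    rw [MvPolynomial.mem_restrictTotalDegree, MvPolynomial.aeval_def, MvPolynomial.eval₂_eq]
    refine MvPolynomial.totalDegree_finsetSum_le fun m hm => ?_
    have hp := (MvPolynomial.le_totalDegree hm).trans
      ((MvPolynomial.mem_restrictTotalDegree _ _ _).1 p.2)
    refine (MvPolynomial.totalDegree_mul _ _).trans ?_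
    rw [MvPolynomial.algebraMap_eq, MvPolynomial.totalDegree_C, zero_add]
    refine (MvPolynomial.totalDegree_finsetProd _ _).trans (le_trans ?_ hp)
    -- Each variable is replaced by an affine function, so a monomial becomes a product of as many
    -- factors of degree at most one.
    refine Finset.sum_le_sum fun j _ => (MvPolynomial.totalDegree_pow _ _).trans ?_
    have h1 : ∀ (c : ℝ) (a : Fin 2),
        (MvPolynomial.C c * MvPolynomial.X a : MvPolynomial (Fin 2) ℝ).totalDegree ≤ 1 :=
      fun c a => (MvPolynomial.totalDegree_mul _ _).trans (by simp)
    refine (Nat.mul_le_mul_left _ (?_ : _ ≤ 1)).trans (mul_one _).le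
    refine (MvPolynomial.totalDegree_add _ _).trans (max_le ?_ (h1 _ _))
    exact (MvPolynomial.totalDegree_add _ _).trans (max_le (by simp) (h1 _ _))⟩

theorem Poly.val_onFace {r : ℕ} (F : Face) (p : Poly 3 r) (y : Fin 2 → ℝ) :
    (p.onFace F).val y = p.val (F.chart y) := by
  simp only [Poly.val, Poly.onFace, MvPolynomial.aeval_def, MvPolynomial.algebraMap_eq]
  rw [← MvPolynomial.coe_eval₂Hom, ← RingHom.comp_apply]
  refine RingHom.congr_fun (MvPolynomial.ringHom_ext (fun c => by simp) fun j => ?_) _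
  simp [Face.chart, mul_comm]

theorem Poly.val_add {d r : ℕ} (p q : Poly d r) (x : Fin d → ℝ) :
    (p + q).val x = p.val x + q.val x := by
  simp [Poly.val]

theorem Poly.val_smul {d r : ℕ} (c : ℝ) (p : Poly d r) (x : Fin d → ℝ) :
    (c • p).val x = c * p.val x := by
  simp [Poly.val, MvPolynomial.smul_eval]

theorem Poly.val_zero {d r : ℕ} (x : Fin d → ℝ) : (0 : Poly d r).val x = 0 := by
  simp [Poly.val]

theorem Poly.val_sum {d r : ℕ} {α : Type*} (s : Finset α) (p : α → Poly d r) (x : Fin d → ℝ) :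
    (∑ i ∈ s, p i).val x = ∑ i ∈ s, (p i).val x := by
  simp [Poly.val]

/-- The partial derivative of a polynomial of degree at most `r`, as a polynomial of degree at
most `r - 1`. -/
def Poly.pderiv {d r : ℕ} (j : Fin d) (p : Poly d r) : Poly d (r - 1) :=
  ⟨MvPolynomial.pderiv j (p : MvPolynomial (Fin d) ℝ),
    (MvPolynomial.mem_restrictTotalDegree _ _ _).2
      (totalDegree_pderiv_le j ((MvPolynomial.mem_restrictTotalDegree _ _ _).1 p.2))⟩

/-! ### Definiteness of integrals and boundaries of polyhedral sets. -/

theorem eval_eq_zero_of_interior {d : ℕ} {S : Set (Fin d → ℝ)} (hS : (interior S).Nonempty)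
    {P : MvPolynomial (Fin d) ℝ} (h : ∀ x ∈ interior S, MvPolynomial.eval x P = 0) : P = 0 := by
  have := Poly.eq_zero_of_interior (m := 1) (r := P.totalDegree) hS
    (fun _ => ⟨P, (MvPolynomial.mem_restrictTotalDegree _ _ _).2 le_rfl⟩)
    (fun x hx => by ext; exact h x hx)
  exact congrArg Subtype.val (congrFun this 0)

theorem Poly.eq_zero_of_val {d r : ℕ} {S : Set (Fin d → ℝ)} (hS : (interior S).Nonempty)
    {p : Poly d r} (h : ∀ x ∈ interior S, p.val x = 0) : p = 0 :=
  Subtype.ext (eval_eq_zero_of_interior hS h)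

/-- A nonnegative continuous function with integral zero vanishes in the interior. -/
theorem eq_zero_of_setIntegral_eq_zero {d : ℕ} {S : Set (Fin d → ℝ)} (hS : IsPolyhedral S)
    {F : (Fin d → ℝ) → ℝ} (hc : Continuous F) (hnn : ∀ x, 0 ≤ F x) (h : ∫ x in S, F x = 0) :
    ∀ x ∈ interior S, F x = 0 := by
  rw [integral_eq_zero_iff_of_nonneg hnn (hc.continuousOn.integrableOn_compact hS.isCompact)] at h
  have h2 : F =ᵐ[volume.restrict (interior S)] 0 :=
    ae_restrict_of_ae_restrict_of_subset interior_subset h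
  exact Measure.eqOn_open_of_ae_eq h2 isOpen_interior hc.continuousOn continuousOn_const

/-- The frontier of a finite union lies in the union of the frontiers, and a convex set has a null
frontier. -/
theorem IsPolyhedral.frontier_null {d : ℕ} {S : Set (Fin d → ℝ)} (hS : IsPolyhedral S) :
    volume (frontier S) = 0 := by
  obtain ⟨𝒮, -, -, rfl⟩ := hS
  induction 𝒮 using Finset.induction_on with
  | empty => simp
  | insert s 𝒮 hs ih =>
    rw [Finset.set_biUnion_insert]
    refine measure_mono_null ((frontier_union_subset _ _).trans
      (Set.union_subset_union Set.inter_subset_left Set.inter_subset_right)) ?_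
    exact measure_union_null ((convex_convexHull ℝ _).addHaar_frontier _) ih

theorem IsPolyhedral.ae_eq_interior {d : ℕ} {S : Set (Fin d → ℝ)} (hS : IsPolyhedral S) :
    interior S =ᵐ[volume] S :=
  interior_ae_eq_of_null_frontier hS.frontier_null

theorem IsPolyhedral.setIntegral_interior {d : ℕ} {S : Set (Fin d → ℝ)} (hS : IsPolyhedral S)
    (F : (Fin d → ℝ) → ℝ) : ∫ x in interior S, F x = ∫ x in S, F x :=
  setIntegral_congr_set hS.ae_eq_interior

theorem IsPolyhedral.setIntegral_congr {d : ℕ} {S : Set (Fin d → ℝ)} (hS : IsPolyhedral S)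
    {F G : (Fin d → ℝ) → ℝ} (h : ∀ x ∈ interior S, F x = G x) :
    ∫ x in S, F x = ∫ x in S, G x := by
  rw [← hS.setIntegral_interior F, ← hS.setIntegral_interior G]
  exact setIntegral_congr_fun isOpen_interior.measurableSet h

/-- A nondegenerate simplex is convex with nonempty interior, hence contained in the closure of that
interior. Consequently an open set that meets a face also meets its relative interior. -/
theorem IsPolyhedral.closure_interior {d : ℕ} {S : Set (Fin d → ℝ)} (hS : IsPolyhedral S) :
    S ⊆ closure (interior S) := by
  obtain ⟨𝒮, -, hind, rfl⟩ := hS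
  refine Set.iUnion₂_subset fun s hs => ?_
  have h1 : affineSpan ℝ (Set.range s) = ⊤ := by
    rw [(hind s hs).affineSpan_eq_top_iff_card_eq_finrank_add_one]
    simp
  have h2 := (convex_convexHull ℝ (Set.range s)).closure_interior_eq_closure_of_nonempty_interior
    (interior_convexHull_nonempty_iff_affineSpan_eq_top.2 h1)
  refine (subset_closure.trans h2.ge).trans (closure_mono (interior_mono ?_))
  exact Set.subset_biUnion_of_mem (u := fun s => convexHull ℝ (Set.range s)) hs

/-! ### The orthonormal frame of a face and its projections along the axes. -/

namespace Face

variable {F : Face} {n : Fin 3 → ℝ}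

/-- `n` is a unit normal vector of the face `F`. -/
def IsUnitNormal (F : Face) (n : Fin 3 → ℝ) : Prop :=
  n ⬝ᵥ n = 1 ∧ ∀ a, n ⬝ᵥ F.tangent a = 0

/-- The matrix with rows `t₁, t₂, n` has orthonormal rows; a right inverse of a square matrix is
also a left inverse, so its columns are orthonormal too. -/
theorem IsUnitNormal.frame (h : F.IsUnitNormal n) (i j : Fin 3) :
    F.tangent 0 i * F.tangent 0 j + F.tangent 1 i * F.tangent 1 j + n i * n j =
      if i = j then 1 else 0 := by
  have h1 : (Matrix.of ![F.tangent 0, F.tangent 1, n]) *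
      (Matrix.of ![F.tangent 0, F.tangent 1, n])ᵀ = 1 := by
    have h0 := F.orthonormal 0 0
    have h01 := F.orthonormal 0 1
    have h11 := F.orthonormal 1 1
    have h2 := h.1
    have h3 := h.2 0
    have h4 := h.2 1
    simp only [dotProduct, Fin.sum_univ_three] at h0 h01 h11 h2 h3 h4
    ext a b
    fin_cases a <;> fin_cases b <;>
      simp [Matrix.mul_apply, Fin.sum_univ_three] at * <;> linarith
  have h2 := congrArg (fun A : Matrix (Fin 3) (Fin 3) ℝ => A i j) (mul_eq_one_comm.1 h1)
  simpa [Matrix.mul_apply, Fin.sum_univ_three, Matrix.one_apply] using h2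

theorem IsUnitNormal.resolve (h : F.IsUnitNormal n) (x : Fin 3 → ℝ) (i : Fin 3) :
    x i = (x ⬝ᵥ F.tangent 0) * F.tangent 0 i + (x ⬝ᵥ F.tangent 1) * F.tangent 1 i +
      (x ⬝ᵥ n) * n i := by
  have h0 := h.frame i 0
  have h1 := h.frame i 1
  have h2 := h.frame i 2
  simp only [dotProduct, Fin.sum_univ_three]
  fin_cases i <;> simp at * <;>
  linear_combination (-x 0) * h0 - x 1 * h1 - x 2 * h2

theorem IsUnitNormal.eq_or_eq_neg {m : Fin 3 → ℝ} (h : F.IsUnitNormal n)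
    (h' : F.IsUnitNormal m) : m = n ∨ m = -n := by
  have h1 : m = (m ⬝ᵥ n) • n := by
    ext i
    have := h.resolve m i
    rw [h'.2 0, h'.2 1] at this
    simpa using this
  have h2 : (m ⬝ᵥ n) * (m ⬝ᵥ n) = 1 := by
    have := h'.1
    nth_rewrite 1 [h1] at this
    rw [smul_dotProduct, smul_eq_mul, dotProduct_comm n m] at this
    exact this
  rcases mul_self_eq_one_iff.1 h2 with h3 | h3
  · left; rw [h1, h3, one_smul]
  · right; rw [h1, h3]; simp

theorem IsUnitNormal.ne_zero (h : F.IsUnitNormal n) : n ≠ 0 := by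
  rintro rfl
  simpa using h.1

theorem dotProduct_chart_sub (h : F.IsUnitNormal n) (y y' : Fin 2 → ℝ) :
    (F.chart y - F.chart y') ⬝ᵥ n = 0 := by
  have h0 := h.2 0
  have h1 := h.2 1
  rw [dotProduct_comm] at h0 h1
  simp [Face.chart, sub_dotProduct, add_dotProduct, h0, h1]

/-- The linear part of the projection of the plane of a face along the `j`-th axis. -/
def projMatrix (F : Face) (j : Fin 3) : Matrix (Fin 2) (Fin 2) ℝ :=
  Matrix.of fun b a => F.tangent a (j.succAbove b)

theorem removeNth_chart (F : Face) (j : Fin 3) (y : Fin 2 → ℝ) :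
    j.removeNth (F.chart y) = j.removeNth F.origin + Matrix.toLin' (F.projMatrix j) y := by
  ext b
  rw [Pi.add_apply, Matrix.toLin'_apply, Matrix.mulVec, dotProduct, Fin.sum_univ_two]
  simp only [Fin.removeNth, Face.chart, projMatrix, Matrix.of_apply, Pi.add_apply, Pi.smul_apply,
    smul_eq_mul]
  ring

/-- By `frame` the two rows have Gram matrix `δ - n nᵀ` in the two remaining coordinates `p, q` of
`n`, so Lagrange's identity gives `det² = (1 - p²)(1 - q²) - p²q² = 1 - p² - q² = n_j²`. -/
theorem IsUnitNormal.abs_det_projMatrix (h : F.IsUnitNormal n) (j : Fin 3) :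
    |(F.projMatrix j).det| = |n j| := by
  rw [← sq_eq_sq_iff_abs_eq_abs, Matrix.det_fin_two]
  simp only [projMatrix, Matrix.of_apply]
  have e1 := h.frame (j.succAbove 0) (j.succAbove 0)
  have e2 := h.frame (j.succAbove 1) (j.succAbove 1)
  have e3 := h.frame (j.succAbove 0) (j.succAbove 1)
  have e4 : n j * n j + n (j.succAbove 0) * n (j.succAbove 0) +
      n (j.succAbove 1) * n (j.succAbove 1) = 1 := by
    have := h.1
    rw [dotProduct, Fin.sum_univ_succAbove _ j, Fin.sum_univ_two] at this
    linarith
  rw [if_pos rfl] at e1 e2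
  rw [if_neg (by simp)] at e3
  set a := F.tangent 0 (j.succAbove 0)
  set b := F.tangent 0 (j.succAbove 1)
  set c := F.tangent 1 (j.succAbove 0)
  set d := F.tangent 1 (j.succAbove 1)
  set p := n (j.succAbove 0)
  set q := n (j.succAbove 1)
  have e1' : a * a + c * c = 1 - p * p := by linarith
  have e2' : b * b + d * d = 1 - q * q := by linarith
  have e3' : a * b + c * d = - (p * q) := by linarith
  have : (a * d - c * b) ^ 2 = (a * a + c * c) * (b * b + d * d) - (a * b + c * d) ^ 2 := by ring
  rw [this, e1', e2', e3']
  linear_combination -e4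

/-- The projection along the `j`-th axis scales areas in the plane of a face by `|det|`. -/
theorem volume_image_removeNth_chart (F : Face) (j : Fin 3) (s : Set (Fin 2 → ℝ)) :
    volume ((fun y => j.removeNth (F.chart y)) '' s) =
      ENNReal.ofReal |(F.projMatrix j).det| * volume s := by
  have : (fun y => j.removeNth (F.chart y)) '' s =
      (fun z => j.removeNth F.origin + z) '' (Matrix.toLin' (F.projMatrix j) '' s) := by
    rw [Set.image_image]
    exact Set.image_congr fun y _ => F.removeNth_chart j y
  rw [this, Set.image_add_left, measure_preimage_add, Measure.addHaar_image_linearMap,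
    LinearMap.det_toLin']

end Face

/-! ### Regular points and the local shape of the mesh at a face. -/

namespace Mesh

variable {Ω : Set (Fin 3 → ℝ)} {ι κ : Type*}

theorem normal_isUnitNormal (M : Mesh Ω ι κ) {i : ι} {e : κ} (he : e ∈ M.faces i) :
    (M.face e).IsUnitNormal (M.normal i e) :=
  ⟨(M.normal_outward i e he).1, (M.normal_outward i e he).2.1⟩

/-- The lines parallel to the `j`-th axis that meet the relative boundary of some face or are
parallel to a face they meet. -/
def badLines (M : Mesh Ω ι κ) (j : Fin 3) : Set (Fin 2 → ℝ) :=
  ⋃ e, ((fun y => j.removeNth ((M.face e).chart y)) '' frontier (M.face e).dom ∪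
    {z | ((M.face e).projMatrix j).det = 0 ∧
      z ∈ (fun y => j.removeNth ((M.face e).chart y)) '' (M.face e).dom})

/-- The relative boundary of a face is null in its plane and stays null under projection; a face
parallel to the axis has `det = 0` and projects to a null set. -/
theorem volume_badLines [Finite κ] (M : Mesh Ω ι κ) (j : Fin 3) : volume (M.badLines j) = 0 := by
  refine measure_iUnion_null fun e => measure_union_null ?_ ?_
  · rw [Face.volume_image_removeNth_chart, (M.face e).polygonal.frontier_null, mul_zero]
  · by_cases h : ((M.face e).projMatrix j).det = 0
    · refine measure_mono_null (fun z hz => hz.2) ?_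
      rw [Face.volume_image_removeNth_chart, h]
      simp
    · simp [h]

theorem mem_relInterior_of_notMem_badLines (M : Mesh Ω ι κ) {j : Fin 3} {x : Fin 3 → ℝ}
    (hx : j.removeNth x ∉ M.badLines j) {e : κ} (he : x ∈ (M.face e).carrier) :
    x ∈ (M.face e).relInterior ∧ ((M.face e).projMatrix j).det ≠ 0 := by
  obtain ⟨y, hy, rfl⟩ := he
  simp only [badLines, Set.mem_iUnion, not_exists, Set.mem_union, not_or] at hx
  obtain ⟨h1, h2⟩ := hx e
  refine ⟨⟨y, ?_, rfl⟩, fun h => h2 ⟨h, y, hy, rfl⟩⟩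
  by_contra hy'
  exact h1 ⟨y, ⟨subset_closure hy, hy'⟩, rfl⟩

/-- `x` lies in the relative interior of the face `e` and on no other face. -/
def IsRegularPoint (M : Mesh Ω ι κ) (e : κ) (x : Fin 3 → ℝ) : Prop :=
  x ∈ (M.face e).relInterior ∧ ∀ e', x ∈ (M.face e').carrier → e' = e

/-- Off the bad lines a point of a face is in its relative interior, and relative interiors of
distinct faces are disjoint. -/
theorem isRegularPoint_of_notMem_badLines (M : Mesh Ω ι κ) {j : Fin 3} {x : Fin 3 → ℝ}
    (hx : j.removeNth x ∉ M.badLines j) {e : κ} (he : x ∈ (M.face e).carrier) :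
    M.IsRegularPoint e x := by
  refine ⟨(M.mem_relInterior_of_notMem_badLines hx he).1, fun e' he' => ?_⟩
  by_contra hne
  exact Set.disjoint_left.1 (M.face_disjoint hne)
    (M.mem_relInterior_of_notMem_badLines hx he').1 (M.mem_relInterior_of_notMem_badLines hx he).1

/-- Near a regular point of a face, all element boundaries lie in the plane of that face. -/
theorem IsRegularPoint.exists_ball [Finite κ] {M : Mesh Ω ι κ} {e : κ} {x : Fin 3 → ℝ}
    (hx : M.IsRegularPoint e x) {n : Fin 3 → ℝ} (hn : (M.face e).IsUnitNormal n)
    {U : Set (Fin 3 → ℝ)} (hU : U ∈ nhds x) :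
    ∃ r > 0, Metric.ball x r ⊆ U ∧ ∀ y ∈ Metric.ball x r, ∀ i, y ∈ frontier (M.elem i) →
      e ∈ M.faces i ∧ (y - x) ⬝ᵥ n = 0 := by
  have hcl : IsClosed (⋃ e' ∈ {e' | e' ≠ e}, (M.face e').carrier) := by
    refine (Set.toFinite _).isClosed_biUnion fun e' _ => ?_
    exact ((M.face e').polygonal.isCompact.image (continuous_chart _)).isClosed
  have hx' : x ∉ ⋃ e' ∈ {e' | e' ≠ e}, (M.face e').carrier := by
    simp only [Set.mem_iUnion, not_exists]
    intro e' he' hxe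
    exact he' (hx.2 e' hxe)
  obtain ⟨r, hr, hb⟩ := Metric.mem_nhds_iff.1 (Filter.inter_mem hU (hcl.isOpen_compl.mem_nhds hx'))
  refine ⟨r, hr, hb.trans Set.inter_subset_left, fun y hy i hyi => ?_⟩
  rw [M.elem_frontier i] at hyi
  simp only [Set.mem_iUnion] at hyi
  obtain ⟨e', he', hye⟩ := hyi
  have : e' = e := by
    by_contra hne
    exact (hb hy).2 (Set.mem_biUnion (show e' ∈ {e' | e' ≠ e} from hne) hye)
  subst this
  refine ⟨he', ?_⟩
  obtain ⟨y', -, rfl⟩ := hye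
  obtain ⟨x', -, rfl⟩ := hx.1
  exact Face.dotProduct_chart_sub hn _ _

end Mesh

/-- A preconnected set that misses the frontier of `T` lies inside or outside of `T`. -/
theorem subset_interior_or_disjoint {X : Type*} [TopologicalSpace X] {T H : Set X}
    (hH : IsPreconnected H) (h : ∀ y ∈ H, y ∉ frontier T) : H ⊆ interior T ∨ H ⊆ Tᶜ := by
  have h1 : H ⊆ interior T ∪ (closure T)ᶜ := by
    intro y hy
    by_cases hi : y ∈ interior T
    · exact Or.inl hi
    · exact Or.inr fun hc => h y hy ⟨hc, hi⟩
  refine (hH.subset_or_subset isOpen_interior isClosed_closure.isOpen_compl ?_ h1).imp_right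
    fun h2 => h2.trans (Set.compl_subset_compl.2 subset_closure)
  exact Set.disjoint_left.2 fun y hy hy' => hy' (subset_closure (interior_subset hy))

theorem isPreconnected_halfBall (x n : Fin 3 → ℝ) (r : ℝ) :
    IsPreconnected (Metric.ball x r ∩ {y | (y - x) ⬝ᵥ n < 0}) := by
  refine Convex.isPreconnected ((convex_ball x r).inter ?_)
  have : {y : Fin 3 → ℝ | (y - x) ⬝ᵥ n < 0} = {y | (dotProductBilin ℝ ℝ n) y < n ⬝ᵥ x} := by
    ext y
    simp [dotProduct_comm]
  rw [this]
  exact convex_halfSpace_lt (LinearMap.isLinear _) _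

namespace Mesh

variable {Ω : Set (Fin 3 → ℝ)} {ι κ : Type*}

/-- Near a regular point of a face `e` of the element `i`, the element is a half space. -/
theorem IsRegularPoint.exists_halfBall [Finite κ] {M : Mesh Ω ι κ} {e : κ} {x : Fin 3 → ℝ}
    (hx : M.IsRegularPoint e x) {i : ι} (he : e ∈ M.faces i) {r : ℝ} (hr : 0 < r)
    (hb : ∀ y ∈ Metric.ball x r, y ∈ frontier (M.elem i) → (y - x) ⬝ᵥ M.normal i e = 0) :
    (∀ y ∈ Metric.ball x r, (y - x) ⬝ᵥ M.normal i e < 0 → y ∈ interior (M.elem i)) ∧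
    (∀ y ∈ Metric.ball x r, 0 < (y - x) ⬝ᵥ M.normal i e → y ∉ M.elem i) := by
  obtain ⟨hn1, -, hout⟩ := M.normal_outward i e he
  set n := M.normal i e
  obtain ⟨δ, hδ, hs⟩ := hout x hx.1
  -- A step short enough that the probe points `x ± s n` obey the outward condition and stay in the
  -- ball.
  obtain ⟨s, hs0, hsδ, hsr⟩ : ∃ s : ℝ, 0 < s ∧ s < δ ∧ s * ‖n‖ < r := by
    have : Filter.Tendsto (fun s : ℝ => s * ‖n‖) (nhdsWithin 0 (Set.Ioi 0)) (nhds 0) := by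
      have : Filter.Tendsto (fun s : ℝ => s * ‖n‖) (nhds 0) (nhds (0 * ‖n‖)) :=
        (continuous_id.mul continuous_const).tendsto 0
      rw [zero_mul] at this
      exact this.mono_left nhdsWithin_le_nhds
    obtain ⟨s, h1, h2⟩ := ((this.eventually_lt_const hr).and
      (Ioo_mem_nhdsGT hδ)).exists
    exact ⟨s, h2.1, h2.2, h1⟩
  obtain ⟨hin, hnot⟩ := hs s hs0 hsδ
  constructor
  · intro y hy hyn
    -- The open half ball is connected and misses the frontier, so it lies entirely inside or
    -- entirely outside; the probe point `x - s n` decides.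
    have hH : Metric.ball x r ∩ {y | (y - x) ⬝ᵥ n < 0} ⊆ interior (M.elem i) := by
      refine (subset_interior_or_disjoint (isPreconnected_halfBall x n r)
        fun y hy hyf => (hy.2 : _ < _).ne (hb y hy.1 hyf)).resolve_right fun h => ?_
      refine h ⟨?_, ?_⟩ (interior_subset hin)
      · simpa [norm_smul, abs_of_pos hs0] using hsr
      · simpa [hn1] using hs0
    exact hH ⟨hy, hyn⟩
  · intro y hy hyn
    have hH : Metric.ball x r ∩ {y | (y - x) ⬝ᵥ (-n) < 0} ⊆ (M.elem i)ᶜ := by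
      refine (subset_interior_or_disjoint (isPreconnected_halfBall x (-n) r)
        fun y hy hyf => (show (y - x) ⬝ᵥ (-n) < 0 from hy.2).ne
          (by rw [dotProduct_neg, hb y hy.1 hyf, neg_zero])).resolve_left
        fun h => hnot (interior_subset (h ⟨?_, ?_⟩))
      · simpa [norm_smul, abs_of_pos hs0] using hsr
      · simpa [hn1] using hs0
    exact hH ⟨hy, by simpa using hyn⟩

theorem exists_isUnitNormal (M : Mesh Ω ι κ) (e : κ) : ∃ n, (M.face e).IsUnitNormal n := by
  obtain ⟨i, hi⟩ := M.face_used e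
  exact ⟨_, M.normal_isUnitNormal hi⟩

/-- Every face has regular points in every open set that it meets. -/
theorem exists_isRegularPoint [Finite κ] (M : Mesh Ω ι κ) {e : κ} {U : Set (Fin 3 → ℝ)}
    (hU : IsOpen U) {x : Fin 3 → ℝ} (hx : x ∈ (M.face e).carrier) (hxU : x ∈ U) :
    ∃ x' ∈ U, M.IsRegularPoint e x' := by
  obtain ⟨y, hy, rfl⟩ := hx
  set O := (M.face e).chart ⁻¹' U ∩ interior (M.face e).dom with hO
  have hOo : IsOpen O := (hU.preimage (continuous_chart _)).inter isOpen_interior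
  have hOn : O.Nonempty := mem_closure_iff.1 ((M.face e).polygonal.closure_interior hy) _
    (hU.preimage (continuous_chart _)) hxU
  obtain ⟨n, hn⟩ := M.exists_isUnitNormal e
  -- Along an axis with `n_j ≠ 0` the relatively open piece `O` projects to positive area, which the
  -- null set of bad lines cannot cover.
  obtain ⟨j, hj⟩ := Function.ne_iff.1 hn.ne_zero
  have hpos : volume ((fun y => j.removeNth ((M.face e).chart y)) '' O) ≠ 0 := by
    rw [Face.volume_image_removeNth_chart, hn.abs_det_projMatrix]
    refine mul_ne_zero ?_ (hOo.measure_pos _ hOn).ne'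
    simpa using hj
  have hns : ¬ (fun y => j.removeNth ((M.face e).chart y)) '' O ⊆ M.badLines j :=
    fun h => hpos (measure_mono_null h (M.volume_badLines j))
  obtain ⟨z, ⟨y', hy', rfl⟩, hz⟩ := Set.not_subset.1 hns
  exact ⟨_, hy'.1, M.isRegularPoint_of_notMem_badLines hz ⟨y', interior_subset hy'.2, rfl⟩⟩

theorem exists_isRegularPoint_face [Finite κ] (M : Mesh Ω ι κ) (e : κ) :
    ∃ x, M.IsRegularPoint e x := by
  obtain ⟨y, hy⟩ := (M.face e).polygonal.nonempty_interior
  obtain ⟨x, -, hx⟩ := M.exists_isRegularPoint isOpen_univ (x := (M.face e).chart y)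
    ⟨y, interior_subset hy, rfl⟩ (Set.mem_univ _)
  exact ⟨x, hx⟩

/-- Points of every ball on a prescribed side of a plane through the centre. -/
theorem exists_mem_ball_dotProduct_pos (x : Fin 3 → ℝ) {n : Fin 3 → ℝ} (hn : n ⬝ᵥ n = 1) {r : ℝ}
    (hr : 0 < r) : ∃ y ∈ Metric.ball x r, 0 < (y - x) ⬝ᵥ n := by
  have hn0 : 0 < ‖n‖ := by
    rw [norm_pos_iff]
    rintro rfl
    simp at hn
  refine ⟨x + (r / 2 / ‖n‖) • n, ?_, ?_⟩
  · rw [mem_ball_iff_norm, add_sub_cancel_left, norm_smul, Real.norm_of_nonneg (by positivity),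
      div_mul_cancel₀ _ hn0.ne']
    linarith
  · rw [add_sub_cancel_left, smul_dotProduct, hn, smul_eq_mul]
    positivity

/-- Unit normals of a plane agree up to sign. With equal signs both elements would contain the same
half ball at a regular point, against disjointness of their interiors. -/
theorem normal_eq_neg [Finite κ] (M : Mesh Ω ι κ) {e : κ} {i l : ι} (hi : e ∈ M.faces i)
    (hl : e ∈ M.faces l) (hil : i ≠ l) : M.normal l e = -M.normal i e := by
  refine ((M.normal_isUnitNormal hi).eq_or_eq_neg (M.normal_isUnitNormal hl)).resolve_left
    fun h => ?_
  obtain ⟨x, hx⟩ := M.exists_isRegularPoint_face e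
  obtain ⟨r, hr, -, hb⟩ := hx.exists_ball (M.normal_isUnitNormal hi) Filter.univ_mem
  have h1 := (hx.exists_halfBall hi hr fun y hy hyf => (hb y hy i hyf).2).1
  have h2 := (hx.exists_halfBall hl hr fun y hy hyf => h ▸ (hb y hy l hyf).2).1
  obtain ⟨y, hy, hyn⟩ := exists_mem_ball_dotProduct_pos x (n := -M.normal i e)
    (by simpa using (M.normal_isUnitNormal hi).1) hr
  rw [dotProduct_neg, neg_pos] at hyn
  exact Set.disjoint_left.1 (M.elem_disjoint hil) (h1 y hy hyn) (h2 y hy (h ▸ hyn))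

theorem isClosed_elem (M : Mesh Ω ι κ) (i : ι) : IsClosed (M.elem i) :=
  (M.elem_polyhedral i).isCompact.isClosed

theorem elem_subset (M : Mesh Ω ι κ) (i : ι) : M.elem i ⊆ closure Ω := by
  rw [← M.elem_cover]
  exact Set.subset_iUnion _ i

theorem carrier_subset_elem (M : Mesh Ω ι κ) {e : κ} {i : ι} (hi : e ∈ M.faces i) :
    (M.face e).carrier ⊆ M.elem i := by
  refine Set.Subset.trans ?_ (M.isClosed_elem i).frontier_subset
  rw [M.elem_frontier i]
  exact Set.subset_biUnion_of_mem (u := fun e => (M.face e).carrier) hi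

/-- A face inside the domain is shared by two elements. -/
theorem exists_neighbour [Finite κ] (hΩ : interior (closure Ω) = Ω) (M : Mesh Ω ι κ) {e : κ}
    {i : ι} (hi : e ∈ M.faces i) (he : ¬ M.IsBoundary e) : ∃ l, l ≠ i ∧ e ∈ M.faces l := by
  obtain ⟨x₀, hx₀, hx₀'⟩ := Set.not_subset.1 he
  have hΩo : IsOpen Ω := hΩ ▸ isOpen_interior
  have hxΩ : x₀ ∈ Ω := by
    by_contra h
    exact hx₀' ⟨M.elem_subset i (M.carrier_subset_elem hi hx₀), by rwa [hΩo.interior_eq]⟩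
  obtain ⟨x, hxU, hx⟩ := M.exists_isRegularPoint hΩo hx₀ hxΩ
  have hn := M.normal_isUnitNormal hi
  obtain ⟨r, hr, hbU, hb⟩ := hx.exists_ball hn (hΩo.mem_nhds hxU)
  obtain ⟨hin, hout⟩ := hx.exists_halfBall hi hr fun y hy hyf => (hb y hy i hyf).2
  -- A point just outside element `i` but still in `Ω`; the element that covers it is the neighbour.
  obtain ⟨y, hy, hyn⟩ := exists_mem_ball_dotProduct_pos x hn.1 hr
  obtain ⟨l, hyl⟩ := Set.mem_iUnion.1 (M.elem_cover.symm ▸ subset_closure (hbU hy))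
  have hli : l ≠ i := by
    rintro rfl
    exact hout y hy hyn hyl
  refine ⟨l, hli, ?_⟩
  by_contra hel
  -- If `e` were not a face of `l`, the ball would miss the frontier of `l`, lie inside `l`, and
  -- overlap `i` on the inner side.
  have hball : Metric.ball x r ⊆ interior (M.elem l) := by
    refine (subset_interior_or_disjoint (convex_ball x r).isPreconnected
      fun y hy hyf => hel (hb y hy l hyf).1).resolve_right fun h => h hy hyl
  obtain ⟨w, hw, hwn⟩ := exists_mem_ball_dotProduct_pos x (n := -M.normal i e)
    (by simpa using hn.1) hr
  rw [dotProduct_neg, neg_pos] at hwn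
  exact Set.disjoint_left.1 (M.elem_disjoint hli) (hball hw) (hin w hw hwn)

/-- A face on the boundary of the domain belongs to only one element. -/
theorem eq_of_isBoundary [Finite κ] (hΩ : interior (closure Ω) = Ω) (M : Mesh Ω ι κ) {e : κ}
    {i l : ι} (hi : e ∈ M.faces i) (hl : e ∈ M.faces l) (he : M.IsBoundary e) : i = l := by
  by_contra hil
  have hneg := M.normal_eq_neg hi hl hil
  obtain ⟨x, hx⟩ := M.exists_isRegularPoint_face e
  have hn := M.normal_isUnitNormal hi
  obtain ⟨r, hr, -, hb⟩ := hx.exists_ball hn Filter.univ_mem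
  have h1 := (hx.exists_halfBall hi hr fun y hy hyf => (hb y hy i hyf).2).1
  have h2 := (hx.exists_halfBall hl hr fun y hy hyf => by
    rw [hneg, dotProduct_neg, (hb y hy l hyf).2, neg_zero]).1
  have hsub : Metric.ball x r ∩ {y | (y - x) ⬝ᵥ M.normal i e ≠ 0} ⊆ closure Ω := by
    rintro y ⟨hy, hyn⟩
    rcases lt_or_gt_of_ne hyn with h | h
    · exact M.elem_subset i (interior_subset (h1 y hy h))
    · exact M.elem_subset l (interior_subset (h2 y hy (by rw [hneg, dotProduct_neg]; linarith)))
  have hball : Metric.ball x r ⊆ closure Ω := by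
    intro y hy
    refine closure_minimal hsub isClosed_closure (mem_closure_iff.2 fun U hU hyU => ?_)
    by_cases hyn : (y - x) ⬝ᵥ M.normal i e = 0
    · obtain ⟨s, hs, hs'⟩ := Metric.isOpen_iff.1 (hU.inter Metric.isOpen_ball) y ⟨hyU, hy⟩
      obtain ⟨w, hw, hwn⟩ := exists_mem_ball_dotProduct_pos y hn.1 hs
      refine ⟨w, (hs' hw).1, (hs' hw).2, ?_⟩
      have : (w - x) ⬝ᵥ M.normal i e = (w - y) ⬝ᵥ M.normal i e + (y - x) ⬝ᵥ M.normal i e := by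
        rw [← add_dotProduct, sub_add_sub_cancel]
      rw [Set.mem_ofPred_eq, this, hyn, add_zero]
      exact hwn.ne'
    · exact ⟨y, hyU, hy, hyn⟩
  -- Two elements on opposite sides of `e` fill a ball around `x`. Regularity of `Ω` (no slits) puts
  -- `x` in `Ω` itself, hence not on its frontier.
  have hxΩ : x ∈ interior (closure Ω) :=
    mem_interior.2 ⟨_, hball, Metric.isOpen_ball, Metric.mem_ball_self hr⟩
  obtain ⟨y, hy, rfl⟩ := hx.1
  refine (he ⟨y, interior_subset hy, rfl⟩).2 ?_
  exact ((hΩ ▸ isOpen_interior : IsOpen Ω).interior_eq.trans hΩ.symm).ge hxΩ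

end Mesh

/-! ### Calculus on a line for functions with finitely many jumps. -/

open Filter Topology in
/-- A function on the line that is locally constant up to finitely many jumps and vanishes far away
is the sum of its jumps. -/
theorem eq_sum_jumps {α : Type*} (E : Finset α) (τ σ : α → ℝ) (c : ℝ → ℝ)
    (hloc : ∀ t, (∀ e ∈ E, τ e ≠ t) → ∀ᶠ s in 𝓝 t, c s = c t)
    (hjump : ∀ e ∈ E, ∃ a, (∀ᶠ s in 𝓝[<] (τ e), c s = a + σ e) ∧ ∀ᶠ s in 𝓝[>] (τ e), c s = a)
    (hinj : ∀ e ∈ E, ∀ e' ∈ E, τ e' = τ e → e' = e) {R : ℝ} (hR : ∀ t, R ≤ t → c t = 0)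
    {t : ℝ} (ht : ∀ e ∈ E, τ e ≠ t) : c t = ∑ e ∈ E, if t < τ e then σ e else 0 := by
  classical
  -- The step function has the same jumps as `c`, so the one-sided values of `D` agree at every
  -- point; the values at the jumps themselves are not controlled, which is why punctured
  -- neighbourhoods appear.
  set D : ℝ → ℝ := fun t => c t - ∑ e ∈ E, if t < τ e then σ e else 0 with hD
  have hstep : ∀ (t : ℝ) (E' : Finset α), (∀ e ∈ E', τ e ≠ t) → ∀ᶠ s in 𝓝 t,
      (∑ e ∈ E', if s < τ e then σ e else 0) = ∑ e ∈ E', if t < τ e then σ e else 0 := by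
    intro t E' hE'
    have : ∀ e ∈ E', ∀ᶠ s in 𝓝 t, (if s < τ e then σ e else 0) = if t < τ e then σ e else 0 := by
      intro e he
      rcases lt_or_gt_of_ne (hE' e he) with h | h
      · filter_upwards [lt_mem_nhds h] with s hs
        rw [if_neg hs.not_gt, if_neg h.not_gt]
      · filter_upwards [gt_mem_nhds h] with s hs
        rw [if_pos hs, if_pos h]
    filter_upwards [(eventually_all_finset E').2 this] with s hs
    exact Finset.sum_congr rfl hs
  have hoff : ∀ t, (∀ e ∈ E, τ e ≠ t) → ∀ᶠ s in 𝓝 t, D s = D t := by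
    intro t ht
    filter_upwards [hloc t ht, hstep t E ht] with s h1 h2
    simp only [hD, h1, h2]
  have hpunct : ∀ t, ∃ v, ∀ᶠ s in 𝓝[≠] t, D s = v := by
    intro t
    by_cases ht : ∀ e ∈ E, τ e ≠ t
    · exact ⟨_, (hoff t ht).filter_mono nhdsWithin_le_nhds⟩
    push Not at ht
    obtain ⟨e, he, rfl⟩ := ht
    obtain ⟨a, hl, hr⟩ := hjump e he
    have hE := hstep (τ e) (E.erase e) fun e' he' h =>
      (Finset.mem_erase.1 he').1 (hinj e he e' (Finset.mem_erase.1 he').2 h)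
    refine ⟨a - ∑ e' ∈ E.erase e, if τ e < τ e' then σ e' else 0, ?_⟩
    rw [← Set.Iio_union_Ioi, nhdsWithin_union, eventually_sup]
    constructor
    · filter_upwards [hl, hE.filter_mono nhdsWithin_le_nhds, self_mem_nhdsWithin] with s h1 h2 h3
      simp only [hD]
      rw [← Finset.add_sum_erase _ _ he, h1, h2, if_pos (Set.mem_Iio.1 h3)]
      ring
    · filter_upwards [hr, hE.filter_mono nhdsWithin_le_nhds, self_mem_nhdsWithin] with s h1 h2 h3
      simp only [hD]
      rw [← Finset.add_sum_erase _ _ he, h1, h2, if_neg (not_lt.2 (Set.mem_Ioi.1 h3).le)]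
      ring
  -- This set is clopen, because the punctured value of `D` is locally constant, and it contains
  -- points far to the right, where `c` and the step function both vanish.
  set A : Set ℝ := {t | ∀ᶠ s in 𝓝[≠] t, D s = 0} with hA
  have hprop : ∀ (v t : ℝ), (∀ᶠ s in 𝓝[≠] t, D s = v) →
      ∀ᶠ u in 𝓝 t, ∀ᶠ s in 𝓝[≠] u, D s = v := by
    intro v t h
    have h1 : ∀ᶠ u in 𝓝[≠] t, ∀ᶠ s in 𝓝[≠] u, D s = v := by
      filter_upwards [eventually_eventually_nhdsWithin.2 h, self_mem_nhdsWithin] with u hu hut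
      have hmem : ({t}ᶜ : Set ℝ) ∈ 𝓝 u := isOpen_compl_singleton.mem_nhds hut
      rw [nhdsWithin_eq_nhds.2 hmem] at hu
      exact hu.filter_mono nhdsWithin_le_nhds
    rw [eventually_nhdsWithin_iff] at h1
    filter_upwards [h1] with u hu
    by_cases hut : u = t
    · rwa [hut]
    · exact hu hut
  have hAo : IsOpen A := isOpen_iff_eventually.2 fun t ht => hprop 0 t ht
  have hAc : IsClosed A := by
    rw [← isOpen_compl_iff, isOpen_iff_eventually]
    intro t ht
    obtain ⟨v, hv⟩ := hpunct t
    have hv0 : v ≠ 0 := by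
      rintro rfl
      exact ht hv
    filter_upwards [hprop v t hv] with u hu h
    obtain ⟨s, h1, h2⟩ := (hu.and h).exists
    exact hv0 (h1.symm.trans h2)
  have hAne : A.Nonempty := by
    obtain ⟨B, hB⟩ := (E.image τ).bddAbove
    refine ⟨max R B + 1, ?_⟩
    have : ∀ᶠ s in 𝓝 (max R B + 1), D s = 0 := by
      filter_upwards [lt_mem_nhds (lt_add_one (max R B))] with s hs
      have h1 := hR s ((le_max_left R B).trans hs.le)
      simp only [hD, h1, zero_sub, neg_eq_zero]
      refine Finset.sum_eq_zero fun e he => if_neg (not_lt.2 ?_)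
      exact (hB (Finset.mem_coe.2 (Finset.mem_image_of_mem τ he))).trans
        ((le_max_right R B).trans hs.le)
    exact this.filter_mono nhdsWithin_le_nhds
  have hAu : A = Set.univ := IsClopen.eq_univ ⟨hAc, hAo⟩ hAne
  have h0 : ∀ᶠ s in 𝓝[≠] t, D s = 0 := (hAu ▸ Set.mem_univ t : t ∈ A)
  obtain ⟨s, h1, h2⟩ := (h0.and ((hoff t ht).filter_mono nhdsWithin_le_nhds)).exists
  have : D t = 0 := h2.symm.trans h1
  simpa [hD, sub_eq_zero] using this

open Filter Topology in
/-- The fundamental theorem of calculus on a set described by finitely many jumps of its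
indicator function. -/
theorem integral_mul_deriv_eq_sum_jumps {α : Type*} (E : Finset α) (τ σ : α → ℝ) (c : ℝ → ℝ)
    (hloc : ∀ t, (∀ e ∈ E, τ e ≠ t) → ∀ᶠ s in 𝓝 t, c s = c t)
    (hjump : ∀ e ∈ E, ∃ a, (∀ᶠ s in 𝓝[<] (τ e), c s = a + σ e) ∧ ∀ᶠ s in 𝓝[>] (τ e), c s = a)
    (hinj : ∀ e ∈ E, ∀ e' ∈ E, τ e' = τ e → e' = e) {R : ℝ} (hR : ∀ t, R ≤ |t| → c t = 0)
    {g g' : ℝ → ℝ} (hg : ∀ t, HasDerivAt g (g' t) t) (hg' : Continuous g') :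
    ∫ t, c t * g' t = ∑ e ∈ E, σ e * g (τ e) := by
  classical
  have hid : ∀ t, (∀ e ∈ E, τ e ≠ t) → c t = ∑ e ∈ E, if t < τ e then σ e else 0 := fun t ht =>
    eq_sum_jumps E τ σ c hloc hjump hinj (R := R) (fun s hs => hR s (hs.trans (le_abs_self s))) ht
  obtain ⟨B, hB⟩ := (E.image τ).bddBelow
  have hB' : ∀ e ∈ E, B ≤ τ e := fun e he => hB (Finset.mem_coe.2 (Finset.mem_image_of_mem τ he))
  set m : ℝ := min B (-|R|) - 1 with hm
  have hmτ : ∀ e ∈ E, m < τ e := fun e he => by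
    have := min_le_left B (-|R|)
    linarith [hB' e he]
  have hmc : ∀ t, t ≤ m → c t = 0 := fun t ht => hR t (by
    have h1 := min_le_right B (-|R|)
    have h2 := neg_abs_le t
    have h3 := le_abs_self R
    linarith [neg_le_abs t])
  -- To the left of all jumps `c` vanishes too, so the jumps add up to zero; this removes the terms
  -- `σ e * g m` at the lower end point.
  have hsum : ∑ e ∈ E, σ e = 0 := by
    have := hid m fun e he => (hmτ e he).ne'
    rw [hmc m le_rfl] at this
    rw [this]
    exact Finset.sum_congr rfl fun e he => (if_pos (hmτ e he)).symm
  have hae : ∀ᵐ t, c t * g' t =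
      ∑ e ∈ E, (Set.Ioc m (τ e)).indicator (fun s => σ e * g' s) t := by
    have hfin : ((E.image τ : Finset ℝ) : Set ℝ)ᶜ ∈ ae (volume : Measure ℝ) :=
      (Finset.finite_toSet _).countable.ae_notMem _
    filter_upwards [hfin] with t ht
    have ht' : ∀ e ∈ E, τ e ≠ t := fun e he h =>
      ht (Finset.mem_coe.2 (Finset.mem_image.2 ⟨e, he, h⟩))
    by_cases hmt : m < t
    · rw [hid t ht', Finset.sum_mul]
      refine Finset.sum_congr rfl fun e he => ?_
      by_cases h : t < τ e
      · rw [if_pos h, Set.indicator_of_mem (Set.mem_Ioc.2 ⟨hmt, h.le⟩)]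
      · rw [if_neg h, Set.indicator_of_notMem, zero_mul]
        exact fun h' => h (lt_of_le_of_ne h'.2 (ht' e he).symm)
    · rw [hmc t (not_lt.1 hmt), zero_mul]
      exact (Finset.sum_eq_zero fun e _ => Set.indicator_of_notMem (fun h' => hmt h'.1) _).symm
  rw [integral_congr_ae hae, integral_finsetSum]
  · have : ∀ e ∈ E, ∫ t, (Set.Ioc m (τ e)).indicator (fun s => σ e * g' s) t =
        σ e * g (τ e) - σ e * g m := by
      intro e he
      rw [integral_indicator measurableSet_Ioc, integral_const_mul,
        ← intervalIntegral.integral_of_le (hmτ e he).le,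
        intervalIntegral.integral_eq_sub_of_hasDerivAt (fun t _ => hg t)
          (hg'.intervalIntegrable _ _), mul_sub]
    rw [Finset.sum_congr rfl this, Finset.sum_sub_distrib, ← Finset.sum_mul, hsum]
    ring
  · intro e _
    rw [integrable_indicator_iff measurableSet_Ioc]
    exact ((continuous_const.mul hg').integrableOn_Icc).mono_set Set.Ioc_subset_Icc_self

/-! ### The divergence theorem on an element. -/

/-- The `j`-th coordinate of the point of the plane of a face with the other coordinates `z`. -/
def Face.height (F : Face) (n : Fin 3 → ℝ) (j : Fin 3) (z : Fin 2 → ℝ) : ℝ :=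
  (F.origin ⬝ᵥ n - ∑ b, z b * n (j.succAbove b)) / n j

theorem Face.continuous_height (F : Face) (n : Fin 3 → ℝ) (j : Fin 3) :
    Continuous (F.height n j) := by
  unfold Face.height
  fun_prop

theorem Face.IsUnitNormal.height_eq {F : Face} {n : Fin 3 → ℝ} (hn : F.IsUnitNormal n) {j : Fin 3}
    (hj : n j ≠ 0) (y : Fin 2 → ℝ) :
    F.height n j (j.removeNth (F.chart y)) = F.chart y j := by
  have h1 : F.chart y ⬝ᵥ n = F.origin ⬝ᵥ n := by
    have := Face.dotProduct_chart_sub hn y 0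
    have h0 : F.chart 0 = F.origin := by simp [Face.chart]
    rwa [h0, sub_dotProduct, sub_eq_zero] at this
  rw [Face.height, ← h1, div_eq_iff hj, dotProduct, Fin.sum_univ_succAbove _ j]
  simp [Fin.removeNth]

theorem Face.IsUnitNormal.insertNth_height {F : Face} {n : Fin 3 → ℝ} (hn : F.IsUnitNormal n)
    {j : Fin 3} (hj : n j ≠ 0) (y : Fin 2 → ℝ) :
    j.insertNth (α := fun _ => ℝ) (F.height n j (j.removeNth (F.chart y)))
      (j.removeNth (F.chart y)) = F.chart y := by
  rw [hn.height_eq hj, Fin.insertNth_self_removeNth]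

namespace Mesh

variable {Ω : Set (Fin 3 → ℝ)} {ι κ : Type*}

theorem continuous_insertNth (j : Fin 3) (z : Fin 2 → ℝ) :
    Continuous fun t : ℝ => j.insertNth (α := fun _ => ℝ) t z :=
  Continuous.finInsertNth (A := fun _ => ℝ) j continuous_id continuous_const

theorem insertNth_sub_dotProduct (j : Fin 3) (z : Fin 2 → ℝ) (s t : ℝ) (n : Fin 3 → ℝ) :
    (j.insertNth (α := fun _ => ℝ) s z - j.insertNth (α := fun _ => ℝ) t z) ⬝ᵥ n =
      (s - t) * n j := by
  rw [dotProduct, Fin.sum_univ_succAbove _ j]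
  simp

/-- The projection of a face along the `j`-th axis. -/
def shadow (M : Mesh Ω ι κ) (j : Fin 3) (e : κ) : Set (Fin 2 → ℝ) :=
  (fun y => j.removeNth ((M.face e).chart y)) '' (M.face e).dom

theorem continuous_removeNth_chart (F : Face) (j : Fin 3) :
    Continuous fun y => j.removeNth (F.chart y) :=
  continuous_pi fun _ => (continuous_apply _).comp (continuous_chart F)

theorem isCompact_shadow (M : Mesh Ω ι κ) (j : Fin 3) (e : κ) : IsCompact (M.shadow j e) :=
  (M.face e).polygonal.isCompact.image (continuous_removeNth_chart _ j)

open Filter Topology in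
/-- The fundamental theorem of calculus on the intersection of an element with a line parallel to
the `j`-th axis. -/
theorem integral_line [Finite κ] (M : Mesh Ω ι κ) (i : ι) (j : Fin 3) {z : Fin 2 → ℝ}
    (hz : z ∉ M.badLines j) (P : MvPolynomial (Fin 3) ℝ) :
    ∫ t, (M.elem i).indicator (fun x => MvPolynomial.eval x (MvPolynomial.pderiv j P))
        (j.insertNth (α := fun _ => ℝ) t z) =
      ∑ e ∈ M.faces i, (M.shadow j e).indicator (fun z =>
        (M.normal i e j / |M.normal i e j|) * MvPolynomial.eval
          (j.insertNth (α := fun _ => ℝ) ((M.face e).height (M.normal i e) j z) z) P) z := by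
  classical
  set ℓ : ℝ → Fin 3 → ℝ := fun t => j.insertNth (α := fun _ => ℝ) t z with hℓ
  have hℓc : Continuous ℓ := continuous_insertNth j z
  have hproj : ∀ t, j.removeNth (ℓ t) = z := fun t => by
    ext b
    simp [hℓ, Fin.removeNth]
  set E : Finset κ := {e ∈ M.faces i | z ∈ M.shadow j e} with hE
  set τ : κ → ℝ := fun e => (M.face e).height (M.normal i e) j z with hτ
  -- The sign of `n_j`: for `n_j > 0` the upward line leaves the element at the crossing (value 1
  -- before, 0 after), for `n_j < 0` it enters.
  set σ : κ → ℝ := fun e => M.normal i e j / |M.normal i e j| with hσ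
  set c : ℝ → ℝ := fun t => (M.elem i).indicator (fun _ => 1) (ℓ t) with hc
  have hcar : ∀ e ∈ E, ℓ (τ e) ∈ (M.face e).carrier ∧ M.normal i e j ≠ 0 := by
    intro e he
    obtain ⟨he1, y, hy, hyz⟩ := Finset.mem_filter.1 he
    have hn := M.normal_isUnitNormal he1
    have hnj : M.normal i e j ≠ 0 := by
      have hz' : j.removeNth ((M.face e).chart y) ∉ M.badLines j := by
        rw [show j.removeNth ((M.face e).chart y) = z from hyz]
        exact hz
      have := (M.mem_relInterior_of_notMem_badLines hz' ⟨y, hy, rfl⟩).2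
      rwa [← abs_ne_zero, hn.abs_det_projMatrix, abs_ne_zero] at this
    refine ⟨⟨y, hy, ?_⟩, hnj⟩
    rw [← hn.insertNth_height hnj y]
    simp only [hℓ, hτ, ← hyz]
  have hreg : ∀ e t, ℓ t ∈ (M.face e).carrier → M.IsRegularPoint e (ℓ t) := fun e t h =>
    M.isRegularPoint_of_notMem_badLines (by rwa [hproj t]) h
  have hmem : ∀ e ∈ M.faces i, ∀ t, ℓ t ∈ (M.face e).carrier → e ∈ E ∧ τ e = t := by
    intro e he t ht
    have hn := M.normal_isUnitNormal he
    have hnj : M.normal i e j ≠ 0 := by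
      have := (M.mem_relInterior_of_notMem_badLines (j := j) (by rwa [hproj t]) ht).2
      rwa [← abs_ne_zero, hn.abs_det_projMatrix, abs_ne_zero] at this
    obtain ⟨y, hy, hyt⟩ := ht
    have hyz : j.removeNth ((M.face e).chart y) = z := by rw [hyt, hproj t]
    refine ⟨Finset.mem_filter.2 ⟨he, y, hy, hyz⟩, ?_⟩
    simp only [hτ]
    rw [← hyz, hn.height_eq hnj, hyt]
    simp [hℓ]
  have hmain := integral_mul_deriv_eq_sum_jumps E τ σ c (g := fun t => MvPolynomial.eval (ℓ t) P)
    (g' := fun t => MvPolynomial.eval (ℓ t) (MvPolynomial.pderiv j P)) ?_ ?_ ?_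
    -- The added 1 makes `|t| ≥ R` strictly exceed the bound on the norms of points of the element.
    (R := (M.elem_polyhedral i).isCompact.isBounded.exists_norm_le.choose + 1) ?_ ?_ ?_
  · rw [Finset.sum_filter] at hmain
    convert hmain using 1
    · congr 1
      ext t
      change (M.elem i).indicator _ (ℓ t) = (M.elem i).indicator _ (ℓ t) * _
      by_cases h : ℓ t ∈ M.elem i
      · rw [Set.indicator_of_mem h, Set.indicator_of_mem h, one_mul]
      · rw [Set.indicator_of_notMem h, Set.indicator_of_notMem h, zero_mul]
    · exact Finset.sum_congr rfl fun e _ => by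
        rw [Set.indicator_apply]
  · intro t ht
    have hnf : ℓ t ∉ frontier (M.elem i) := by
      rw [M.elem_frontier i]
      simp only [Set.mem_iUnion, not_exists]
      intro e he hte
      exact ht e (hmem e he t hte).1 (hmem e he t hte).2
    by_cases hti : ℓ t ∈ interior (M.elem i)
    · filter_upwards [hℓc.continuousAt.eventually (isOpen_interior.mem_nhds hti)] with s hs
      simp only [hc]
      rw [Set.indicator_of_mem (interior_subset hs), Set.indicator_of_mem (interior_subset hti)]
    · have htc : ℓ t ∈ (M.elem i)ᶜ := fun h => hnf ⟨subset_closure h, hti⟩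
      filter_upwards [hℓc.continuousAt.eventually
        ((M.isClosed_elem i).isOpen_compl.mem_nhds htc)] with s hs
      simp only [hc]
      rw [Set.indicator_of_notMem hs, Set.indicator_of_notMem htc]
  · intro e he
    obtain ⟨hx, hnj⟩ := hcar e he
    have he1 := (Finset.mem_filter.1 he).1
    have hxr := hreg e _ hx
    obtain ⟨r, hr, -, hb⟩ := hxr.exists_ball (M.normal_isUnitNormal he1) univ_mem
    obtain ⟨hin, hout⟩ := hxr.exists_halfBall he1 hr fun y hy hyf => (hb y hy i hyf).2
    have hball : ∀ᶠ s in 𝓝 (τ e), ℓ s ∈ Metric.ball (ℓ (τ e)) r :=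
      hℓc.continuousAt.eventually (Metric.ball_mem_nhds _ hr)
    have hc1 : ∀ s, ℓ s ∈ Metric.ball (ℓ (τ e)) r → (s - τ e) * M.normal i e j < 0 → c s = 1 :=
      fun s hs h => Set.indicator_of_mem (interior_subset
        (hin _ hs (by rwa [insertNth_sub_dotProduct]))) _
    have hc0 : ∀ s, ℓ s ∈ Metric.ball (ℓ (τ e)) r → 0 < (s - τ e) * M.normal i e j → c s = 0 :=
      fun s hs h => Set.indicator_of_notMem (hout _ hs (by rwa [insertNth_sub_dotProduct])) _
    rcases lt_or_gt_of_ne hnj with hneg | hpos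
    · refine ⟨1, ?_, ?_⟩
      · filter_upwards [hball.filter_mono nhdsWithin_le_nhds, self_mem_nhdsWithin] with s hs hs'
        rw [hc0 s hs (mul_pos_of_neg_of_neg (sub_neg.2 hs') hneg)]
        simp only [hσ]
        rw [abs_of_neg hneg, div_neg, div_self hnj]
        norm_num
      · filter_upwards [hball.filter_mono nhdsWithin_le_nhds, self_mem_nhdsWithin] with s hs hs'
        exact hc1 s hs (mul_neg_of_pos_of_neg (sub_pos.2 hs') hneg)
    · refine ⟨0, ?_, ?_⟩
      · filter_upwards [hball.filter_mono nhdsWithin_le_nhds, self_mem_nhdsWithin] with s hs hs'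
        rw [hc1 s hs (mul_neg_of_neg_of_pos (sub_neg.2 hs') hpos)]
        simp only [hσ]
        rw [abs_of_pos hpos, div_self hnj, zero_add]
      · filter_upwards [hball.filter_mono nhdsWithin_le_nhds, self_mem_nhdsWithin] with s hs hs'
        exact hc0 s hs (mul_pos (sub_pos.2 hs') hpos)
  · intro e he e' he' h
    exact (hreg e _ (hcar e he).1).2 e' (h ▸ (hcar e' he').1)
  · intro t ht
    refine Set.indicator_of_notMem (fun hti => ?_) _
    have h1 := (M.elem_polyhedral i).isCompact.isBounded.exists_norm_le.choose_spec _ hti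
    have h2 : |t| ≤ ‖ℓ t‖ := by
      have := norm_le_pi_norm (ℓ t) j
      simpa [hℓ] using this
    linarith
  · intro t
    refine (hasDerivAt_eval_curve P (x := ℓ) (x' := Pi.single j 1) (t := t)
      fun l => ?_).congr_deriv ?_
    · rcases Fin.eq_self_or_eq_succAbove j l with rfl | ⟨b, rfl⟩
      · simpa [hℓ] using hasDerivAt_id' t
      · simpa [hℓ, Pi.single_apply, Fin.succAbove_ne] using hasDerivAt_const t (z b)
    · simp [Pi.single_apply]
  · exact (MvPolynomial.continuous_eval _).comp hℓc

/-- The projection of a face along the `j`-th axis transforms surface integrals by `|n_j|`. -/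
theorem setIntegral_shadow (M : Mesh Ω ι κ) {i : ι} (j : Fin 3) {e : κ} (he : e ∈ M.faces i)
    (f : (Fin 3 → ℝ) → ℝ) :
    ∫ z in M.shadow j e, (M.normal i e j / |M.normal i e j|) * f
        (j.insertNth (α := fun _ => ℝ) ((M.face e).height (M.normal i e) j z) z) =
      ∫ y in (M.face e).dom, f ((M.face e).chart y) * M.normal i e j := by
  -- For `n_j = 0` the factor `n_j / |n_j|` is `0 / 0 = 0`, and both sides vanish.
  by_cases hnj : M.normal i e j = 0
  · simp [hnj]
  have hn := M.normal_isUnitNormal he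
  have hdet : ((M.face e).projMatrix j).det ≠ 0 := by
    rwa [← abs_ne_zero, hn.abs_det_projMatrix, abs_ne_zero]
  set A : (Fin 2 → ℝ) →L[ℝ] (Fin 2 → ℝ) :=
    LinearMap.toContinuousLinearMap (Matrix.toLin' ((M.face e).projMatrix j)) with hA
  have hAdet : A.det = ((M.face e).projMatrix j).det := by
    rw [hA, LinearMap.det_toContinuousLinearMap, LinearMap.det_toLin']
  have hinj : Function.Injective fun y => j.removeNth ((M.face e).chart y) := by
    intro y y' h
    simp only [Face.removeNth_chart, add_right_inj, Matrix.toLin'_apply] at h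
    exact Matrix.mulVec_injective_of_isUnit
      ((Matrix.isUnit_iff_isUnit_det _).2 (isUnit_iff_ne_zero.2 hdet)) h
  rw [shadow, integral_image_eq_integral_abs_det_fderiv_smul volume
    (M.face e).polygonal.isCompact.measurableSet (f' := fun _ => A) ?_ hinj.injOn]
  · refine integral_congr_ae (Filter.Eventually.of_forall fun y => ?_)
    simp only
    rw [hAdet, hn.abs_det_projMatrix, hn.insertNth_height hnj, smul_eq_mul, ← mul_assoc,
      mul_div_cancel₀ _ (abs_ne_zero.2 hnj), mul_comm]
  · intro y _
    have : (fun y => j.removeNth ((M.face e).chart y)) =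
        fun y => j.removeNth (M.face e).origin + A y :=
      funext fun y => (M.face e).removeNth_chart j y
    rw [this]
    exact (A.hasFDerivAt.const_add _).hasFDerivWithinAt

/-- The divergence theorem on an element, for a polynomial field along the `j`-th axis. -/
theorem integral_pderiv [Finite κ] (M : Mesh Ω ι κ) (i : ι) (j : Fin 3)
    (P : MvPolynomial (Fin 3) ℝ) :
    ∫ x in M.elem i, MvPolynomial.eval x (MvPolynomial.pderiv j P) =
      ∑ e ∈ M.faces i, ∫ y in (M.face e).dom,
        MvPolynomial.eval ((M.face e).chart y) P * M.normal i e j := by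
  have hcpt := (M.elem_polyhedral i).isCompact
  have hint : Integrable ((M.elem i).indicator fun x =>
      MvPolynomial.eval x (MvPolynomial.pderiv j P)) := by
    rw [integrable_indicator_iff hcpt.measurableSet]
    exact (MvPolynomial.continuous_eval _).continuousOn.integrableOn_compact hcpt
  have hmp := (volume_preserving_piFinSuccAbove (fun _ : Fin 3 => ℝ) j).symm
  -- Fubini: the `j`-th coordinate is integrated first, along lines that are good for almost every
  -- `z`.
  rw [← integral_indicator hcpt.measurableSet, ← hmp.integral_comp']
  have hint' := (hmp.integrable_comp_emb (MeasurableEquiv.measurableEmbedding _)).2 hint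
  rw [Measure.volume_eq_prod] at hint' ⊢
  refine (integral_prod_symm _ hint').trans ?_
  have hae : ∀ᵐ z : Fin 2 → ℝ, z ∉ M.badLines j :=
    measure_eq_zero_iff_ae_notMem.1 (M.volume_badLines j)
  have hline : ∀ᵐ z : Fin 2 → ℝ, ∫ t : ℝ, (M.elem i).indicator
      (fun x => MvPolynomial.eval x (MvPolynomial.pderiv j P))
        ((MeasurableEquiv.piFinSuccAbove (fun _ => ℝ) j).symm (t, z)) =
      ∑ e ∈ M.faces i, (M.shadow j e).indicator (fun z =>
        (M.normal i e j / |M.normal i e j|) * MvPolynomial.eval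
          (j.insertNth (α := fun _ => ℝ) ((M.face e).height (M.normal i e) j z) z) P) z := by
    filter_upwards [hae] with z hz
    exact M.integral_line i j hz P
  refine (integral_congr_ae hline).trans ?_
  rw [integral_finsetSum]
  · refine Finset.sum_congr rfl fun e he => ?_
    rw [integral_indicator (M.isCompact_shadow j e).measurableSet]
    exact M.setIntegral_shadow j he fun x => MvPolynomial.eval x P
  · intro e _
    rw [integrable_indicator_iff (M.isCompact_shadow j e).measurableSet]
    refine Continuous.continuousOn ?_ |>.integrableOn_compact (M.isCompact_shadow j e)
    exact continuous_const.mul ((MvPolynomial.continuous_eval _).comp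
      (Continuous.finInsertNth (A := fun _ => ℝ) j ((M.face e).continuous_height _ j)
        continuous_id))

theorem continuous_eval_chart (F : Face) (P : MvPolynomial (Fin 3) ℝ) :
    Continuous fun y => MvPolynomial.eval (F.chart y) P :=
  (MvPolynomial.continuous_eval P).comp (continuous_chart F)

/-- The divergence theorem on an element. -/
theorem integral_divergence [Finite κ] (M : Mesh Ω ι κ) (i : ι)
    (Q : Fin 3 → MvPolynomial (Fin 3) ℝ) :
    ∫ x in M.elem i, MvPolynomial.eval x (∑ j, MvPolynomial.pderiv j (Q j)) =
      M.bdryIntegral i fun e y =>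
        (fun j => MvPolynomial.eval ((M.face e).chart y) (Q j)) ⬝ᵥ M.normal i e := by
  simp only [map_sum, dotProduct, bdryIntegral]
  rw [integral_finsetSum]
  · simp only [M.integral_pderiv]
    rw [Finset.sum_comm]
    refine Finset.sum_congr rfl fun e _ => (integral_finsetSum _ fun j _ => ?_).symm
    exact ((continuous_eval_chart _ _).mul continuous_const).continuousOn.integrableOn_compact
      (M.face e).polygonal.isCompact
  · exact fun j _ => (MvPolynomial.continuous_eval _).continuousOn.integrableOn_compact
      (M.elem_polyhedral i).isCompact

/-! ### Cancellation of fluxes and existence of transversal boundary faces. -/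

/-- At most two elements share a face. -/
theorem eq_or_eq_of_mem_faces [Finite κ] (M : Mesh Ω ι κ) {e : κ} {i l m : ι}
    (hi : e ∈ M.faces i) (hl : e ∈ M.faces l) (hil : i ≠ l) (hm : e ∈ M.faces m) :
    m = i ∨ m = l := by
  by_contra! h
  -- Three elements at one face would have pairwise opposite normals, so `n = -n`.
  have h2 := M.normal_eq_neg hl hm h.2.symm
  rw [M.normal_eq_neg hi hm h.1.symm, M.normal_eq_neg hi hl hil, neg_neg] at h2
  exact (M.normal_isUnitNormal hi).ne_zero (self_eq_neg.1 h2.symm)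

/-- Contributions of the two sides of the interior faces cancel. -/
theorem sum_faces_eq_zero [Finite κ] (hΩ : interior (closure Ω) = Ω) (M : Mesh Ω ι κ)
    (I : Finset ι) (H : ι → κ → ℝ)
    (hI : ∀ e, ¬ M.IsBoundary e → ∀ i l, e ∈ M.faces i → e ∈ M.faces l → i ∈ I → l ∈ I)
    (hbd : ∀ e, M.IsBoundary e → ∀ i ∈ I, e ∈ M.faces i → H i e = 0)
    (hint : ∀ e, ¬ M.IsBoundary e → ∀ i ∈ I, ∀ l ∈ I, i ≠ l → e ∈ M.faces i → e ∈ M.faces l →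
      H i e + H l e = 0) :
    ∑ i ∈ I, ∑ e ∈ M.faces i, H i e = 0 := by
  classical
  have := Fintype.ofFinite κ
  rw [Finset.sum_comm' (s' := fun e => I.filter fun i => e ∈ M.faces i) (t' := Finset.univ)
    (by intro i e; simp)]
  refine Finset.sum_eq_zero fun e _ => ?_
  by_cases he : M.IsBoundary e
  · exact Finset.sum_eq_zero fun i hi =>
      hbd e he i (Finset.mem_filter.1 hi).1 (Finset.mem_filter.1 hi).2
  rcases (I.filter fun i => e ∈ M.faces i).eq_empty_or_nonempty with h | ⟨i, hi⟩
  · rw [h, Finset.sum_empty]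
  obtain ⟨hiI, hie⟩ := Finset.mem_filter.1 hi
  obtain ⟨l, hli, hle⟩ := M.exists_neighbour hΩ hie he
  have hlI := hI e he i l hie hle hiI
  have hset : I.filter (fun i => e ∈ M.faces i) = {i, l} := by
    ext m
    simp only [Finset.mem_filter, Finset.mem_insert, Finset.mem_singleton]
    constructor
    · rintro ⟨-, hme⟩
      exact M.eq_or_eq_of_mem_faces hie hle hli.symm hme
    · rintro (rfl | rfl)
      · exact ⟨hiI, hie⟩
      · exact ⟨hlI, hle⟩
  rw [hset, Finset.sum_pair hli.symm]
  exact hint e he i hiI l hlI hli.symm hie hle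

theorem measureReal_elem_pos (M : Mesh Ω ι κ) (i : ι) : 0 < volume.real (M.elem i) := by
  have h1 : 0 < volume (M.elem i) :=
    (isOpen_interior.measure_pos _ (M.elem_polyhedral i).nonempty_interior).trans_le
      (measure_mono interior_subset)
  exact ENNReal.toReal_pos h1.ne' (M.elem_polyhedral i).isCompact.measure_lt_top.ne

/-- A union of elements that is closed under passing through interior faces has boundary faces
transversal to any given direction. -/
theorem exists_boundary_face [Finite κ] (hΩ : interior (closure Ω) = Ω) (M : Mesh Ω ι κ)
    (I : Finset ι) (hIn : I.Nonempty)
    (hI : ∀ e, ¬ M.IsBoundary e → ∀ i l, e ∈ M.faces i → e ∈ M.faces l → i ∈ I → l ∈ I)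
    {d : Fin 3 → ℝ} (hd : d ≠ 0) :
    ∃ i ∈ I, ∃ e ∈ M.faces i, M.IsBoundary e ∧ d ⬝ᵥ M.normal i e ≠ 0 := by
  by_contra! hcon
  -- The field `(d·x) d` has constant divergence `|d|²` and flux density `(d·x)(d·n)`. If `d·n`
  -- vanished on all boundary faces of the union, its total volume would be zero.
  set Q : Fin 3 → MvPolynomial (Fin 3) ℝ := fun j =>
    MvPolynomial.C (d j) * ∑ l, MvPolynomial.C (d l) * MvPolynomial.X l with hQ
  have hdiv : ∑ j, MvPolynomial.pderiv j (Q j) = MvPolynomial.C (d ⬝ᵥ d) := by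
    simp [hQ, Fin.sum_univ_three, MvPolynomial.pderiv_X, dotProduct,
      Pi.single_apply]
  have hval : ∀ (i : ι) (e : κ) (y : Fin 2 → ℝ),
      (fun j => MvPolynomial.eval ((M.face e).chart y) (Q j)) ⬝ᵥ M.normal i e =
        (d ⬝ᵥ (M.face e).chart y) * (d ⬝ᵥ M.normal i e) := by
    intro i e y
    simp only [hQ, dotProduct, Fin.sum_univ_three, map_mul, map_add, MvPolynomial.eval_C,
      MvPolynomial.eval_X]
    ring
  have hsum : ∑ i ∈ I, ∫ x in M.elem i,
      MvPolynomial.eval x (∑ j, MvPolynomial.pderiv j (Q j)) = 0 := by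
    simp only [M.integral_divergence, hval, bdryIntegral]
    refine M.sum_faces_eq_zero hΩ I _ hI (fun e he i hi hie => ?_)
      fun e he i hi l hl hil hie hle => ?_
    · rw [hcon i hi e hie he]
      simp
    · rw [M.normal_eq_neg hie hle hil]
      simp only [dotProduct_neg, mul_neg, integral_neg]
      ring
  simp only [hdiv, MvPolynomial.eval_C, setIntegral_const, smul_eq_mul] at hsum
  have hdd : 0 < d ⬝ᵥ d := lt_of_le_of_ne (Finset.sum_nonneg fun j _ => mul_self_nonneg _)
    fun h => hd (dotProduct_self_eq_zero.1 h.symm)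
  exact (Finset.sum_pos (fun i _ => mul_pos (M.measureReal_elem_pos i) hdd) hIn).ne' hsum

end Mesh

/-! ### Vanishing of piecewise polynomial harmonic fields. -/

/-- The tangential derivatives of a polynomial vanishing on a face are zero there. -/
theorem Face.sum_pderiv_mul_tangent {F : Face} {P : MvPolynomial (Fin 3) ℝ}
    (h : ∀ y ∈ interior F.dom, MvPolynomial.eval (F.chart y) P = 0) {y : Fin 2 → ℝ}
    (hy : y ∈ interior F.dom) (a : Fin 2) :
    ∑ l, MvPolynomial.eval (F.chart y) (MvPolynomial.pderiv l P) * F.tangent a l = 0 := by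
  have hx : ∀ s : ℝ, F.chart (y + s • Pi.single a 1) = F.chart y + s • F.tangent a := by
    intro s
    fin_cases a <;> simp [Face.chart, add_smul, add_assoc, add_comm, add_left_comm]
  have h1 := hasDerivAt_eval_curve P (x := fun s => F.chart y + s • F.tangent a)
    (x' := F.tangent a) (t := 0) fun l => by
      simpa using ((hasDerivAt_id' (0 : ℝ)).mul_const (F.tangent a l)).const_add (F.chart y l)
  have h2 : (fun s : ℝ => MvPolynomial.eval (F.chart y + s • F.tangent a) P) =ᶠ[nhds 0]
      fun _ => 0 := by
    have hc : Continuous fun s : ℝ => y + s • (Pi.single a 1 : Fin 2 → ℝ) := by fun_prop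
    have : ∀ᶠ s : ℝ in nhds 0, y + s • (Pi.single a 1 : Fin 2 → ℝ) ∈ interior F.dom := by
      refine hc.continuousAt.eventually (isOpen_interior.mem_nhds ?_)
      simpa using hy
    filter_upwards [this] with s hs
    rw [← hx s]
    exact h _ hs
  have h3 := h1.unique ((hasDerivAt_const (0 : ℝ) (0 : ℝ)).congr_of_eventuallyEq h2)
  simpa using h3

/-- A symmetric trace-free matrix that annihilates the tangent vectors of a face vanishes. -/
theorem Face.IsUnitNormal.eq_zero_of_symm_traceless {F : Face} {n : Fin 3 → ℝ}
    (hn : F.IsUnitNormal n) {J : Fin 3 → Fin 3 → ℝ} (hsymm : ∀ a b, J a b = J b a)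
    (htr : ∑ a, J a a = 0) (ht : ∀ a b, ∑ l, J l b * F.tangent a l = 0) (a b : Fin 3) :
    J a b = 0 := by
  -- `J` kills the tangents, so `J = n ⊗ N`. Symmetry makes `N` parallel to `n`, and the vanishing
  -- trace says `N·n = 0`.
  have hN : ∀ a b, J a b = (∑ m, J m b * n m) * n a := by
    intro a b
    have := hn.resolve (fun m => J m b) a
    simp only [dotProduct, ht, zero_mul, zero_add] at this
    exact this
  set N : Fin 3 → ℝ := fun b => ∑ m, J m b * n m with hNdef
  have hsN : ∀ a b, N b * n a = N a * n b := fun a b => by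
    rw [← hN a b, ← hN b a, hsymm]
  have htrN : ∑ b, N b * n b = 0 := by
    rw [← htr]
    exact Finset.sum_congr rfl fun b _ => (hN b b).symm
  have hN0 : N b = 0 := by
    calc N b = N b * (n ⬝ᵥ n) := by rw [hn.1, mul_one]
      _ = ∑ l, N l * n l * n b := by
        rw [dotProduct, Finset.mul_sum]
        exact Finset.sum_congr rfl fun l _ => by rw [← mul_assoc, hsN l b]; ring
      _ = 0 := by rw [← Finset.sum_mul, htrN, zero_mul]
  rw [hN a b]
  change N b * n a = 0
  rw [hN0, zero_mul]

namespace Mesh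

variable {Ω : Set (Fin 3 → ℝ)} {ι κ : Type*}

/-- Polynomials whose sum of squares integrates to zero over an element vanish. -/
theorem eq_zero_of_integral_sum_sq (M : Mesh Ω ι κ) {i : ι} {α : Type*} [Fintype α]
    (P : α → MvPolynomial (Fin 3) ℝ)
    (h : ∫ x in M.elem i, ∑ a, MvPolynomial.eval x (P a) * MvPolynomial.eval x (P a) = 0) (a : α) :
    P a = 0 := by
  refine eval_eq_zero_of_interior (M.elem_polyhedral i).nonempty_interior fun x hx => ?_
  have h1 := eq_zero_of_setIntegral_eq_zero (M.elem_polyhedral i)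
    (continuous_finsetSum _ fun a _ => (MvPolynomial.continuous_eval (P a)).mul
      (MvPolynomial.continuous_eval (P a)))
    (fun x => Finset.sum_nonneg fun a _ => mul_self_nonneg _) h x hx
  exact mul_self_eq_zero.1
    ((Finset.sum_eq_zero_iff_of_nonneg fun a _ => mul_self_nonneg _).1 h1 a (Finset.mem_univ a))

/-- Piecewise constants that are continuous across interior faces and vanish on the boundary
vanish. -/
theorem eq_zero_of_pderiv_eq_zero [Fintype ι] [Finite κ] (hΩ : interior (closure Ω) = Ω)
    (M : Mesh Ω ι κ) (p : ι → MvPolynomial (Fin 3) ℝ)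
    (hgrad : ∀ i j, MvPolynomial.pderiv j (p i) = 0)
    (hbd : ∀ i, ∀ e ∈ M.faces i, M.IsBoundary e → ∀ y ∈ interior (M.face e).dom,
      MvPolynomial.eval ((M.face e).chart y) (p i) = 0)
    (hcont : ∀ e i l, e ∈ M.faces i → e ∈ M.faces l → ∀ y ∈ interior (M.face e).dom,
      MvPolynomial.eval ((M.face e).chart y) (p i) = MvPolynomial.eval ((M.face e).chart y) (p l))
    (i : ι) : p i = 0 := by
  classical
  have hconst : ∀ i, p i = MvPolynomial.C (MvPolynomial.coeff 0 (p i)) := fun i =>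
    eq_C_of_pderiv_eq_zero (hgrad i)
  -- The elements carrying the same constant as `i` form a set closed under passing through faces.
  -- Only the existence of a boundary face matters, so the direction is arbitrary.
  obtain ⟨l, hl, e, he, heb, -⟩ := M.exists_boundary_face hΩ
    (Finset.univ.filter fun l => p l = p i) ⟨i, by simp⟩ (fun e _ m l hm hl hmi => by
      simp only [Finset.mem_filter, Finset.mem_univ, true_and] at hmi ⊢
      rw [← hmi, hconst l, hconst m]
      obtain ⟨y, hy⟩ := (M.face e).polygonal.nonempty_interior
      have := hcont e m l hm hl y hy
      rw [hconst l, hconst m, MvPolynomial.eval_C, MvPolynomial.eval_C] at this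
      rw [this]) (d := fun _ => 1) (fun h => one_ne_zero (congrFun h 0))
  rw [← (Finset.mem_filter.1 hl).2]
  obtain ⟨y, hy⟩ := (M.face e).polygonal.nonempty_interior
  have := hbd l e he heb y hy
  rw [hconst l, MvPolynomial.eval_C] at this
  rw [hconst l, this, map_zero]

/-- The product rule gives `∂_b u_a ∂_a u_b + u_a ∂_a (∇·u)`, summed over `a, b`. The second part
vanishes, and symmetry of `∇u` turns the first into `|∇u|²`. -/
theorem divergence_convective {u : Fin 3 → MvPolynomial (Fin 3) ℝ}
    (hcurl : ∀ a b, MvPolynomial.pderiv a (u b) = MvPolynomial.pderiv b (u a))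
    (hdiv : ∑ a, MvPolynomial.pderiv a (u a) = 0) :
    ∑ b, MvPolynomial.pderiv b (∑ a, u a * MvPolynomial.pderiv a (u b)) =
      ∑ q : Fin 3 × Fin 3,
        MvPolynomial.pderiv q.1 (u q.2) * MvPolynomial.pderiv q.1 (u q.2) := by
  have h1 : ∀ a, ∑ b, MvPolynomial.pderiv b (MvPolynomial.pderiv a (u b)) = 0 := fun a => by
    have := congrArg (MvPolynomial.pderiv a) hdiv
    rw [map_sum, map_zero] at this
    rw [← this]
    exact Finset.sum_congr rfl fun b _ => pderiv_comm b a _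
  simp only [map_sum, MvPolynomial.pderiv_mul, Finset.sum_add_distrib]
  rw [Finset.sum_comm (f := fun b a => u a * _)]
  simp only [← Finset.mul_sum, h1, mul_zero, Finset.sum_const_zero, add_zero]
  rw [Fintype.sum_prod_type]
  exact Finset.sum_congr rfl fun a _ => Finset.sum_congr rfl fun b _ => by rw [hcurl b a]

/-- A piecewise polynomial field that is curl- and divergence-free in the elements, continuous
across interior faces, and normal to the boundary faces is piecewise constant. -/
theorem pderiv_eq_zero_of_harmonic [Fintype ι] [Finite κ] (hΩ : interior (closure Ω) = Ω)
    (M : Mesh Ω ι κ) (u : ι → Fin 3 → MvPolynomial (Fin 3) ℝ)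
    (hcurl : ∀ i a b, MvPolynomial.pderiv a (u i b) = MvPolynomial.pderiv b (u i a))
    (hdiv : ∀ i, ∑ a, MvPolynomial.pderiv a (u i a) = 0)
    (hbd : ∀ i, ∀ e ∈ M.faces i, M.IsBoundary e → ∀ y ∈ interior (M.face e).dom, ∀ a,
      (fun b => MvPolynomial.eval ((M.face e).chart y) (u i b)) ⬝ᵥ (M.face e).tangent a = 0)
    (hcont : ∀ e, ¬ M.IsBoundary e → ∀ i l, i ≠ l → e ∈ M.faces i → e ∈ M.faces l →
      ∀ y ∈ interior (M.face e).dom, ∀ b, MvPolynomial.eval ((M.face e).chart y) (u i b) =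
        MvPolynomial.eval ((M.face e).chart y) (u l b))
    (i : ι) (a b : Fin 3) : MvPolynomial.pderiv a (u i b) = 0 := by
  have hsum : ∑ i, ∫ x in M.elem i, MvPolynomial.eval x
      (∑ b, MvPolynomial.pderiv b (∑ a, u i a * MvPolynomial.pderiv a (u i b))) = 0 := by
    simp only [M.integral_divergence, bdryIntegral]
    refine M.sum_faces_eq_zero hΩ _ _ (fun _ _ _ _ _ _ _ => Finset.mem_univ _)
      (fun e he i _ hie => ?_) fun e he i _ l _ hil hie hle => ?_
    · rw [← (M.face e).polygonal.setIntegral_interior]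
      refine setIntegral_eq_zero_of_forall_eq_zero fun y hy => ?_
      have hn := M.normal_isUnitNormal hie
      set n := M.normal i e
      set x := (M.face e).chart y
      have ht := hbd i e hie he y hy
      -- On a boundary face `u = φ n` with `φ = u·n`.
      have hu : ∀ a, MvPolynomial.eval x (u i a) =
          ((fun b => MvPolynomial.eval x (u i b)) ⬝ᵥ n) * n a := by
        intro a
        have := hn.resolve (fun b => MvPolynomial.eval x (u i b)) a
        rwa [ht 0, ht 1, zero_mul, zero_mul, zero_add, zero_add] at this
      -- The tangents are constant on the flat face, so differentiating `u·t_a = 0` along `t_a`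
      -- gives `t_a·(∇u)t_a = 0`.
      have hJ : ∀ a, ∑ l, (∑ b, MvPolynomial.eval x (MvPolynomial.pderiv l (u i b)) *
          (M.face e).tangent a b) * (M.face e).tangent a l = 0 := by
        intro a
        have := Face.sum_pderiv_mul_tangent (F := M.face e)
          (P := ∑ b, u i b * MvPolynomial.C ((M.face e).tangent a b))
          (fun y hy => by simpa [dotProduct] using hbd i e hie he y hy a) hy a
        simpa [MvPolynomial.pderiv_mul, mul_comm] using this
      have htr : ∑ a, MvPolynomial.eval x (MvPolynomial.pderiv a (u i a)) = 0 := by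
        rw [← map_sum, hdiv i, map_zero]
      set φ := (fun b => MvPolynomial.eval x (u i b)) ⬝ᵥ n
      simp only [dotProduct, map_sum, map_mul]
      simp only [hu]
      have hJ0 := hJ 0
      have hJ1 := hJ 1
      have hf := hn.frame
      set J : Fin 3 → Fin 3 → ℝ := fun a b =>
        MvPolynomial.eval x (MvPolynomial.pderiv a (u i b)) with hJdef
      -- `n·(∇u)n` is the trace minus the two tangential diagonal entries.
      have key : ∑ a, ∑ b, J a b * (n a * n b) = 0 := by
        have e1 : ∀ a b, n a * n b = (if a = b then 1 else 0) -
            (M.face e).tangent 0 a * (M.face e).tangent 0 b -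
            (M.face e).tangent 1 a * (M.face e).tangent 1 b := fun a b => by
          rw [← hf a b]; ring
        have e2 : ∑ a, ∑ b, J a b * (if a = b then 1 else 0) = 0 := by
          simpa using htr
        simp only [e1, mul_sub, Finset.sum_sub_distrib]
        rw [e2]
        have e3 : ∀ t : Fin 3 → ℝ, (∑ a, ∑ b, J a b * (t a * t b)) =
            ∑ l, (∑ b, J l b * t b) * t l := fun t => by
          refine Finset.sum_congr rfl fun a _ => ?_
          rw [Finset.sum_mul]
          exact Finset.sum_congr rfl fun b _ => by ring
        rw [e3, e3, hJ0, hJ1]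
        ring
      calc _ = φ * ∑ a, ∑ b, J a b * (n a * n b) := by
            simp only [hJdef, Fin.sum_univ_three]
            ring
        _ = 0 := by rw [key, mul_zero]
    · rw [← (M.face e).polygonal.setIntegral_interior, ← (M.face e).polygonal.setIntegral_interior,
        ← sub_neg_eq_add, sub_eq_zero, ← integral_neg]
      refine setIntegral_congr_fun isOpen_interior.measurableSet fun y hy => ?_
      have hn := M.normal_isUnitNormal hie
      -- The jump of `∇u` is symmetric and trace-free, and continuity of `u` along the face makes it
      -- kill the tangents. So the whole gradient is continuous, and the fluxes cancel.
      have hJ : ∀ a b, MvPolynomial.eval ((M.face e).chart y) (MvPolynomial.pderiv a (u i b)) =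
          MvPolynomial.eval ((M.face e).chart y) (MvPolynomial.pderiv a (u l b)) := by
        intro a b
        rw [← sub_eq_zero]
        refine hn.eq_zero_of_symm_traceless (J := fun a b =>
          MvPolynomial.eval ((M.face e).chart y) (MvPolynomial.pderiv a (u i b)) -
          MvPolynomial.eval ((M.face e).chart y) (MvPolynomial.pderiv a (u l b))) ?_ ?_ ?_ a b
        · intro a b
          simp only [hcurl i a b, hcurl l a b]
        · rw [Finset.sum_sub_distrib, ← map_sum, ← map_sum, hdiv, hdiv, sub_self]
        · intro a b
          have := Face.sum_pderiv_mul_tangent (F := M.face e) (P := u i b - u l b)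
            (fun y hy => by rw [map_sub, hcont e he i l hil hie hle y hy b, sub_self]) hy a
          simpa using this
      simp only [dotProduct, map_sum, map_mul, hJ, hcont e he i l hil hie hle y hy,
        M.normal_eq_neg hie hle hil, Pi.neg_apply, mul_neg, Finset.sum_neg_distrib, neg_neg]
  have hnn : ∀ i, 0 ≤ ∫ x in M.elem i, ∑ q : Fin 3 × Fin 3,
      MvPolynomial.eval x (MvPolynomial.pderiv q.1 (u i q.2)) *
        MvPolynomial.eval x (MvPolynomial.pderiv q.1 (u i q.2)) := fun i =>
    integral_nonneg fun x => Finset.sum_nonneg fun _ _ => mul_self_nonneg _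
  simp only [divergence_convective (hcurl _) (hdiv _)] at hsum
  simp only [map_sum, map_mul] at hsum
  exact M.eq_zero_of_integral_sum_sq (fun q : Fin 3 × Fin 3 => MvPolynomial.pderiv q.1 (u i q.2))
    ((Finset.sum_eq_zero_iff_of_nonneg fun i _ => hnn i).1 hsum i (Finset.mem_univ i)) (a, b)

theorem exists_ne_zero_dotProduct_eq_zero (c : Fin 3 → ℝ) :
    ∃ d : Fin 3 → ℝ, d ≠ 0 ∧ c ⬝ᵥ d = 0 := by
  by_cases h : c 0 = 0
  · exact ⟨![1, 0, 0], fun h' => one_ne_zero (congrFun h' 0),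
      by simp [dotProduct, Fin.sum_univ_three, h]⟩
  · refine ⟨![-c 1, c 0, 0], fun h' => h (congrFun h' 1), ?_⟩
    simp [dotProduct, Fin.sum_univ_three]
    ring

/-- A piecewise polynomial field that is curl- and divergence-free in the elements, continuous
across interior faces, and normal to the boundary faces vanishes. -/
theorem eq_zero_of_harmonic [Fintype ι] [Finite κ] (hΩ : interior (closure Ω) = Ω)
    (M : Mesh Ω ι κ) (u : ι → Fin 3 → MvPolynomial (Fin 3) ℝ)
    (hcurl : ∀ i a b, MvPolynomial.pderiv a (u i b) = MvPolynomial.pderiv b (u i a))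
    (hdiv : ∀ i, ∑ a, MvPolynomial.pderiv a (u i a) = 0)
    (hbd : ∀ i, ∀ e ∈ M.faces i, M.IsBoundary e → ∀ y ∈ interior (M.face e).dom, ∀ a,
      (fun b => MvPolynomial.eval ((M.face e).chart y) (u i b)) ⬝ᵥ (M.face e).tangent a = 0)
    (hcont : ∀ e, ¬ M.IsBoundary e → ∀ i l, i ≠ l → e ∈ M.faces i → e ∈ M.faces l →
      ∀ y ∈ interior (M.face e).dom, ∀ b, MvPolynomial.eval ((M.face e).chart y) (u i b) =
        MvPolynomial.eval ((M.face e).chart y) (u l b))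
    (i : ι) : u i = 0 := by
  classical
  have hgrad := M.pderiv_eq_zero_of_harmonic hΩ u hcurl hdiv hbd hcont
  have hconst : ∀ i b, u i b = MvPolynomial.C (MvPolynomial.coeff 0 (u i b)) := fun i b =>
    eq_C_of_pderiv_eq_zero fun j => hgrad i j b
  set c : Fin 3 → ℝ := fun b => MvPolynomial.coeff 0 (u i b) with hc
  -- With `d ⊥ c` and a boundary face where `d·n ≠ 0`: there `c = (c·n) n`, so `0 = c·d =
  -- (c·n)(n·d)` forces `c = 0`.
  obtain ⟨d, hd, hcd⟩ := exists_ne_zero_dotProduct_eq_zero c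
  obtain ⟨l, hl, e, he, heb, hdn⟩ := M.exists_boundary_face hΩ
    (Finset.univ.filter fun l => u l = u i) ⟨i, by simp⟩ (fun e heb m l hm hl hmi => by
      simp only [Finset.mem_filter, Finset.mem_univ, true_and] at hmi ⊢
      rcases eq_or_ne m l with rfl | hml
      · exact hmi
      rw [← hmi]
      ext1 b
      rw [hconst l b, hconst m b]
      obtain ⟨y, hy⟩ := (M.face e).polygonal.nonempty_interior
      have := hcont e heb m l hml hm hl y hy b
      rw [hconst l b, hconst m b, MvPolynomial.eval_C, MvPolynomial.eval_C] at this
      rw [this]) hd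
  have hli := (Finset.mem_filter.1 hl).2
  obtain ⟨y, hy⟩ := (M.face e).polygonal.nonempty_interior
  have ht : ∀ a, c ⬝ᵥ (M.face e).tangent a = 0 := fun a => by
    have h1 := hbd l e he heb y hy a
    have h2 : (fun b => MvPolynomial.eval ((M.face e).chart y) (u l b)) = c := by
      ext b
      rw [hli, hconst i b, MvPolynomial.eval_C]
    rwa [h2] at h1
  have hn := M.normal_isUnitNormal he
  have hcn : c = (c ⬝ᵥ M.normal l e) • M.normal l e := by
    ext b
    have := hn.resolve c b
    rwa [ht 0, ht 1, zero_mul, zero_mul, zero_add, zero_add] at this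
  have h0 : c ⬝ᵥ M.normal l e = 0 := by
    rw [hcn, smul_dotProduct, smul_eq_mul, mul_eq_zero] at hcd
    exact hcd.resolve_right (by rwa [dotProduct_comm])
  rw [h0, zero_smul] at hcn
  ext1 b
  rw [hconst i b, show MvPolynomial.coeff 0 (u i b) = 0 from congrFun hcn b, map_zero]
  rfl

end Mesh

/-! ### Linearity of the weak operators, the forms and the load. -/

namespace Mesh

variable {Ω : Set (Fin 3 → ℝ)} {ι κ : Type*} {k : ℕ}

theorem weakGrad_spec (M : Mesh Ω ι κ) (w : WPair ι κ k) (i : ι) :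
    M.IsWeakGrad k w i (M.weakGrad w i) :=
  Classical.epsilon_spec (M.existsUnique_isWeakGrad w i).exists

theorem weakCurl_spec (M : Mesh Ω ι κ) (v : VSpace ι κ k) (i : ι) :
    M.IsWeakCurl k v i (M.weakCurl v i) :=
  Classical.epsilon_spec (M.existsUnique_isWeakCurl v i).exists

theorem bVal_add (M : Mesh Ω ι κ) (v w : VSpace ι κ k) (e : κ) (y : Fin 2 → ℝ) :
    M.bVal (v + w) e y = M.bVal v e y + M.bVal w e y := by
  simp only [bVal, Prod.snd_add, Pi.add_apply, Poly.val_add, add_smul]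
  abel

theorem bVal_smul (M : Mesh Ω ι κ) (c : ℝ) (v : VSpace ι κ k) (e : κ) (y : Fin 2 → ℝ) :
    M.bVal (c • v) e y = c • M.bVal v e y := by
  simp only [bVal, Prod.smul_snd, Pi.smul_apply, Poly.val_smul, mul_smul, smul_add]

theorem cross_add_left (v w n : Fin 3 → ℝ) : (v + w) ⨯₃ n = v ⨯₃ n + w ⨯₃ n := by
  rw [map_add, LinearMap.add_apply]

theorem cross_smul_left (c : ℝ) (v n : Fin 3 → ℝ) : (c • v) ⨯₃ n = c • (v ⨯₃ n) := by
  rw [map_smul, LinearMap.smul_apply]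

theorem integral_add_elem (M : Mesh Ω ι κ) (i : ι) {F G : (Fin 3 → ℝ) → ℝ} (hF : Continuous F)
    (hG : Continuous G) :
    ∫ x in M.elem i, (F x + G x) = (∫ x in M.elem i, F x) + ∫ x in M.elem i, G x :=
  integral_add (hF.continuousOn.integrableOn_compact (M.elem_polyhedral i).isCompact)
    (hG.continuousOn.integrableOn_compact (M.elem_polyhedral i).isCompact)

theorem weakCurl_add (M : Mesh Ω ι κ) (v w : VSpace ι κ k) (i : ι) :
    M.weakCurl (v + w) i = M.weakCurl v i + M.weakCurl w i := by
  refine (M.existsUnique_isWeakCurl (v + w) i).unique (M.weakCurl_spec _ i) fun q => ?_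
  have hc : ∀ (v : VSpace ι κ k) (e : κ), Continuous fun y =>
      (M.bVal v e y ⨯₃ M.normal i e) ⬝ᵥ Poly.vec q ((M.face e).chart y) := fun v e =>
    continuous_dot (continuous_cross (M.continuous_bVal v e) _)
      ((Poly.continuous_vec q).comp (continuous_chart _))
  simp only [Poly.vec_add, add_dotProduct, Prod.fst_add, Pi.add_apply, bVal_add, cross_add_left]
  rw [M.integral_add_elem i (continuous_dot (Poly.continuous_vec _) (Poly.continuous_vec _))
      (continuous_dot (Poly.continuous_vec _) (Poly.continuous_vec _)),
    M.integral_add_elem i (continuous_dot (Poly.continuous_vec _) (Poly.continuous_curl _))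
      (continuous_dot (Poly.continuous_vec _) (Poly.continuous_curl _)),
    M.bdryIntegral_add i (hc v) (hc w), M.weakCurl_spec v i q, M.weakCurl_spec w i q]
  ring

theorem weakCurl_smul (M : Mesh Ω ι κ) (c : ℝ) (v : VSpace ι κ k) (i : ι) :
    M.weakCurl (c • v) i = c • M.weakCurl v i := by
  refine (M.existsUnique_isWeakCurl (c • v) i).unique (M.weakCurl_spec _ i) fun q => ?_
  simp only [Poly.vec_smul, smul_dotProduct, Prod.smul_fst, Pi.smul_apply, bVal_smul,
    cross_smul_left, smul_eq_mul, integral_const_mul, bdryIntegral_mul]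
  rw [M.weakCurl_spec v i q]
  ring

/-- The tangential jump `(v₀ - v_b) × n` on a face of the element `i`. -/
def jump (M : Mesh Ω ι κ) (v : VSpace ι κ k) (i : ι) (e : κ) (y : Fin 2 → ℝ) : Fin 3 → ℝ :=
  (Poly.vec (v.1 i) ((M.face e).chart y) - M.bVal v e y) ⨯₃ M.normal i e

theorem jump_add (M : Mesh Ω ι κ) (v w : VSpace ι κ k) (i : ι) (e : κ) (y : Fin 2 → ℝ) :
    M.jump (v + w) i e y = M.jump v i e y + M.jump w i e y := by
  simp only [jump, Prod.fst_add, Pi.add_apply, Poly.vec_add, bVal_add, add_sub_add_comm,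
    cross_add_left]

theorem jump_smul (M : Mesh Ω ι κ) (c : ℝ) (v : VSpace ι κ k) (i : ι) (e : κ) (y : Fin 2 → ℝ) :
    M.jump (c • v) i e y = c • M.jump v i e y := by
  simp only [jump, Prod.smul_fst, Pi.smul_apply, Poly.vec_smul, bVal_smul, ← smul_sub,
    cross_smul_left]

theorem continuous_jump (M : Mesh Ω ι κ) (v : VSpace ι κ k) (i : ι) (e : κ) :
    Continuous (M.jump v i e) :=
  continuous_cross (((Poly.continuous_vec _).comp (continuous_chart _)).sub
    (M.continuous_bVal v e)) _

/-- The jump `p₀ - p_b` on a face of the element `i`. -/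
def sjump (M : Mesh Ω ι κ) (p : WPair ι κ k) (i : ι) (e : κ) (y : Fin 2 → ℝ) : ℝ :=
  (p.1 i).val ((M.face e).chart y) - (p.2 e).val y

theorem sjump_add (M : Mesh Ω ι κ) (p q : WPair ι κ k) (i : ι) (e : κ) (y : Fin 2 → ℝ) :
    M.sjump (p + q) i e y = M.sjump p i e y + M.sjump q i e y := by
  simp only [sjump, Prod.fst_add, Prod.snd_add, Pi.add_apply, Poly.val_add]
  ring

theorem sjump_smul (M : Mesh Ω ι κ) (c : ℝ) (p : WPair ι κ k) (i : ι) (e : κ) (y : Fin 2 → ℝ) :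
    M.sjump (c • p) i e y = c * M.sjump p i e y := by
  simp only [sjump, Prod.smul_fst, Prod.smul_snd, Pi.smul_apply, Poly.val_smul]
  ring

theorem continuous_sjump (M : Mesh Ω ι κ) (p : WPair ι κ k) (i : ι) (e : κ) :
    Continuous (M.sjump p i e) :=
  ((Poly.continuous_val _).comp (continuous_chart _)).sub (Poly.continuous_val _)

theorem interior_elem_subset (hΩ : interior (closure Ω) = Ω) (M : Mesh Ω ι κ) (i : ι) :
    interior (M.elem i) ⊆ Ω :=
  (interior_mono (M.elem_subset i)).trans hΩ.le

/-- Elements are only contained in the closure of `Ω`, but their interiors lie in `Ω` and their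
frontiers are null. This carries integrability and a.e. statements from `Ω` to the elements. -/
theorem restrict_elem_le (hΩ : interior (closure Ω) = Ω) (M : Mesh Ω ι κ) (i : ι) :
    volume.restrict (M.elem i) ≤ volume.restrict Ω := by
  rw [← Measure.restrict_congr_set (M.elem_polyhedral i).ae_eq_interior]
  exact Measure.restrict_mono (M.interior_elem_subset hΩ i) le_rfl

theorem integrableOn_mul_continuous (M : Mesh Ω ι κ)
    {g : (Fin 3 → ℝ) → ℝ} {i : ι} (hg : IntegrableOn g (M.elem i)) {F : (Fin 3 → ℝ) → ℝ}
    (hF : Continuous F) : IntegrableOn (fun x => g x * F x) (M.elem i) :=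
  hg.mul_continuousOn hF.continuousOn (M.elem_polyhedral i).isCompact

theorem integrableOn_of_memLp {E : Type*} [NormedAddCommGroup E] (hΩ : interior (closure Ω) = Ω)
    (M : Mesh Ω ι κ) {f : (Fin 3 → ℝ) → E} (hf : MemLp f 2 (volume.restrict Ω)) (i : ι) :
    IntegrableOn f (M.elem i) := by
  have : IsFiniteMeasure (volume.restrict (M.elem i)) :=
    ⟨by simpa using (M.elem_polyhedral i).isCompact.measure_lt_top⟩
  exact (hf.mono_measure (M.restrict_elem_le hΩ i)).integrable (by norm_num)

variable [Fintype ι]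

/-- Since `v₀` has degree `k`, it is itself an admissible test field in the definition of `∇_w q`.
In this form linearity in `q` and the effect of special choices of `q` are visible. -/
theorem b_eq (M : Mesh Ω ι κ) (v : VSpace ι κ k) (q : WPair ι κ k) :
    M.b v q = ∑ i, (-(∫ x in M.elem i, (q.1 i).val x * Poly.div (v.1 i) x) +
      M.bdryIntegral i fun e y =>
        (q.2 e).val y * (Poly.vec (v.1 i) ((M.face e).chart y) ⬝ᵥ M.normal i e)) := by
  refine Finset.sum_congr rfl fun i _ => ?_
  rw [← M.weakGrad_spec q i (v.1 i)]
  simp only [dotProduct_comm]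

theorem a_comm (M : Mesh Ω ι κ) (ν : (Fin 3 → ℝ) → ℝ) (v w : VSpace ι κ k) :
    M.a ν v w = M.a ν w v := by
  simp only [a, s₁]
  congr 1
  · simp only [dotProduct_comm (Poly.vec (M.weakCurl v _) _)]
  · refine Finset.sum_congr rfl fun i _ => congrArg _ (congrArg _ ?_)
    ext e y
    exact dotProduct_comm _ _

theorem a_eq (M : Mesh Ω ι κ) (ν : (Fin 3 → ℝ) → ℝ) (v w : VSpace ι κ k) :
    M.a ν v w = (∑ i, ∫ x in M.elem i,
      ν x * (Poly.vec (M.weakCurl v i) x ⬝ᵥ Poly.vec (M.weakCurl w i) x)) +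
      ∑ i, M.size⁻¹ * M.bdryIntegral i fun e y => M.jump v i e y ⬝ᵥ M.jump w i e y := rfl

theorem s₂_eq (M : Mesh Ω ι κ) (p q : WPair ι κ k) :
    M.s₂ p q = ∑ i, M.size * M.bdryIntegral i fun e y => M.sjump p i e y * M.sjump q i e y := rfl

theorem s₂_comm (M : Mesh Ω ι κ) (p q : WPair ι κ k) : M.s₂ p q = M.s₂ q p := by
  simp only [s₂_eq, mul_comm (M.sjump p _ _ _)]

theorem a_add_left (hΩ : interior (closure Ω) = Ω) (M : Mesh Ω ι κ) {ν : (Fin 3 → ℝ) → ℝ}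
    (hν : IntegrableOn ν Ω) (u v w : VSpace ι κ k) :
    M.a ν (u + v) w = M.a ν u w + M.a ν v w := by
  have hint : ∀ (v : VSpace ι κ k) i, IntegrableOn (fun x =>
      ν x * (Poly.vec (M.weakCurl v i) x ⬝ᵥ Poly.vec (M.weakCurl w i) x)) (M.elem i) :=
    fun v i => M.integrableOn_mul_continuous
      (Integrable.mono_measure hν (M.restrict_elem_le hΩ i))
      (continuous_dot (Poly.continuous_vec _) (Poly.continuous_vec _))
  have hc : ∀ (v : VSpace ι κ k) i e, Continuous fun y => M.jump v i e y ⬝ᵥ M.jump w i e y :=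
    fun v i e => continuous_dot (M.continuous_jump v i e) (M.continuous_jump w i e)
  simp only [a_eq, weakCurl_add, jump_add, Poly.vec_add, add_dotProduct, mul_add,
    fun i => M.bdryIntegral_add i (hc u i) (hc v i), Finset.sum_add_distrib,
    fun i => integral_add (hint u i) (hint v i)]
  ring

theorem a_smul_left (M : Mesh Ω ι κ) (ν : (Fin 3 → ℝ) → ℝ) (c : ℝ) (v w : VSpace ι κ k) :
    M.a ν (c • v) w = c * M.a ν v w := by
  simp only [a_eq, weakCurl_smul, jump_smul, Poly.vec_smul, smul_dotProduct, smul_eq_mul,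
    mul_left_comm _ c, bdryIntegral_mul, integral_const_mul, ← Finset.mul_sum, mul_add]

theorem s₂_add_left (M : Mesh Ω ι κ) (p q r : WPair ι κ k) :
    M.s₂ (p + q) r = M.s₂ p r + M.s₂ q r := by
  have hc : ∀ (p : WPair ι κ k) i e, Continuous fun y => M.sjump p i e y * M.sjump r i e y :=
    fun p i e => (M.continuous_sjump p i e).mul (M.continuous_sjump r i e)
  simp only [s₂_eq, sjump_add, add_mul, fun i => M.bdryIntegral_add i (hc p i) (hc q i), mul_add,
    Finset.sum_add_distrib]

theorem s₂_smul_left (M : Mesh Ω ι κ) (c : ℝ) (p q : WPair ι κ k) :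
    M.s₂ (c • p) q = c * M.s₂ p q := by
  simp only [s₂_eq, sjump_smul, mul_assoc, bdryIntegral_mul, mul_left_comm _ c, ← Finset.mul_sum]

theorem b_add_left (M : Mesh Ω ι κ) (u v : VSpace ι κ k) (q : WPair ι κ k) :
    M.b (u + v) q = M.b u q + M.b v q := by
  simp only [b, Prod.fst_add, Pi.add_apply, Poly.vec_add, add_dotProduct]
  rw [← Finset.sum_add_distrib]
  exact Finset.sum_congr rfl fun i _ => M.integral_add_elem i
    (continuous_dot (Poly.continuous_vec _) (Poly.continuous_vec _))
    (continuous_dot (Poly.continuous_vec _) (Poly.continuous_vec _))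

theorem b_smul_left (M : Mesh Ω ι κ) (c : ℝ) (v : VSpace ι κ k) (q : WPair ι κ k) :
    M.b (c • v) q = c * M.b v q := by
  simp only [b, Prod.smul_fst, Pi.smul_apply, Poly.vec_smul, smul_dotProduct, smul_eq_mul,
    integral_const_mul, Finset.mul_sum]

theorem b_add_right (M : Mesh Ω ι κ) (v : VSpace ι κ k) (p q : WPair ι κ k) :
    M.b v (p + q) = M.b v p + M.b v q := by
  have hc : ∀ (p : WPair ι κ k) i e, Continuous fun y =>
      (p.2 e).val y * (Poly.vec (v.1 i) ((M.face e).chart y) ⬝ᵥ M.normal i e) := fun p i e =>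
    (Poly.continuous_val _).mul
      (continuous_dot ((Poly.continuous_vec _).comp (continuous_chart _)) continuous_const)
  have hc' : ∀ (p : WPair ι κ k) i, Continuous fun x => (p.1 i).val x * Poly.div (v.1 i) x :=
    fun p i => (Poly.continuous_val _).mul (Poly.continuous_div _)
  simp only [b_eq, Prod.fst_add, Prod.snd_add, Pi.add_apply, Poly.val_add, add_mul,
    fun i => M.integral_add_elem i (hc' p i) (hc' q i),
    fun i => M.bdryIntegral_add i (hc p i) (hc q i), Finset.sum_add_distrib,
    Finset.sum_neg_distrib]
  ring

theorem b_smul_right (M : Mesh Ω ι κ) (c : ℝ) (v : VSpace ι κ k) (q : WPair ι κ k) :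
    M.b v (c • q) = c * M.b v q := by
  simp only [b_eq, Prod.smul_fst, Prod.smul_snd, Pi.smul_apply, Poly.val_smul, mul_assoc,
    integral_const_mul, bdryIntegral_mul, ← mul_neg, ← mul_add, ← Finset.mul_sum]

/-- The bilinear form of the coupled system. -/
def systemForm (hΩ : interior (closure Ω) = Ω) (M : Mesh Ω ι κ) (k : ℕ) {ν : (Fin 3 → ℝ) → ℝ}
    (hν : IntegrableOn ν Ω) :
    (VSpace ι κ k × WPair ι κ k) →ₗ[ℝ] (VSpace ι κ k × WPair ι κ k) →ₗ[ℝ] ℝ :=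
  -- The two equations are added; with these signs the `b` terms cancel on the diagonal.
  LinearMap.mk₂ ℝ (fun x y => M.a ν x.1 y.1 - M.b y.1 x.2 + (M.b x.1 y.2 + M.s₂ x.2 y.2))
    (fun x x' y => by
      simp only [Prod.fst_add, Prod.snd_add, M.a_add_left hΩ hν, b_add_left, b_add_right,
        s₂_add_left]
      ring)
    (fun c x y => by
      simp only [Prod.smul_fst, Prod.smul_snd, a_smul_left, b_smul_left, b_smul_right,
        s₂_smul_left, smul_eq_mul]
      ring)
    (fun x y y' => by
      simp only [Prod.fst_add, Prod.snd_add, M.a_comm ν x.1, M.s₂_comm x.2, M.a_add_left hΩ hν,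
        b_add_left, b_add_right, s₂_add_left]
      ring)
    (fun c x y => by
      simp only [Prod.smul_fst, Prod.smul_snd, M.a_comm ν x.1, M.s₂_comm x.2, a_smul_left,
        b_smul_left, b_smul_right, s₂_smul_left, smul_eq_mul]
      ring)

/-- The right-hand side of the coupled system. -/
def systemLoad (hΩ : interior (closure Ω) = Ω) (M : Mesh Ω ι κ) (k : ℕ)
    {f : (Fin 3 → ℝ) → Fin 3 → ℝ} (hf : MemLp f 2 (volume.restrict Ω))
    {g : (Fin 3 → ℝ) → ℝ} (hg : MemLp g 2 (volume.restrict Ω)) :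
    (VSpace ι κ k × WPair ι κ k) →ₗ[ℝ] ℝ where
  toFun y := (∑ i, ∫ x in M.elem i, f x ⬝ᵥ Poly.vec (y.1.1 i) x) -
    ∑ i, ∫ x in M.elem i, g x * (y.2.1 i).val x
  map_add' y y' := by
    have h1 : ∀ (p : Fin 3 → Poly 3 k) i,
        IntegrableOn (fun x => f x ⬝ᵥ Poly.vec p x) (M.elem i) := fun p i =>
      integrable_finsetSum _ fun j _ => M.integrableOn_mul_continuous
        ((M.integrableOn_of_memLp hΩ hf i).eval j) (Poly.continuous_val (p j))
    have h2 : ∀ (p : Poly 3 (k - 1)) i, IntegrableOn (fun x => g x * p.val x) (M.elem i) :=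
      fun p i => M.integrableOn_mul_continuous (M.integrableOn_of_memLp hΩ hg i)
        (Poly.continuous_val p)
    simp only [Prod.fst_add, Prod.snd_add, Pi.add_apply, Poly.vec_add, Poly.val_add,
      dotProduct_add, mul_add, fun i => integral_add (h1 (y.1.1 i) i) (h1 (y'.1.1 i) i),
      fun i => integral_add (h2 (y.2.1 i) i) (h2 (y'.2.1 i) i), Finset.sum_add_distrib]
    ring
  map_smul' c y := by
    simp only [Prod.smul_fst, Prod.smul_snd, Pi.smul_apply, Poly.vec_smul, Poly.val_smul,
      dotProduct_smul, smul_eq_mul, mul_left_comm _ c, integral_const_mul, ← Finset.mul_sum,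
      RingHom.id_apply, mul_sub]

end Mesh

/-! ### Triviality of the homogeneous problem. -/

namespace Mesh

variable {Ω : Set (Fin 3 → ℝ)} {ι κ : Type*} {k : ℕ}

theorem bdryIntegral_congr (M : Mesh Ω ι κ) {i : ι} {F G : κ → (Fin 2 → ℝ) → ℝ}
    (h : ∀ e ∈ M.faces i, ∀ y ∈ interior (M.face e).dom, F e y = G e y) :
    M.bdryIntegral i F = M.bdryIntegral i G :=
  Finset.sum_congr rfl fun e he => (M.face e).polygonal.setIntegral_congr (h e he)

theorem bdryIntegral_eq_zero (M : Mesh Ω ι κ) {i : ι} {F : κ → (Fin 2 → ℝ) → ℝ}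
    (h : ∀ e ∈ M.faces i, ∀ y ∈ interior (M.face e).dom, F e y = 0) :
    M.bdryIntegral i F = 0 := by
  rw [M.bdryIntegral_congr h]
  simp [bdryIntegral]

theorem bdryIntegral_nonneg (M : Mesh Ω ι κ) {i : ι} {F : κ → (Fin 2 → ℝ) → ℝ}
    (h : ∀ e y, 0 ≤ F e y) : 0 ≤ M.bdryIntegral i F :=
  Finset.sum_nonneg fun e _ => integral_nonneg (h e)

theorem eq_zero_of_bdryIntegral_eq_zero (M : Mesh Ω ι κ) {i : ι} {F : κ → (Fin 2 → ℝ) → ℝ}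
    (hc : ∀ e, Continuous (F e)) (hnn : ∀ e y, 0 ≤ F e y) (h : M.bdryIntegral i F = 0) :
    ∀ e ∈ M.faces i, ∀ y ∈ interior (M.face e).dom, F e y = 0 := by
  intro e he
  have := (Finset.sum_eq_zero_iff_of_nonneg fun e _ => integral_nonneg (hnn e)).1 h e he
  exact eq_zero_of_setIntegral_eq_zero (M.face e).polygonal (hc e) (hnn e) this

/-- A function with vanishing weak gradient and no jumps is constant. -/
theorem pderiv_eq_zero_of_isWeakGrad_zero [Finite κ] (M : Mesh Ω ι κ) {w : WPair ι κ k} {i : ι}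
    (hG : M.IsWeakGrad k w i 0)
    (hj : ∀ e ∈ M.faces i, ∀ y ∈ interior (M.face e).dom, M.sjump w i e y = 0) (j : Fin 3) :
    MvPolynomial.pderiv j (w.1 i : MvPolynomial (Fin 3) ℝ) = 0 := by
  set P : MvPolynomial (Fin 3) ℝ := (w.1 i : MvPolynomial (Fin 3) ℝ) with hP
  -- The test field is `∇p₀`. Replacing `p_b` by `p₀` on the faces and applying the divergence
  -- theorem to `p₀ ∇p₀` leaves `∫ |∇p₀|² = 0`.
  set q : Fin 3 → Poly 3 k := fun j => ⟨MvPolynomial.pderiv j P,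
    (MvPolynomial.mem_restrictTotalDegree _ _ _).2 ((totalDegree_pderiv_le j
      ((MvPolynomial.mem_restrictTotalDegree _ _ _).1 (w.1 i).2)).trans (by omega))⟩ with hq
  have h1 := hG q
  have h2 := M.integral_divergence i fun j => P * (q j : MvPolynomial (Fin 3) ℝ)
  have h3 : (M.bdryIntegral i fun e y =>
      (w.2 e).val y * (Poly.vec q ((M.face e).chart y) ⬝ᵥ M.normal i e)) =
      M.bdryIntegral i fun e y => (fun j => MvPolynomial.eval ((M.face e).chart y)
        (P * (q j : MvPolynomial (Fin 3) ℝ))) ⬝ᵥ M.normal i e := by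
    refine M.bdryIntegral_congr fun e he y hy => ?_
    rw [← sub_eq_zero.1 (hj e he y hy), dotProduct, dotProduct, Finset.mul_sum]
    refine Finset.sum_congr rfl fun j _ => ?_
    rw [map_mul, ← mul_assoc]
    rfl
  have h4 : ∀ x, MvPolynomial.eval x
      (∑ j, MvPolynomial.pderiv j (P * (q j : MvPolynomial (Fin 3) ℝ))) =
      (∑ j, MvPolynomial.eval x (MvPolynomial.pderiv j P) *
        MvPolynomial.eval x (MvPolynomial.pderiv j P)) + (w.1 i).val x * Poly.div q x := by
    intro x
    simp only [map_sum, MvPolynomial.pderiv_mul, map_add, map_mul, Finset.sum_add_distrib,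
      Poly.div, Finset.mul_sum]
    rfl
  rw [h3, ← h2] at h1
  simp only [h4] at h1
  have h6 := M.integral_add_elem i (F := fun x => ∑ j,
      MvPolynomial.eval x (MvPolynomial.pderiv j P) * MvPolynomial.eval x (MvPolynomial.pderiv j P))
    (G := fun x => (w.1 i).val x * Poly.div q x) (continuous_finsetSum _ fun j _ =>
      (MvPolynomial.continuous_eval _).mul (MvPolynomial.continuous_eval _))
    ((Poly.continuous_val _).mul (Poly.continuous_div q))
  rw [h6] at h1
  have h5 : ∀ x, Poly.vec (0 : Fin 3 → Poly 3 k) x = 0 := fun x => by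
    ext j
    exact Poly.val_zero x
  simp only [h5, zero_dotProduct, integral_zero] at h1
  exact M.eq_zero_of_integral_sum_sq (fun j => MvPolynomial.pderiv j P) (by linarith) j

/-- A field with vanishing weak curl and no tangential jumps is curl-free. -/
theorem pderiv_comm_of_isWeakCurl_zero [Finite κ] (M : Mesh Ω ι κ) {v : VSpace ι κ k} {i : ι}
    (hC : M.IsWeakCurl k v i 0)
    (hj : ∀ e ∈ M.faces i, ∀ y ∈ interior (M.face e).dom, M.jump v i e y = 0) (a b : Fin 3) :
    MvPolynomial.pderiv a (v.1 i b : MvPolynomial (Fin 3) ℝ) =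
      MvPolynomial.pderiv b (v.1 i a : MvPolynomial (Fin 3) ℝ) := by
  set u : Fin 3 → MvPolynomial (Fin 3) ℝ := fun b => (v.1 i b : MvPolynomial (Fin 3) ℝ) with hu
  -- The test field is `r = ∇×u₀`, whose degree `k - 1` is exactly what the weak curl admits.
  set q : Fin 3 → Poly 3 (k - 1) := ![Poly.pderiv 1 (v.1 i 2) - Poly.pderiv 2 (v.1 i 1),
    Poly.pderiv 2 (v.1 i 0) - Poly.pderiv 0 (v.1 i 2),
    Poly.pderiv 0 (v.1 i 1) - Poly.pderiv 1 (v.1 i 0)] with hq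
  set r : Fin 3 → MvPolynomial (Fin 3) ℝ := fun b => (q b : MvPolynomial (Fin 3) ℝ) with hr
  have hr0 : r 0 = MvPolynomial.pderiv 1 (u 2) - MvPolynomial.pderiv 2 (u 1) := rfl
  have hr1 : r 1 = MvPolynomial.pderiv 2 (u 0) - MvPolynomial.pderiv 0 (u 2) := rfl
  have hr2 : r 2 = MvPolynomial.pderiv 0 (u 1) - MvPolynomial.pderiv 1 (u 0) := rfl
  have h1 := hC q
  -- The field is `u₀ × r`, and `∇·(u₀ × r) + u₀·∇×r = r·∇×u₀ = |r|²`.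
  have h2 := M.integral_divergence i
    ![u 1 * r 2 - u 2 * r 1, u 2 * r 0 - u 0 * r 2, u 0 * r 1 - u 1 * r 0]
  have h3 : (M.bdryIntegral i fun e y =>
      (M.bVal v e y ⨯₃ M.normal i e) ⬝ᵥ Poly.vec q ((M.face e).chart y)) =
      M.bdryIntegral i fun e y => (-1) * ((fun j => MvPolynomial.eval ((M.face e).chart y)
        (![u 1 * r 2 - u 2 * r 1, u 2 * r 0 - u 0 * r 2, u 0 * r 1 - u 1 * r 0] j)) ⬝ᵥ
          M.normal i e) := by
    refine M.bdryIntegral_congr fun e he y hy => ?_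
    have h := hj e he y hy
    rw [jump, map_sub, LinearMap.sub_apply, sub_eq_zero] at h
    rw [← h]
    have e1 : ∀ b, Poly.vec (v.1 i) ((M.face e).chart y) b =
      MvPolynomial.eval ((M.face e).chart y) (u b) := fun b => rfl
    have e2 : ∀ b, Poly.vec q ((M.face e).chart y) b =
      MvPolynomial.eval ((M.face e).chart y) (r b) := fun b => rfl
    simp only [dotProduct, Fin.sum_univ_three, cross_apply, e1, e2, Matrix.cons_val]
    simp only [map_sub, map_mul]
    ring
  have h4 : ∀ x, MvPolynomial.eval x (∑ j, MvPolynomial.pderiv j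
      (![u 1 * r 2 - u 2 * r 1, u 2 * r 0 - u 0 * r 2, u 0 * r 1 - u 1 * r 0] j)) +
      Poly.vec (v.1 i) x ⬝ᵥ Poly.curl q x =
      ∑ j, MvPolynomial.eval x (r j) * MvPolynomial.eval x (r j) := by
    intro x
    have e1 : ∀ b, Poly.vec (v.1 i) x b = MvPolynomial.eval x (u b) := fun b => rfl
    have e2 : ∀ a b, Poly.partialVal a (q b) x =
        MvPolynomial.eval x (MvPolynomial.pderiv a (r b)) :=
      fun a b => rfl
    simp only [dotProduct, Fin.sum_univ_three, Poly.curl, e1, e2, Matrix.cons_val, map_add, map_sub,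
      MvPolynomial.pderiv_mul, map_mul]
    have f0 := congrArg (MvPolynomial.eval x) hr0
    have f1 := congrArg (MvPolynomial.eval x) hr1
    have f2 := congrArg (MvPolynomial.eval x) hr2
    rw [map_sub] at f0 f1 f2
    linear_combination (-MvPolynomial.eval x (r 0)) * f0 - MvPolynomial.eval x (r 1) * f1 -
      MvPolynomial.eval x (r 2) * f2
  have h5 : ∀ x, Poly.vec (0 : Fin 3 → Poly 3 (k - 1)) x = 0 := fun x => by
    ext j
    exact Poly.val_zero x
  rw [h3, M.bdryIntegral_mul, ← h2] at h1
  simp only [h5, zero_dotProduct, integral_zero] at h1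
  have h6 := M.eq_zero_of_integral_sum_sq r (i := i) (by
    rw [← setIntegral_congr_fun (M.elem_polyhedral i).isCompact.measurableSet fun x _ => h4 x,
      M.integral_add_elem i (MvPolynomial.continuous_eval _)
        (continuous_dot (Poly.continuous_vec _) (Poly.continuous_curl _))]
    linarith)
  have g0 := h6 0
  have g1 := h6 1
  have g2 := h6 2
  rw [hr0, sub_eq_zero] at g0
  rw [hr1, sub_eq_zero] at g1
  rw [hr2, sub_eq_zero] at g2
  change MvPolynomial.pderiv a (u b) = MvPolynomial.pderiv b (u a)
  fin_cases a <;> fin_cases b <;> first | rfl | assumption | (symm; assumption)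

theorem eq_smul_of_cross_eq_zero {c n : Fin 3 → ℝ} (hn : n ⬝ᵥ n = 1) (h : c ⨯₃ n = 0) :
    c = (c ⬝ᵥ n) • n := by
  have h0 := congrFun h 0
  have h1 := congrFun h 1
  have h2 := congrFun h 2
  simp only [cross_apply, Matrix.cons_val, Pi.zero_apply] at h0 h1 h2
  simp only [dotProduct, Fin.sum_univ_three] at hn
  ext j
  simp only [dotProduct, Fin.sum_univ_three, Pi.smul_apply, smul_eq_mul]
  fin_cases j <;> simp
  · linear_combination (-c 0) * hn + n 1 * h2 - n 2 * h1
  · linear_combination (-c 1) * hn - n 0 * h2 + n 2 * h0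
  · linear_combination (-c 2) * hn + n 0 * h1 - n 1 * h0

/-- Needed for definiteness of both stabilisers: for `h = 0` they would vanish, `h⁻¹` being 0 by
convention. An element has interior points, hence positive diameter. -/
theorem size_pos [Finite ι] (M : Mesh Ω ι κ) (i : ι) : 0 < M.size := by
  have hb : BddAbove (Set.range fun i => Metric.diam (WithLp.toLp 2 '' M.elem i)) :=
    (Set.finite_range _).bddAbove
  refine lt_of_lt_of_le ?_ (le_ciSup hb i)
  have hcpt : IsCompact (WithLp.toLp 2 '' M.elem i) :=
    (M.elem_polyhedral i).isCompact.image (PiLp.continuous_toLp 2 _)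
  refine Metric.diam_pos ?_ hcpt.isBounded
  have hnt : (M.elem i).Nontrivial := by
    obtain ⟨x, hx⟩ := (M.elem_polyhedral i).nonempty_interior
    exact (infinite_of_mem_nhds x (mem_interior_iff_mem_nhds.1 hx)).nontrivial
  exact hnt.image (WithLp.toLp_injective 2)

theorem bVal_zero_right (M : Mesh Ω ι κ) (w : ι → Fin 3 → Poly 3 k) (e : κ) (y : Fin 2 → ℝ) :
    M.bVal ((w, 0) : VSpace ι κ k) e y = 0 := by
  simp [bVal, Poly.val]

theorem bVal_dotProduct_tangent (M : Mesh Ω ι κ) (v : VSpace ι κ k) (e : κ) (y : Fin 2 → ℝ)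
    (a : Fin 2) : M.bVal v e y ⬝ᵥ (M.face e).tangent a = (v.2 e a).val y := by
  fin_cases a <;> simp [bVal, add_dotProduct, (M.face e).orthonormal]

theorem bVal_dotProduct_normal (M : Mesh Ω ι κ) (v : VSpace ι κ k) {i : ι} {e : κ}
    (he : e ∈ M.faces i) (y : Fin 2 → ℝ) : M.bVal v e y ⬝ᵥ M.normal i e = 0 := by
  have hn := M.normal_isUnitNormal he
  have h0 := hn.2 0
  have h1 := hn.2 1
  rw [dotProduct_comm] at h0 h1
  simp [bVal, add_dotProduct, h0, h1]

theorem curlEnergy_nonneg (hΩ : interior (closure Ω) = Ω) (M : Mesh Ω ι κ) {ν : (Fin 3 → ℝ) → ℝ}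
    (hνpos : ∀ᵐ x ∂volume.restrict Ω, 0 < ν x) (u : VSpace ι κ k) (i : ι) :
    0 ≤ ∫ x in M.elem i, ν x * (Poly.vec (M.weakCurl u i) x ⬝ᵥ Poly.vec (M.weakCurl u i) x) := by
  refine integral_nonneg_of_ae ?_
  filter_upwards [hνpos.filter_mono (ae_mono (M.restrict_elem_le hΩ i))] with x hx
  exact mul_nonneg hx.le (Finset.sum_nonneg fun j _ => mul_self_nonneg _)

/-- No lower bound on `ν` is needed: the nonnegative integrand vanishes a.e., and `ν > 0` a.e.
passes this on to the polynomial. -/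
theorem weakCurl_eq_zero_of_energy (hΩ : interior (closure Ω) = Ω) (M : Mesh Ω ι κ)
    {ν : (Fin 3 → ℝ) → ℝ} (hν : IntegrableOn ν Ω) (hνpos : ∀ᵐ x ∂volume.restrict Ω, 0 < ν x)
    {u : VSpace ι κ k} {i : ι} (h : ∫ x in M.elem i,
      ν x * (Poly.vec (M.weakCurl u i) x ⬝ᵥ Poly.vec (M.weakCurl u i) x) = 0) :
    M.weakCurl u i = 0 := by
  have hνi := hνpos.filter_mono (ae_mono (M.restrict_elem_le hΩ i))
  rw [integral_eq_zero_iff_of_nonneg_ae] at h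
  · refine Poly.eq_zero_of_integral (M.elem_polyhedral i) _ (integral_eq_zero_of_ae ?_)
    filter_upwards [h, hνi] with x hx hx'
    exact (mul_eq_zero.1 hx).resolve_left hx'.ne'
  · filter_upwards [hνi] with x hx
    exact mul_nonneg hx.le (Finset.sum_nonneg fun j _ => mul_self_nonneg _)
  · exact M.integrableOn_mul_continuous
      (Integrable.mono_measure hν (M.restrict_elem_le hΩ i))
      (continuous_dot (Poly.continuous_vec _) (Poly.continuous_vec _))

variable [Fintype ι]

/-- A solution of the homogeneous system has no weak curl and no jumps. -/
theorem energy_eq_zero (hΩ : interior (closure Ω) = Ω) (M : Mesh Ω ι κ)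
    {ν : (Fin 3 → ℝ) → ℝ} (hν : IntegrableOn ν Ω) (hνpos : ∀ᵐ x ∂volume.restrict Ω, 0 < ν x)
    {u : VSpace ι κ k} {p : WPair ι κ k} (h : M.a ν u u + M.s₂ p p = 0) (i : ι) :
    M.weakCurl u i = 0 ∧
    (∀ e ∈ M.faces i, ∀ y ∈ interior (M.face e).dom, M.jump u i e y = 0) ∧
    ∀ e ∈ M.faces i, ∀ y ∈ interior (M.face e).dom, M.sjump p i e y = 0 := by
  have hpos := M.size_pos i
  have hJ : ∀ i, 0 ≤ M.bdryIntegral i fun e y => M.jump u i e y ⬝ᵥ M.jump u i e y := fun i =>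
    M.bdryIntegral_nonneg fun e y => Finset.sum_nonneg fun j _ => mul_self_nonneg _
  have hS : ∀ i, 0 ≤ M.bdryIntegral i fun e y => M.sjump p i e y * M.sjump p i e y := fun i =>
    M.bdryIntegral_nonneg fun e y => mul_self_nonneg _
  have h1 := Finset.sum_nonneg fun i (_ : i ∈ Finset.univ) => M.curlEnergy_nonneg hΩ hνpos u i
  have h2 := Finset.sum_nonneg fun i (_ : i ∈ Finset.univ) =>
    mul_nonneg (inv_nonneg.2 hpos.le) (hJ i)
  have h3 := Finset.sum_nonneg fun i (_ : i ∈ Finset.univ) => mul_nonneg hpos.le (hS i)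
  rw [a_eq, s₂_eq] at h
  refine ⟨?_, ?_, ?_⟩
  · exact M.weakCurl_eq_zero_of_energy hΩ hν hνpos ((Finset.sum_eq_zero_iff_of_nonneg
      fun i _ => M.curlEnergy_nonneg hΩ hνpos u i).1 (by linarith) i (Finset.mem_univ i))
  · have h4 := (Finset.sum_eq_zero_iff_of_nonneg fun i (_ : i ∈ Finset.univ) =>
      mul_nonneg (inv_nonneg.2 hpos.le) (hJ i)).1 (by linarith) i (Finset.mem_univ i)
    intro e he y hy
    exact dotProduct_self_eq_zero.1 (M.eq_zero_of_bdryIntegral_eq_zero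
      (fun e => continuous_dot (M.continuous_jump u i e) (M.continuous_jump u i e))
      (fun e y => Finset.sum_nonneg fun j _ => mul_self_nonneg _)
      ((mul_eq_zero.1 h4).resolve_left (inv_ne_zero hpos.ne')) e he y hy)
  · have h4 := (Finset.sum_eq_zero_iff_of_nonneg fun i (_ : i ∈ Finset.univ) =>
      mul_nonneg hpos.le (hS i)).1 (by linarith) i (Finset.mem_univ i)
    intro e he y hy
    exact mul_self_eq_zero.1 (M.eq_zero_of_bdryIntegral_eq_zero
      (fun e => (M.continuous_sjump p i e).mul (M.continuous_sjump p i e))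
      (fun e y => mul_self_nonneg _)
      ((mul_eq_zero.1 h4).resolve_left hpos.ne') e he y hy)

/-- Fields that are orthogonal to all weak gradients are divergence-free in the elements. -/
theorem div_eq_zero_of_b_eq_zero (M : Mesh Ω ι κ) {u : VSpace ι κ k}
    (hb : ∀ q ∈ M.W k, M.b u q = 0) (i : ι) :
    ∑ a, MvPolynomial.pderiv a (u.1 i a : MvPolynomial (Fin 3) ℝ) = 0 := by
  set D : ι → Poly 3 (k - 1) := fun i => ∑ a, Poly.pderiv a (u.1 i a) with hD
  have hval : ∀ i x, Poly.div (u.1 i) x = (D i).val x := fun i x => by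
    simp only [hD, Poly.val_sum]
    rfl
  -- `∇·u₀` has degree `k - 1`, so it is admissible as `q₀`; with `q_b = 0` the identity becomes `∑
  -- ∫ (∇·u₀)² = 0`.
  have h := hb (D, 0) fun e _ y _ => Poly.val_zero y
  rw [b_eq] at h
  simp only [Pi.zero_apply, Poly.val_zero, zero_mul, hval] at h
  have h0 : ∀ i, M.bdryIntegral i (fun _ _ => (0 : ℝ)) = 0 := fun i => by simp [bdryIntegral]
  simp only [h0, add_zero, Finset.sum_neg_distrib, neg_eq_zero] at h
  have h1 := (Finset.sum_eq_zero_iff_of_nonneg fun i _ =>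
    integral_nonneg fun x => mul_self_nonneg _).1 h i (Finset.mem_univ i)
  have h2 : D i = 0 := Poly.eq_zero_of_val (M.elem_polyhedral i).nonempty_interior fun x hx =>
    mul_self_eq_zero.1 (eq_zero_of_setIntegral_eq_zero (M.elem_polyhedral i)
      ((Poly.continuous_val _).mul (Poly.continuous_val _)) (fun x => mul_self_nonneg _) h1 x hx)
  have h3 := congrArg (Subtype.val) h2
  simpa [hD, Poly.pderiv] using h3

/-- Fields that are orthogonal to all weak gradients have continuous normal components. -/
theorem sum_normal_eq_zero_of_b_eq_zero (M : Mesh Ω ι κ) {u : VSpace ι κ k}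
    [DecidableEq κ] (hb : ∀ q ∈ M.W k, M.b u q = 0) {e : κ} (he : ¬ M.IsBoundary e) :
    ∀ y ∈ interior (M.face e).dom, ∑ i with e ∈ M.faces i,
      Poly.vec (u.1 i) ((M.face e).chart y) ⬝ᵥ M.normal i e = 0 := by
  -- The sum of the outward normal components from the elements at `e` is a polynomial of degree `k`
  -- on `e`. As `e` is not a boundary face, `q₀ = 0`, `q_b = r` on `e` alone is admissible and
  -- yields `∫_e r² = 0`.
  set r : Poly 2 k := ∑ i with e ∈ M.faces i, ∑ j, M.normal i e j • (u.1 i j).onFace (M.face e)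
    with hr
  have hrval : ∀ y, r.val y = ∑ i with e ∈ M.faces i,
      Poly.vec (u.1 i) ((M.face e).chart y) ⬝ᵥ M.normal i e := by
    intro y
    simp only [hr, Poly.val_sum, Poly.val_smul, Poly.val_onFace, dotProduct, Poly.vec, mul_comm]
  have h := hb (0, Pi.single e r) fun e' he' y _ => by
    have hne : e' ≠ e := by
      rintro rfl
      exact he he'
    simp only [Pi.single_eq_of_ne hne, Poly.val_zero]
  rw [b_eq] at h
  simp only [Pi.zero_apply, Poly.val_zero, zero_mul, integral_zero, neg_zero, zero_add] at h
  have h1 : ∀ i, (M.bdryIntegral i fun e' y => (Pi.single (M := fun _ => Poly 2 k) e r e').val y *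
      (Poly.vec (u.1 i) ((M.face e').chart y) ⬝ᵥ M.normal i e')) =
      if e ∈ M.faces i then ∫ y in (M.face e).dom,
        r.val y * (Poly.vec (u.1 i) ((M.face e).chart y) ⬝ᵥ M.normal i e) else 0 := by
    intro i
    rw [bdryIntegral, ← Finset.sum_ite_eq' (M.faces i) e fun e' => ∫ y in (M.face e').dom,
        r.val y * (Poly.vec (u.1 i) ((M.face e').chart y) ⬝ᵥ M.normal i e')]
    refine Finset.sum_congr rfl fun e' _ => ?_
    split_ifs with h
    · subst h
      simp only [Pi.single_eq_same]
    · simp only [Pi.single_eq_of_ne h, Poly.val_zero, zero_mul, integral_zero]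
  simp only [h1] at h
  rw [← Finset.sum_filter, ← integral_finsetSum] at h
  · simp only [← Finset.mul_sum, ← hrval] at h
    intro y hy
    rw [← hrval]
    exact mul_self_eq_zero.1 (eq_zero_of_setIntegral_eq_zero (M.face e).polygonal
      ((Poly.continuous_val _).mul (Poly.continuous_val _)) (fun x => mul_self_nonneg _) h y hy)
  · intro i _
    exact ((Poly.continuous_val _).mul (continuous_dot ((Poly.continuous_vec _).comp
      (continuous_chart _)) continuous_const)).continuousOn.integrableOn_compact
        (M.face e).polygonal.isCompact

/-- The homogeneous system has only the trivial solution. -/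
theorem eq_zero_of_homogeneous [Finite κ] (hΩ : interior (closure Ω) = Ω) (M : Mesh Ω ι κ)
    {ν : (Fin 3 → ℝ) → ℝ} (hν : IntegrableOn ν Ω) (hνpos : ∀ᵐ x ∂volume.restrict Ω, 0 < ν x)
    {u : VSpace ι κ k} {p : WPair ι κ k} (hu : u ∈ M.V0 k) (hp : p ∈ M.W k)
    (h₁ : ∀ v ∈ M.V0 k, M.a ν u v - M.b v p = 0)
    (h₂ : ∀ q ∈ M.W k, M.b u q + M.s₂ p q = 0) : u = 0 ∧ p = 0 := by
  classical
  -- The choices `v = u` and `q = p`: in the sum of the two equations `b(u, p)` cancels.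
  have hE := M.energy_eq_zero hΩ hν hνpos (u := u) (p := p) (by linarith [h₁ u hu, h₂ p hp])
  have hvec0 : ∀ {m d r : ℕ} (x : Fin d → ℝ), Poly.vec (0 : Fin m → Poly d r) x = 0 := fun x => by
    ext j
    exact Poly.val_zero x
  have ha : ∀ v, M.a ν u v = 0 := fun v => by
    rw [a_eq]
    have : ∀ i, (M.bdryIntegral i fun e y => M.jump u i e y ⬝ᵥ M.jump v i e y) = 0 := fun i =>
      M.bdryIntegral_eq_zero fun e he y hy => by rw [(hE i).2.1 e he y hy, zero_dotProduct]
    simp [this, (hE _).1, hvec0]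
  have hs : ∀ q, M.s₂ p q = 0 := fun q => by
    rw [s₂_eq]
    refine Finset.sum_eq_zero fun i _ => mul_eq_zero_of_right _ ?_
    exact M.bdryIntegral_eq_zero fun e he y hy => by rw [(hE i).2.2 e he y hy, zero_mul]
  have hb : ∀ q ∈ M.W k, M.b u q = 0 := fun q hq => by
    have := h₂ q hq
    rwa [hs, add_zero] at this
  have hgrad : ∀ i, M.weakGrad p i = 0 := by
    -- The weak gradient has degree `k`, so it may serve as `v₀`; with `v_b = 0` this gives `∑ ∫
    -- |∇_w p|² = 0`.
    have h := h₁ ((fun i => M.weakGrad p i), 0) fun i e _ _ y _ => by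
      rw [bVal_zero_right, map_zero, LinearMap.zero_apply]
    rw [ha, zero_sub, neg_eq_zero, b] at h
    intro i
    exact Poly.eq_zero_of_integral (M.elem_polyhedral i) _
      ((Finset.sum_eq_zero_iff_of_nonneg fun i _ => integral_nonneg fun x =>
        Finset.sum_nonneg fun j _ => mul_self_nonneg _).1 h i (Finset.mem_univ i))
  have hpb : ∀ i, ∀ e ∈ M.faces i, ∀ y ∈ interior (M.face e).dom,
      (p.1 i).val ((M.face e).chart y) = (p.2 e).val y := fun i e he y hy =>
    sub_eq_zero.1 ((hE i).2.2 e he y hy)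
  have hp0 : ∀ i, p.1 i = 0 := by
    intro i
    refine Subtype.ext (M.eq_zero_of_pderiv_eq_zero hΩ
      (fun i => (p.1 i : MvPolynomial (Fin 3) ℝ)) (fun i j => ?_) (fun i e he heb y hy => ?_)
      (fun e i l hi hl y hy => ?_) i)
    · exact M.pderiv_eq_zero_of_isWeakGrad_zero (hgrad i ▸ M.weakGrad_spec p i) (hE i).2.2 j
    · exact (hpb i e he y hy).trans (hp e heb y (interior_subset hy))
    · exact (hpb i e hi y hy).trans (hpb l e hl y hy).symm
  have hu0 : ∀ i, u.1 i = 0 := by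
    intro i
    have := M.eq_zero_of_harmonic hΩ (fun i b => (u.1 i b : MvPolynomial (Fin 3) ℝ))
      (fun i a b => M.pderiv_comm_of_isWeakCurl_zero
        ((hE i).1 ▸ M.weakCurl_spec u i) (hE i).2.1 a b)
      (fun i => M.div_eq_zero_of_b_eq_zero hb i) ?_ ?_ i
    · ext1 b
      exact Subtype.ext (congrFun this b)
    · intro i e he heb y hy a
      have hn := M.normal_isUnitNormal he
      have h := (hE i).2.1 e he y hy
      rw [jump, map_sub, LinearMap.sub_apply, hu i e he heb y (interior_subset hy), sub_zero] at h
      have h' := eq_smul_of_cross_eq_zero hn.1 h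
      change Poly.vec (u.1 i) ((M.face e).chart y) ⬝ᵥ (M.face e).tangent a = 0
      rw [h', smul_dotProduct, hn.2 a, smul_zero]
    · intro e heb i l hil hi hl y hy b
      have hn := M.normal_isUnitNormal hi
      have hneg := M.normal_eq_neg hi hl hil
      have hs := M.sum_normal_eq_zero_of_b_eq_zero hb heb y hy
      have hset : (Finset.univ.filter fun i => e ∈ M.faces i) = {i, l} := by
        ext m
        simp only [Finset.mem_filter, Finset.mem_univ, true_and, Finset.mem_insert,
          Finset.mem_singleton]
        refine ⟨M.eq_or_eq_of_mem_faces hi hl hil, ?_⟩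
        rintro (rfl | rfl) <;> assumption
      -- The normal jump vanishes here; the tangential one vanishes because both traces share the
      -- single value `u_b`.
      rw [hset, Finset.sum_pair hil, hneg, dotProduct_neg, ← sub_eq_add_neg,
        ← sub_dotProduct] at hs
      have j1 := (hE i).2.1 e hi y hy
      have j2 := (hE l).2.1 e hl y hy
      rw [jump, hneg, map_neg, neg_eq_zero] at j2
      rw [jump] at j1
      have j3 : (Poly.vec (u.1 i) ((M.face e).chart y) - Poly.vec (u.1 l) ((M.face e).chart y)) ⨯₃
          M.normal i e = 0 := by
        rw [← sub_sub_sub_cancel_right _ _ (M.bVal u e y), map_sub, LinearMap.sub_apply, j1, j2,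
          sub_zero]
      have h' := eq_smul_of_cross_eq_zero hn.1 j3
      rw [hs, zero_smul, sub_eq_zero] at h'
      exact congrFun h' b
  refine ⟨Prod.ext (funext hu0) (funext fun e => funext fun a => ?_),
    Prod.ext (funext hp0) (funext fun e => ?_)⟩
  · obtain ⟨i, hi⟩ := M.face_used e
    refine Poly.eq_zero_of_val (M.face e).polygonal.nonempty_interior fun y hy => ?_
    have hn := M.normal_isUnitNormal hi
    have h := (hE i).2.1 e hi y hy
    -- Once `u₀ = 0`, the jump condition says `u_b × n = 0`, while `u_b` is tangential by
    -- construction.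
    rw [jump, hu0 i, hvec0, zero_sub, map_neg, LinearMap.neg_apply, neg_eq_zero] at h
    have h' := eq_smul_of_cross_eq_zero hn.1 h
    rw [M.bVal_dotProduct_normal u hi, zero_smul] at h'
    rw [← M.bVal_dotProduct_tangent u e y a, h', zero_dotProduct]
  · obtain ⟨i, hi⟩ := M.face_used e
    refine Poly.eq_zero_of_val (M.face e).polygonal.nonempty_interior fun y hy => ?_
    rw [← hpb i e hi y hy, hp0 i, Poly.val_zero]

end Mesh

/-! ### From uniqueness to unique solvability, and the boundary data. -/

/-- A bilinear form that is nondegenerate on a finite-dimensional subspace is uniquely solvable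
there. -/
theorem existsUnique_of_nondegenerate {E : Type*} [AddCommGroup E] [Module ℝ E]
    [FiniteDimensional ℝ E] (B : E →ₗ[ℝ] E →ₗ[ℝ] ℝ) (X : Submodule ℝ E)
    (hB : ∀ x ∈ X, (∀ y ∈ X, B x y = 0) → x = 0) (L : E →ₗ[ℝ] ℝ) :
    ∃! x, x ∈ X ∧ ∀ y ∈ X, B x y = L y := by
  set T : X →ₗ[ℝ] Module.Dual ℝ X := B.domRestrict₁₂ X X with hT
  have hinj : Function.Injective T := by
    rw [injective_iff_map_eq_zero]
    intro x hx
    exact Subtype.ext (hB x x.2 fun y hy => LinearMap.congr_fun hx ⟨y, hy⟩)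
  have hsurj : Function.Surjective T :=
    (LinearMap.injective_iff_surjective_of_finrank_eq_finrank
      (Subspace.dual_finrank_eq (K := ℝ) (V := X)).symm).1 hinj
  obtain ⟨x, hx⟩ := hsurj (L.domRestrict X)
  refine ⟨x, ⟨x.2, fun y hy => LinearMap.congr_fun hx ⟨y, hy⟩⟩, fun x' hx' => ?_⟩
  have : (⟨x', hx'.1⟩ : X) = x := hinj (by
    rw [hx]
    exact LinearMap.ext fun y => hx'.2 y y.2)
  exact congrArg Subtype.val this

namespace Mesh

variable {Ω : Set (Fin 3 → ℝ)} {ι κ : Type*} {k : ℕ}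

/-- The product `V_{h,0} × W_h` as a subspace. -/
def testSpace (M : Mesh Ω ι κ) (k : ℕ) : Submodule ℝ (VSpace ι κ k × WPair ι κ k) where
  carrier := {x | x.1 ∈ M.V0 k ∧ x.2 ∈ M.W k}
  add_mem' {x y} hx hy := by
    refine ⟨fun i e he heb z hz => ?_, fun e heb z hz => ?_⟩
    · rw [Prod.fst_add, bVal_add, cross_add_left, hx.1 i e he heb z hz, hy.1 i e he heb z hz,
        add_zero]
    · rw [Prod.snd_add, Prod.snd_add, Pi.add_apply, Poly.val_add, hx.2 e heb z hz,
        hy.2 e heb z hz, add_zero]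
  zero_mem' := by
    refine ⟨fun i e he heb z hz => ?_, fun e heb z hz => Poly.val_zero z⟩
    change M.bVal ((0, 0) : VSpace ι κ k) e z ⨯₃ M.normal i e = 0
    rw [bVal_zero_right, map_zero, LinearMap.zero_apply]
  smul_mem' c x hx := by
    refine ⟨fun i e he heb z hz => ?_, fun e heb z hz => ?_⟩
    · rw [Prod.smul_fst, bVal_smul, cross_smul_left, hx.1 i e he heb z hz, smul_zero]
    · rw [Prod.smul_snd, Prod.smul_snd, Pi.smul_apply, Poly.val_smul, hx.2 e heb z hz, mul_zero]

/-- A tangential vector is recovered from the tangential components of its rotation. -/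
theorem cross_tangent_sum {F : Face} {n : Fin 3 → ℝ} (hn : F.IsUnitNormal n) {c : Fin 3 → ℝ}
    (hc : c ⬝ᵥ n = 0) :
    (((F.tangent 0 ⨯₃ n) ⬝ᵥ c) • F.tangent 0 + ((F.tangent 1 ⨯₃ n) ⬝ᵥ c) • F.tangent 1) ⨯₃ n =
      c := by
  have h1 : ∀ t : Fin 3 → ℝ, (t ⨯₃ n) ⬝ᵥ c = (n ⨯₃ c) ⬝ᵥ t := fun t => by
    simp only [cross_apply, dotProduct, Fin.sum_univ_three, Matrix.cons_val]
    ring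
  have h2 : (n ⨯₃ c) ⬝ᵥ n = 0 := by
    simp only [cross_apply, dotProduct, Fin.sum_univ_three, Matrix.cons_val]
    ring
  -- The bracket is the expansion of the tangential vector `n × c`, and `(n × c) × n = c` for `c ⊥
  -- n`.
  have h3 : ((F.tangent 0 ⨯₃ n) ⬝ᵥ c) • F.tangent 0 + ((F.tangent 1 ⨯₃ n) ⬝ᵥ c) • F.tangent 1 =
      n ⨯₃ c := by
    ext j
    rw [hn.resolve (n ⨯₃ c) j, h2, zero_mul, add_zero, h1, h1]
    rfl
  rw [h3]
  have hn1 := hn.1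
  simp only [dotProduct, Fin.sum_univ_three] at hn1 hc
  ext j
  fin_cases j <;> simp [cross_apply]
  · linear_combination c 0 * hn1 - n 0 * hc
  · linear_combination c 1 * hn1 - n 1 * hc
  · linear_combination c 2 * hn1 - n 2 * hc

/-- Polynomial tangential boundary data are attained. -/
theorem exists_lift [Finite κ] (hΩ : interior (closure Ω) = Ω) (M : Mesh Ω ι κ)
    (Φ : κ → Fin 3 → Poly 2 k)
    (hΦ : ∀ i, ∀ e ∈ M.faces i, M.IsBoundary e → ∀ y ∈ (M.face e).dom,
      Poly.vec (Φ e) y ⬝ᵥ M.normal i e = 0) :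
    ∃ v : VSpace ι κ k, ∀ i, ∀ e ∈ M.faces i, M.IsBoundary e → ∀ y ∈ (M.face e).dom,
      M.bVal v e y ⨯₃ M.normal i e = Poly.vec (Φ e) y := by
  choose s hs using M.face_used
  -- The coefficients of `n × Φ` in the tangent frame, again polynomials of degree `k`. The normal
  -- comes from one chosen element, which on a boundary face is the only one.
  refine ⟨(0, fun e a => ∑ m, ((M.face e).tangent a ⨯₃ M.normal (s e) e) m • Φ e m), ?_⟩
  intro i e he heb y hy
  obtain rfl := M.eq_of_isBoundary hΩ he (hs e) heb
  have hval : ∀ a, (∑ m, ((M.face e).tangent a ⨯₃ M.normal (s e) e) m • Φ e m).val y =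
      ((M.face e).tangent a ⨯₃ M.normal (s e) e) ⬝ᵥ Poly.vec (Φ e) y := fun a => by
    simp only [Poly.val_sum, Poly.val_smul]
    rfl
  simp only [bVal, hval]
  exact cross_tangent_sum (M.normal_isUnitNormal he) (hΦ _ e he heb y hy)

/-- The projection of a tangential field is tangential. -/
theorem faceProj_dotProduct_normal (M : Mesh Ω ι κ) {φ : (Fin 3 → ℝ) → Fin 3 → ℝ} {e : κ}
    (hφ : MemLp (fun y => φ ((M.face e).chart y)) 2 (volume.restrict (M.face e).dom))
    {n : Fin 3 → ℝ}
    (hn : ∀ᵐ y ∂volume.restrict (M.face e).dom, φ ((M.face e).chart y) ⬝ᵥ n = 0)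
    (y : Fin 2 → ℝ) : Poly.vec (M.faceProj k φ e) y ⬝ᵥ n = 0 := by
  have hspec : M.IsFaceProj k φ e (M.faceProj k φ e) :=
    Classical.epsilon_spec (M.existsUnique_isFaceProj k φ e hφ).exists
  set Q := M.faceProj k φ e
  set r : Poly 2 k := ∑ j, n j • Q j with hr
  have hrval : ∀ y, r.val y = Poly.vec Q y ⬝ᵥ n := fun y => by
    simp only [hr, Poly.val_sum, Poly.val_smul, dotProduct, Poly.vec, mul_comm]
  -- The projection is tested with `r n`, where `r` is its normal component; the right side vanishes
  -- and `∫ r² = 0` remains.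
  have h := hspec fun j => n j • r
  have hvec : ∀ y, Poly.vec (fun j => n j • r) y = r.val y • n := fun y => by
    ext j
    simp only [Poly.vec, Poly.val_smul, Pi.smul_apply, smul_eq_mul, mul_comm]
  simp only [hvec, dotProduct_smul, ← hrval, smul_eq_mul] at h
  rw [integral_eq_zero_of_ae (f := fun y => r.val y * (φ ((M.face e).chart y) ⬝ᵥ n)) (by
    filter_upwards [hn] with y hy
    rw [hy, mul_zero, Pi.zero_apply])] at h
  have h0 : r = 0 := Poly.eq_zero_of_val (M.face e).polygonal.nonempty_interior fun y hy =>
    mul_self_eq_zero.1 (eq_zero_of_setIntegral_eq_zero (M.face e).polygonal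
      ((Poly.continuous_val _).mul (Poly.continuous_val _)) (fun x => mul_self_nonneg _) h y hy)
  rw [← hrval, h0, Poly.val_zero]

variable [Fintype ι]

/-- The lift `v` makes the affine boundary condition linear. Adding the two equations loses nothing,
because testing with `(w, 0)` and `(0, q)` separates them again. -/
theorem isSolution_iff [Finite κ] (hΩ : interior (closure Ω) = Ω) (M : Mesh Ω ι κ)
    {ν : (Fin 3 → ℝ) → ℝ} (hν : IntegrableOn ν Ω)
    {f : (Fin 3 → ℝ) → Fin 3 → ℝ} (hf : MemLp f 2 (volume.restrict Ω))
    {g : (Fin 3 → ℝ) → ℝ} (hg : MemLp g 2 (volume.restrict Ω)) {Φ : κ → Fin 3 → Poly 2 k}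
    {v : VSpace ι κ k} (hv : ∀ i, ∀ e ∈ M.faces i, M.IsBoundary e → ∀ y ∈ (M.face e).dom,
      M.bVal v e y ⨯₃ M.normal i e = Poly.vec (Φ e) y)
    (x : VSpace ι κ k × WPair ι κ k) :
    M.IsSolution ν f g Φ (x + (v, 0)).1 (x + (v, 0)).2 ↔
      x ∈ M.testSpace k ∧ ∀ y ∈ M.testSpace k, M.systemForm hΩ k hν x y =
        (M.systemLoad hΩ k hf hg - M.systemForm hΩ k hν (v, 0)) y := by
  have hform : ∀ x y, M.systemForm hΩ k hν x y =
    M.a ν x.1 y.1 - M.b y.1 x.2 + (M.b x.1 y.2 + M.s₂ x.2 y.2) := fun _ _ => rfl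
  have hload : ∀ y, M.systemLoad hΩ k hf hg y =
    (∑ i, ∫ x in M.elem i, f x ⬝ᵥ Poly.vec (y.1.1 i) x) -
      ∑ i, ∫ x in M.elem i, g x * (y.2.1 i).val x := fun _ => rfl
  have hcomb : (∀ y ∈ M.testSpace k, M.systemForm hΩ k hν x y =
      (M.systemLoad hΩ k hf hg - M.systemForm hΩ k hν (v, 0)) y) ↔
      ∀ y ∈ M.testSpace k, M.systemForm hΩ k hν (x + (v, 0)) y = M.systemLoad hΩ k hf hg y := by
    refine forall₂_congr fun y _ => ?_
    rw [LinearMap.sub_apply, map_add, LinearMap.add_apply, eq_sub_iff_add_eq]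
  rw [hcomb]
  set z := x + (v, 0) with hz
  have hz2 : z.2 = x.2 := by simp [hz]
  have hbc : (∀ i, ∀ e ∈ M.faces i, M.IsBoundary e → ∀ y ∈ (M.face e).dom,
      M.bVal z.1 e y ⨯₃ M.normal i e = Poly.vec (Φ e) y) ↔ x.1 ∈ M.V0 k := by
    refine forall₂_congr fun i e => forall₂_congr fun he heb => forall₂_congr fun y hy => ?_
    rw [hz, Prod.fst_add, bVal_add, cross_add_left, hv i e he heb y hy, add_eq_right]
  rw [IsSolution, hbc, hz2]
  constructor
  · rintro ⟨hp, hu, h1, h2⟩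
    refine ⟨⟨hu, hp⟩, fun y hy => ?_⟩
    rw [hform, hload, hz2, h1 y.1 hy.1, h2 y.2 hy.2]
    ring
  · rintro ⟨⟨hu, hp⟩, h⟩
    refine ⟨hp, hu, fun w hw => ?_, fun q hq => ?_⟩
    · have h0 := h (w, 0) ⟨hw, (M.testSpace k).zero_mem.2⟩
      have e1 := M.b_smul_right 0 z.1 0
      have e2 := M.s₂_smul_left 0 0 x.2
      rw [zero_smul, zero_mul] at e1 e2
      rw [hform, hload] at h0
      simpa [e1, M.s₂_comm x.2 0, e2, Poly.val_zero, hz2] using h0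
    · have h0 := h (0, q) ⟨(M.testSpace k).zero_mem.1, hq⟩
      have e1 := M.b_smul_left 0 0 x.2
      have e2 := M.a_smul_left ν 0 0 z.1
      rw [zero_smul, zero_mul] at e1 e2
      have e3 : ∀ x, Poly.vec (0 : Fin 3 → Poly 3 k) x = 0 := fun x => funext fun j =>
        Poly.val_zero x
      rw [hform, hload] at h0
      simpa [e1, M.a_comm ν z.1 0, e2, e3, hz2] using h0

theorem existsUnique_isSolution [Finite κ] (hΩ : interior (closure Ω) = Ω) (M : Mesh Ω ι κ)
    {ν : (Fin 3 → ℝ) → ℝ} (hν : IntegrableOn ν Ω) (hνpos : ∀ᵐ x ∂volume.restrict Ω, 0 < ν x)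
    {f : (Fin 3 → ℝ) → Fin 3 → ℝ} (hf : MemLp f 2 (volume.restrict Ω))
    {g : (Fin 3 → ℝ) → ℝ} (hg : MemLp g 2 (volume.restrict Ω)) (Φ : κ → Fin 3 → Poly 2 k)
    (hΦ : ∀ i, ∀ e ∈ M.faces i, M.IsBoundary e → ∀ y ∈ (M.face e).dom,
      Poly.vec (Φ e) y ⬝ᵥ M.normal i e = 0) :
    ∃! up : VSpace ι κ k × WPair ι κ k, M.IsSolution ν f g Φ up.1 up.2 := by
  obtain ⟨v, hv⟩ := M.exists_lift hΩ Φ hΦ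
  have hnd : ∀ x ∈ M.testSpace k, (∀ y ∈ M.testSpace k, M.systemForm hΩ k hν x y = 0) → x = 0 := by
    intro x hx h
    -- An element of the kernel solves the scheme with all data and the lift equal to zero.
    have h0 := (M.isSolution_iff hΩ hν (f := 0) (g := 0) (Φ := 0) (v := 0) MemLp.zero MemLp.zero
      (fun i e _ _ y _ => ?_) x).2 ⟨hx, fun y hy => ?_⟩
    · obtain ⟨-, -, h1, h2⟩ := h0
      rw [show x + ((0 : VSpace ι κ k), (0 : WPair ι κ k)) = x from add_zero x] at h1 h2
      have := M.eq_zero_of_homogeneous hΩ hν hνpos hx.1 hx.2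
        (fun w hw => by simpa using h1 w hw) fun q hq => by simpa using h2 q hq
      exact Prod.ext this.1 this.2
    · change M.bVal ((0, 0) : VSpace ι κ k) e y ⨯₃ M.normal i e = _
      rw [bVal_zero_right, map_zero, LinearMap.zero_apply]
      exact (funext fun j => Poly.val_zero y).symm
    · rw [h y hy, show ((0 : VSpace ι κ k), (0 : WPair ι κ k)) = 0 from rfl, map_zero, sub_zero]
      simp [systemLoad]
  have := Fintype.ofFinite κ
  obtain ⟨x, hx, huniq⟩ := existsUnique_of_nondegenerate (M.systemForm hΩ k hν) (M.testSpace k) hnd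
    (M.systemLoad hΩ k hf hg - M.systemForm hΩ k hν (v, 0))
  refine ⟨x + (v, 0), (M.isSolution_iff hΩ hν hf hg hv x).2 hx, fun z hz => ?_⟩
  rw [← huniq (z - (v, 0)) ((M.isSolution_iff hΩ hν hf hg hv _).1 (by rwa [sub_add_cancel])),
    sub_add_cancel]

end Mesh

end WG

end

theorem mainTheorem5 {ι κ : Type*} [Fintype ι] [Fintype κ] {Ω : Set (Fin 3 → ℝ)}
    (hΩ : interior (closure Ω) = Ω) (M : WG.Mesh Ω ι κ) (k : ℕ) (hk : 1 ≤ k)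
    (ν : (Fin 3 → ℝ) → ℝ) (hν : IntegrableOn ν Ω) (hνpos : ∀ᵐ x ∂volume.restrict Ω, 0 < ν x)
    (f : (Fin 3 → ℝ) → Fin 3 → ℝ) (hf : MemLp f 2 (volume.restrict Ω))
    (g : (Fin 3 → ℝ) → ℝ) (hg : MemLp g 2 (volume.restrict Ω)) :
    (∀ Φ : κ → Fin 3 → WG.Poly 2 k,
      (∀ i, ∀ e ∈ M.faces i, M.IsBoundary e → ∀ y ∈ (M.face e).dom,
        WG.Poly.vec (Φ e) y ⬝ᵥ M.normal i e = 0) →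
      ∃! up : WG.VSpace ι κ k × WG.WPair ι κ k, M.IsSolution ν f g Φ up.1 up.2) ∧
    (∀ φ : (Fin 3 → ℝ) → Fin 3 → ℝ,
      (∀ e, M.IsBoundary e →
        MemLp (fun y => φ ((M.face e).chart y)) 2 (volume.restrict (M.face e).dom)) →
      (∀ i, ∀ e ∈ M.faces i, M.IsBoundary e →
        ∀ᵐ y ∂volume.restrict (M.face e).dom, φ ((M.face e).chart y) ⬝ᵥ M.normal i e = 0) →
      ∃! up : WG.VSpace ι κ k × WG.WPair ι κ k,
        M.IsSolution ν f g (M.faceProj k φ) up.1 up.2) :=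
  ⟨fun Φ hΦ => M.existsUnique_isSolution hΩ hν hνpos hf hg Φ hΦ,
    -- Only boundary faces enter: on the others, where `φ` need not be square integrable, `faceProj`
    -- is never read.
    fun _ hφ hφn => M.existsUnique_isSolution hΩ hν hνpos hf hg _ fun i e he heb y _ =>
      M.faceProj_dotProduct_normal (hφ e heb) (hφn i e he heb) y⟩
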